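/- Let $(\Omega,\mathcal F,\mu)$ be a probability space, $T\colon\Omega\to\Omega$ a bijective, bi-measurable, measure-preserving map, and $\mathcal M\subset\mathcal F$ a sub-$\sigma$-algebra with $T\mathcal M\subset\mathcal M$. Write $Uf=f\circ T$, and for $f\colon\Omega\to\mathbb R$, $n\geqslant 1$, $t\in[0,1]$, $$S_n(f)=\sum_{j=0}^{n-1}f\circ T^j,\qquad W(n,f,t)=S_{[nt]}(f)+(nt-[nt])\,f\circ T^{[nt]}.$$ For $\alpha\in(0,1)$ let $\mathcal H_\alpha$ be the space of functions $x\colon[0,1]\to\mathbb R$ with finite norm $$\|x\|_{\mathcal H_\alpha}=\sup_{0\leqslant s<t\leqslant 1}\frac{|x(t)-x(s)|}{(t-s)^\alpha}+|x(0)|,$$ and let $\mathcal H_\alpha^o\subset\mathcal H_\alpha$ be the closed subspace of those $x$ with $\lim_{\delta\to0}\sup_{0<|t-s|<\delta}|x(t)-x(s)|/|t-s|^\alpha=0$. Let $p>2$, let $H$ be a linear subspace of $\mathbb L^p=\mathbb L^p(\Omega,\mathcal F,\mu)$, and let $(P_{T^k})_{k\geqslant1}$ be linear operators from $H$ to itself.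 Condition (C) means: 1. $P_{T^k}=P_T^k$ for each $k\geqslant 1$; 2. $P_T$ is power bounded on $H$: $\sup_{n\geqslant1}\sup_{f\in H\setminus\{0\}}\|P_T^nf\|_p/\|f\|_p<+\infty$; 3. for each $f\in H$ with $P_Tf=0$, the sequence $(f\circ T^i)_{i\geqslant0}$ is a martingale difference sequence with respect to $(T^{-i}\mathcal M)_{i\geqslant0}$ or with respect to $(T^{-i-1}\mathcal M)_{i\geqslant0}$; 4. either $U^{-1}H\subset H$ and $P_TU^{-1}f=f$ for each $f\in H$, or $UH\subset H$ and $P_TUf=f$ for each $f\in H$. Here $(X_i)_{i\ge 0}$ is a martingale difference sequence with respect to $(\mathcal F_i)_{i\ge 0}$ if every $X_i$ is integrable and (up to a null set) $\mathcal F_i$-measurable and $\mathbb E[X_{i+1}\mid\mathcal F_i]=0$ almost surely for every $i\geqslant0$. **Proposition.** Assume that $(T,(P_{T^k})_{k\geqslant1})$ satisfies condition (C) on $H\subset\mathbb L^p$, $p>2$, and that $h\in H$ satisfies $$\|h\|_{\mathrm{MW}(p,P_T)}:=\sum_{j=0}^{+\infty}2^{-j/2}\Big\|\sum_{i=0}^{2^j-1}P_T^ih\Big\|_p<+\infty.$$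 Then $n^{-1/2}W(n,h,\cdot)$, $n\geqslant 1$, are random elements of $\mathcal H_{1/2-1/p}$ (Borel measurable, with all paths in $\mathcal H^o_{1/2-1/p}$), and the sequence $(n^{-1/2}W(n,h,\cdot))_{n\geqslant1}$ is tight in $\mathcal H_{1/2-1/p}$: for each $\varepsilon>0$ there is a compact $K\subset\mathcal H_{1/2-1/p}$ with $\mu\{n^{-1/2}W(n,h,\cdot)\notin K\}\leqslant\varepsilon$ for every $n\geqslant1$. -/

import Mathlib

open MeasureTheory Topology
open scoped NNReal ENNReal unitInterval

/-! ### The Hölder space on `[0,1]` -/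

/-- The real functions on `[0,1]` that are Hölder continuous with exponent `α`. -/
def holderSubmodule (α : ℝ≥0) : Submodule ℝ (I → ℝ) where
  carrier := {x | MemHolder α x}
  add_mem' := fun hx hy => hx.add hy
  zero_mem' := memHolder_zero
  smul_mem' := fun _ _ hx => hx.smul

/-- The Hölder space `H_α[0,1]`; it is a type of its own, so that its only norm and topology are
the Hölder ones given below. -/
def HolderSpace (α : ℝ≥0) : Type := holderSubmodule α

namespace HolderSpace

variable {α : ℝ≥0}

instance : AddCommGroup (HolderSpace α) := inferInstanceAs (AddCommGroup (holderSubmodule α))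

instance : Module ℝ (HolderSpace α) := inferInstanceAs (Module ℝ (holderSubmodule α))

instance : FunLike (HolderSpace α) I ℝ where
  coe x := x.1
  coe_injective := Subtype.val_injective

theorem memHolder (x : HolderSpace α) : MemHolder α (x : I → ℝ) := x.2

/-- `‖x‖ = sup_{s < t} |x t - x s| / (t - s) ^ α + |x 0|`; the first summand is Mathlib's
`nnHolderNorm`, the least `C` with `|x t - x s| ≤ C |t - s| ^ α` for all `s, t`. -/
noncomputable instance : Norm (HolderSpace α) where
  norm x := (nnHolderNorm α (x : I → ℝ) : ℝ) + |x 0|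

theorem norm_def (x : HolderSpace α) : ‖x‖ = (nnHolderNorm α (x : I → ℝ) : ℝ) + |x 0| := rfl

theorem coe_add (x y : HolderSpace α) : ((x + y : HolderSpace α) : I → ℝ) = x + y := rfl

theorem coe_smul (c : ℝ) (x : HolderSpace α) : ((c • x : HolderSpace α) : I → ℝ) = c • ⇑x := rfl

theorem coe_zero : ((0 : HolderSpace α) : I → ℝ) = 0 := rfl

theorem normCore (α : ℝ≥0) : NormedSpace.Core ℝ (HolderSpace α) where
  norm_nonneg x := by rw [norm_def]; positivity
  norm_smul c x := by
    rw [norm_def, norm_def, coe_smul, x.memHolder.nnHolderNorm_smul]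
    simp [abs_mul, mul_add]
  norm_triangle x y := by
    have h1 : (nnHolderNorm α (x + y : I → ℝ) : ℝ)
        ≤ nnHolderNorm α (x : I → ℝ) + nnHolderNorm α (y : I → ℝ) := by
      exact_mod_cast x.memHolder.nnHolderNorm_add_le y.memHolder
    have h2 : |x 0 + y 0| ≤ |x 0| + |y 0| := abs_add_le _ _
    rw [norm_def, norm_def, norm_def, coe_add, Pi.add_apply]
    linarith
  norm_eq_zero_iff x := by
    constructor
    · intro h
      rw [norm_def] at h
      have h0 := abs_nonneg (x 0)
      have h1 : (0 : ℝ) ≤ nnHolderNorm α (x : I → ℝ) := NNReal.coe_nonneg _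
      have h2 : nnHolderNorm α (x : I → ℝ) = 0 := by
        apply NNReal.coe_eq_zero.mp; linarith
      have h3 : x 0 = 0 := abs_eq_zero.mp (by linarith)
      have h4 := (x.memHolder.nnHolderNorm_eq_zero).mp h2
      apply DFunLike.coe_injective
      funext t
      rw [h4 t 0, h3, coe_zero, Pi.zero_apply]
    · rintro rfl
      rw [norm_def, coe_zero, nnHolderNorm_zero]
      simp

noncomputable instance : NormedAddCommGroup (HolderSpace α) :=
  NormedAddCommGroup.ofCore (normCore α)

noncomputable instance : NormedSpace ℝ (HolderSpace α) := NormedSpace.ofCore (normCore α)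

noncomputable instance : MeasurableSpace (HolderSpace α) := borel _

instance : BorelSpace (HolderSpace α) := ⟨rfl⟩

/-- The subset `H_α^o[0,1]` of those `x` whose modulus of Hölder continuity
`sup {|x t - x s| / |t - s| ^ α : 0 < |t - s| < δ}` tends to `0` as `δ → 0`. -/
def little (α : ℝ≥0) : Set (HolderSpace α) :=
  {x | ∀ ε : ℝ, 0 < ε → ∃ δ : ℝ, 0 < δ ∧ ∀ s t : I, 0 < |(t : ℝ) - s| → |(t : ℝ) - s| < δ →
    |x t - x s| / |(t : ℝ) - s| ^ (α : ℝ) ≤ ε}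

end HolderSpace

/-! ### The partial sum process -/

/-- `W(n,f,T,t) = S_{[nt]}(T,f) + (nt - [nt]) f ∘ T^{[nt]}` at the point `ω`, where
`S_k(T,f) = ∑_{j < k} f ∘ T^j`. -/
noncomputable def partialSumProcess {Ω : Type*} (T : Ω → Ω) (f : Ω → ℝ) (n : ℕ) (ω : Ω) (t : I) :
    ℝ :=
  birkhoffSum T f ⌊(n : ℝ) * t⌋₊ ω
    + ((n : ℝ) * t - (⌊(n : ℝ) * t⌋₊ : ℝ)) * f (T^[⌊(n : ℝ) * t⌋₊] ω)

/-! ### Martingale differences and condition (C) -/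

section ConditionC

variable {Ω : Type*}

/-- The filtration `(T^{-i-s} 𝓜)_{i ≥ 0}`, for a sub-σ-algebra `𝓜` with `T 𝓜 ⊆ 𝓜`. -/
def pullbackFiltration (𝓜 : MeasurableSpace Ω) {mΩ : MeasurableSpace Ω} (T : Ω ≃ᵐ Ω) (h𝓜 : 𝓜 ≤ mΩ)
    (hT𝓜 : ∀ A, MeasurableSet[𝓜] A → MeasurableSet[𝓜] (T '' A)) (s : ℕ) : Filtration ℕ mΩ where
  seq i := 𝓜.comap (T^[i + s])
  mono' := by
    refine monotone_nat_of_le_succ fun i => ?_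
    rintro _ ⟨A, hA, rfl⟩
    refine ⟨T '' A, hT𝓜 A hA, ?_⟩
    rw [Nat.add_right_comm, Function.iterate_succ', Set.preimage_comp,
      Set.preimage_image_eq A T.injective]
  le' i := by
    rintro _ ⟨A, hA, rfl⟩
    exact (T.measurable.iterate (i + s)) (h𝓜 A hA)

/-- `(X_i)_{i ≥ 0}` is a martingale difference sequence with respect to `(ℱ_i)_{i ≥ 0}`: each
`X_i` is integrable and (after modification on a null set) `ℱ_i`-measurable, and
`E[X_{i+1} | ℱ_i] = 0` almost surely. -/
structure IsMartingaleDifference {mΩ : MeasurableSpace Ω} (μ : Measure Ω) (ℱ : Filtration ℕ mΩ)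
    (X : ℕ → Ω → ℝ) : Prop where
  integrable : ∀ i, Integrable (X i) μ
  adapted : ∀ i, AEStronglyMeasurable[ℱ i] (X i) μ
  condExp_eq_zero : ∀ i, μ[X (i + 1) | ℱ i] =ᵐ[μ] 0

/-- The Koopman operator `U f = f ∘ T` on `L^p`. -/
noncomputable def koopman {mΩ : MeasurableSpace Ω} {μ : Measure Ω} (p : ℝ≥0∞) (T : Ω ≃ᵐ Ω)
    (hT : MeasurePreserving T μ μ) :
    Lp ℝ p μ →ₗ[ℝ] Lp ℝ p μ :=
  Lp.compMeasurePreservingₗ ℝ T hT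

/-- The inverse `U⁻¹ f = f ∘ T⁻¹` of the Koopman operator on `L^p`. -/
noncomputable def koopmanInv {mΩ : MeasurableSpace Ω} {μ : Measure Ω} (p : ℝ≥0∞) (T : Ω ≃ᵐ Ω)
    (hT : MeasurePreserving T μ μ) :
    Lp ℝ p μ →ₗ[ℝ] Lp ℝ p μ :=
  Lp.compMeasurePreservingₗ ℝ T.symm (hT.symm T)

/-- Condition (C) for `(T, (P_{T^k})_{k ≥ 1})` on the subspace `H` of `L^p`, where `P k` stands for
`P_{T^k}` (the value `P 0` plays no role), so that `P_T` is `P 1`. -/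
structure ConditionC (𝓜 : MeasurableSpace Ω) {mΩ : MeasurableSpace Ω} {μ : Measure Ω} {p : ℝ≥0∞}
    (T : Ω ≃ᵐ Ω) (hT : MeasurePreserving T μ μ) (h𝓜 : 𝓜 ≤ mΩ)
    (hT𝓜 : ∀ A, MeasurableSet[𝓜] A → MeasurableSet[𝓜] (T '' A))
    (H : Submodule ℝ (Lp ℝ p μ)) (P : ℕ → Module.End ℝ H) : Prop where
  semigroup : ∀ k, 1 ≤ k → P k = P 1 ^ k
  powerBounded : ∃ K : ℝ, ∀ n : ℕ, 1 ≤ n → ∀ f : H,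
    ‖((P 1 ^ n) f : Lp ℝ p μ)‖ ≤ K * ‖(f : Lp ℝ p μ)‖
  martingale : ∀ f : H, P 1 f = 0 →
    IsMartingaleDifference μ (pullbackFiltration 𝓜 T h𝓜 hT𝓜 0)
        (fun i ω => (f : Lp ℝ p μ) (T^[i] ω)) ∨
      IsMartingaleDifference μ (pullbackFiltration 𝓜 T h𝓜 hT𝓜 1)
        (fun i ω => (f : Lp ℝ p μ) (T^[i] ω))
  /-- Either `U⁻¹ H ⊆ H` and `P_T U⁻¹ = I` on `H`, or `U H ⊆ H` and `P_T U = I` on `H`. -/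
  inverse :
    (∃ hH : ∀ f ∈ H, koopmanInv p T hT f ∈ H,
        ∀ f : H, P 1 ⟨koopmanInv p T hT f, hH f f.2⟩ = f) ∨
      (∃ hH : ∀ f ∈ H, koopman p T hT f ∈ H,
        ∀ f : H, P 1 ⟨koopman p T hT f, hH f f.2⟩ = f)

/-- `‖f‖_{MW(p,Q)} = ∑_{j ≥ 0} 2^{-j/2} ‖∑_{i < 2^j} Q^i f‖_p ∈ [0,∞]`. -/
noncomputable def mwNorm {mΩ : MeasurableSpace Ω} {μ : Measure Ω} {p : ℝ≥0∞}
    {H : Submodule ℝ (Lp ℝ p μ)} (Q : Module.End ℝ H) (f : H) :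
    ℝ≥0∞ :=
  ∑' j : ℕ, ENNReal.ofReal ((2 : ℝ) ^ (-(j : ℝ) / 2) *
    ‖((∑ i ∈ Finset.range (2 ^ j), (Q ^ i) f : H) : Lp ℝ p μ)‖)

end ConditionC

/-! Put α = 1/2 - 1/p, let S_k be the partial sums of f along T, and let `holderMax α T f n l` be
the largest |S_j - S_i| / (j - i)^α over i < j ≤ n with j - i ≤ l. Linear interpolation costs a
factor 3, and n^{-1/2} n^α = n^{-1/p}. By Markov's inequality and a compactness criterion, tightness
therefore follows from two bounds on the mean of `holderMax` for f = h: it is at most C n^{1/p}, and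
it is at most ε n^{1/p} when l ≤ δ n and n is large (`HolderSpace.isTightMeasureSet_partialSumPath`,
`ConditionC.lintegral_holderMax`).

Both bounds come from grouping summands into pairs. Replacing (T, f) by (T², f + f∘T) costs twice
the largest summand and gains a factor 2^{-α} (`holderMax_le_pairing`). Condition (C) writes f +
f∘T, up to shifts, as f + P_T f plus a martingale difference whose norm is at most a constant times
‖f‖_p. After r pairings the transformation is T^{2^r} and the function is the sum of P_T^i h over i
< 2^r. Since 2^{-α} (n/2)^{1/p} = 2^{-1/2} n^{1/p}, the costs add up to the Maxwell–Woodroofe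
series; this is the first bound. For the second, the largest summand and the short-range martingale
terms are negligible at each of R pairings, and what remains is bounded by the tail of the series
from R on (`IsCascade.lintegral_small`).

For martingale differences D (`lintegral_holderMax_le`), chaining reduces everything to dyadic
blocks. With a threshold x, D is truncated for blocks of length 2^k at x (n/2^k)^{1/p}; the small
part is estimated by a moment of order 2m > p, the large part by the second moment. Summed over all
blocks, the estimates decay geometrically in k on both sides of |D|^p 2^k = x^p n. This gives a
bound by the L^p norm, with an additional factor that makes the integral vanish as l/n tends to 0.
-/

/-! ### Innovations and moments of their partial sums -/

/-- `f` is measurable with respect to `G'` up to a null set and has zero conditional expectation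
given `G`. -/
structure IsInnovation {Ω : Type*} {mΩ : MeasurableSpace Ω} (μ : Measure Ω)
    (G G' : MeasurableSpace Ω) (f : Ω → ℝ) : Prop where
  aesm : AEStronglyMeasurable[G'] f μ
  condExp_eq : μ[f | G] =ᵐ[μ] 0

/-- Trading powers of the smaller of |s| and |d| for powers of the larger leaves only the two
extreme monomials. This disposes of all binomial terms of order at least 2 in d at once. -/
theorem pow_mul_pow_le_add (s d : ℝ) {m k : ℕ} (hm : 1 ≤ m) (hk : 2 ≤ k) (hkm : k ≤ 2 * m) :
    s ^ (2 * m - k) * d ^ k ≤ s ^ (2 * m - 2) * d ^ 2 + d ^ (2 * m) := by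
  have e1 : s ^ (2 * m - 2) = |s| ^ (2 * m - 2) := by
    rw [← abs_pow, abs_of_nonneg]; exact Even.pow_nonneg ⟨m - 1, by omega⟩ s
  have e2 : d ^ (2 * m) = |d| ^ (2 * m) := by
    rw [← abs_pow, abs_of_nonneg]; exact Even.pow_nonneg ⟨m, by omega⟩ d
  have e3 : s ^ (2 * m - k) * d ^ k ≤ |s| ^ (2 * m - k) * |d| ^ k := by
    rw [← abs_pow, ← abs_pow, ← abs_mul]; exact le_abs_self _
  rw [e1, e2, ← sq_abs d]
  refine e3.trans ?_
  rcases le_total |d| |s| with h | h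
  · have : |s| ^ (2 * m - k) * |d| ^ k ≤ |s| ^ (2 * m - 2) * |d| ^ 2 := by
      calc |s| ^ (2 * m - k) * |d| ^ k = |s| ^ (2 * m - k) * (|d| ^ (k - 2) * |d| ^ 2) := by
            rw [← pow_add]; congr 2; omega
        _ ≤ |s| ^ (2 * m - k) * (|s| ^ (k - 2) * |d| ^ 2) := by gcongr
        _ = |s| ^ (2 * m - 2) * |d| ^ 2 := by
            rw [← mul_assoc, ← pow_add]; congr 2; omega
    have h0 : 0 ≤ |d| ^ (2 * m) := by positivity
    linarith
  · have : |s| ^ (2 * m - k) * |d| ^ k ≤ |d| ^ (2 * m) := by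
      calc |s| ^ (2 * m - k) * |d| ^ k ≤ |d| ^ (2 * m - k) * |d| ^ k := by gcongr
        _ = |d| ^ (2 * m) := by rw [← pow_add]; congr 1; omega
    have h0 : 0 ≤ |s| ^ (2 * m - 2) * |d| ^ 2 := by positivity
    linarith

/-- The term linear in d is kept exactly, because orthogonality will kill it. The other binomial
coefficients add up to at most 2^{2m} = 4^m. -/
theorem add_pow_two_mul_le (s d : ℝ) {m : ℕ} (hm : 1 ≤ m) :
    (s + d) ^ (2 * m) ≤ s ^ (2 * m) + 2 * m * (s ^ (2 * m - 1) * d)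
      + 4 ^ m * (s ^ (2 * m - 2) * d ^ 2 + d ^ (2 * m)) := by
  have h0 : 0 ≤ s ^ (2 * m - 2) * d ^ 2 + d ^ (2 * m) :=
    add_nonneg (mul_nonneg (Even.pow_nonneg ⟨m - 1, by omega⟩ s) (sq_nonneg d))
      (Even.pow_nonneg ⟨m, by omega⟩ d)
  obtain ⟨N, hN⟩ : ∃ N, 2 * m = N + 1 := ⟨2 * m - 1, by omega⟩
  rw [add_comm s d, add_pow, hN, Finset.sum_range_succ', Finset.sum_range_succ', ← hN]
  have h2 : ∑ k ∈ Finset.range N, d ^ (k + 1 + 1) * s ^ (2 * m - (k + 1 + 1)) *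
      ((2 * m).choose (k + 1 + 1) : ℝ)
      ≤ 4 ^ m * (s ^ (2 * m - 2) * d ^ 2 + d ^ (2 * m)) := by
    calc _ ≤ ∑ k ∈ Finset.range N, (s ^ (2 * m - 2) * d ^ 2 + d ^ (2 * m)) *
          ((2 * m).choose (k + 1 + 1) : ℝ) := by
          refine Finset.sum_le_sum fun k hk => ?_
          gcongr
          rw [mul_comm]
          exact pow_mul_pow_le_add s d hm (by omega) (by have := Finset.mem_range.1 hk; omega)
      _ = (s ^ (2 * m - 2) * d ^ 2 + d ^ (2 * m)) *
          ((∑ k ∈ Finset.range N, (2 * m).choose (k + 1 + 1) : ℕ) : ℝ) := by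
          rw [← Finset.mul_sum]; push_cast; rfl
      _ ≤ (s ^ (2 * m - 2) * d ^ 2 + d ^ (2 * m)) * 4 ^ m := by
          gcongr
          have : ∑ k ∈ Finset.range N, (2 * m).choose (k + 1 + 1) ≤ 4 ^ m := by
            have h3 := Nat.sum_range_choose (2 * m)
            rw [pow_mul, hN, Finset.sum_range_succ', Finset.sum_range_succ'] at h3
            rw [hN]
            norm_num at h3 ⊢
            omega
          exact_mod_cast this
      _ = _ := mul_comm _ _
  have h1 : (d ^ (0 + 1) * s ^ (2 * m - (0 + 1)) * ((2 * m).choose (0 + 1) : ℝ))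
      = 2 * m * (s ^ (2 * m - 1) * d) := by
    simp; ring
  rw [h1]
  simp only [pow_zero, Nat.sub_zero, Nat.choose_zero_right, Nat.cast_one, one_mul, mul_one]
  linarith

/-- Young's inequality, by comparing d² with s²/N. The weight N will be the number of summands, so
that the coefficient of s^{2m} stays harmless after N steps. -/
theorem pow_mul_sq_le_young (s d : ℝ) {m : ℕ} (hm : 1 ≤ m) {N : ℝ} (hN : 0 < N) :
    s ^ (2 * m - 2) * d ^ 2 ≤ N⁻¹ * s ^ (2 * m) + N ^ (m - 1) * d ^ (2 * m) := by
  obtain ⟨l, rfl⟩ : ∃ l, m = l + 1 := ⟨m - 1, by omega⟩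
  have e : 2 * (l + 1) - 2 = 2 * l := by omega
  rw [e, pow_mul, pow_mul, pow_mul, Nat.add_sub_cancel]
  have hs := sq_nonneg s
  have hd := sq_nonneg d
  generalize s ^ 2 = x at *
  generalize d ^ 2 = y at *
  rcases le_total y (N⁻¹ * x) with h | h
  · have : x ^ l * y ≤ x ^ l * (N⁻¹ * x) := by gcongr
    have h2 : 0 ≤ N ^ l * y ^ (l + 1) := by positivity
    calc _ ≤ _ := this
      _ = N⁻¹ * x ^ (l + 1) := by ring
      _ ≤ _ := by linarith
  · have hx : x ≤ N * y := by
      rw [inv_mul_le_iff₀ hN] at h; exact h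
    have : x ^ l * y ≤ (N * y) ^ l * y := by gcongr
    have h2 : 0 ≤ N⁻¹ * x ^ (l + 1) := by positivity
    calc _ ≤ _ := this
      _ = N ^ l * y ^ (l + 1) := by rw [mul_pow]; ring
      _ ≤ _ := by linarith

section Moments

variable {Ω : Type*} {G : MeasurableSpace Ω} {mΩ : MeasurableSpace Ω} {μ : Measure Ω}

theorem integral_mul_eq_zero_of_condExp [IsFiniteMeasure μ] (hG : G ≤ mΩ) {z d : Ω → ℝ}
    (hz : AEStronglyMeasurable[G] z μ) (hd : Integrable d μ) (hzd : Integrable (z * d) μ)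
    (h : μ[d | G] =ᵐ[μ] 0) : ∫ ω, z ω * d ω ∂μ = 0 := by
  have h1 := condExp_mul_of_aestronglyMeasurable_left hz hzd hd
  calc ∫ ω, z ω * d ω ∂μ = ∫ ω, (μ[z * d | G]) ω ∂μ := (integral_condExp hG).symm
    _ = ∫ ω, 0 ∂μ := by
        refine integral_congr_ae ?_
        filter_upwards [h1, h] with ω h1 h2
        rw [h1, Pi.mul_apply, h2]; simp
    _ = 0 := by simp

/-- The sum of `d` over the `n` points preceding the present. -/
noncomputable def pastSum (T : Ω ≃ᵐ Ω) (d : Ω → ℝ) (n : ℕ) : Ω → ℝ :=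
  birkhoffSum T.symm (d ∘ T.symm) n

theorem pastSum_succ (T : Ω ≃ᵐ Ω) (d : Ω → ℝ) (n : ℕ) :
    pastSum T d (n + 1) = (fun ω => pastSum T d n ω + d ω) ∘ T.symm := by
  funext ω
  simp only [pastSum, birkhoffSum_succ', Function.comp_apply]
  ring

theorem birkhoffSum_iterate_symm (T : Ω ≃ᵐ Ω) (d : Ω → ℝ) (n : ℕ) (ω : Ω) :
    birkhoffSum T d n (T.symm^[n] ω) = pastSum T d n ω := by
  induction n generalizing ω with
  | zero => simp [pastSum]
  | succ n ih =>
    have h : T^[n] (T.symm^[n] (T.symm ω)) = T.symm ω :=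
      Function.LeftInverse.iterate T.apply_symm_apply n (T.symm ω)
    rw [birkhoffSum_succ, Function.iterate_succ_apply, ih, h, pastSum_succ]
    rfl

/-- Adding d to a `G`-measurable sum gives something measurable for T⁻¹G, and composing with T⁻¹
returns it to `G`. Summing over the past thus needs the single σ-algebra `G` for every n, with d
always orthogonal to what precedes it. -/
theorem aestronglyMeasurable_pastSum {T : Ω ≃ᵐ Ω} (hT : MeasurePreserving T μ μ)
    (hGT : G ≤ G.comap T)
    {d : Ω → ℝ} (hd : AEStronglyMeasurable[G.comap T] d μ) (n : ℕ) :
    AEStronglyMeasurable[G] (pastSum T d n) μ := by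
  induction n with
  | zero => simpa [pastSum] using aestronglyMeasurable_zero
  | succ n ih =>
    rw [pastSum_succ]
    have h1 : AEStronglyMeasurable[G.comap T] (fun ω => pastSum T d n ω + d ω) μ :=
      (ih.mono hGT).add hd
    obtain ⟨g, hg, hfg⟩ := h1
    refine ⟨g ∘ T.symm, ?_, ?_⟩
    · refine hg.comp_measurable ?_
      rintro _ ⟨A, hA, rfl⟩
      have : T.symm ⁻¹' (T ⁻¹' A) = A := by
        rw [← Set.preimage_comp]; simp
      rwa [this]
    · exact (hT.symm T).quasiMeasurePreserving.ae_eq_comp hfg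

theorem measurable_pastSum (T : Ω ≃ᵐ Ω) {d : Ω → ℝ} (hd : Measurable d) (n : ℕ) :
    Measurable (pastSum T d n) := by
  induction n with
  | zero => simpa [pastSum] using measurable_zero
  | succ n ih => rw [pastSum_succ]; exact (ih.add hd).comp T.symm.measurable

theorem measurable_birkhoffSum {T : Ω → Ω} (hT : Measurable T) {d : Ω → ℝ} (hd : Measurable d)
    (n : ℕ) : Measurable (birkhoffSum T d n) := by
  unfold birkhoffSum
  exact Finset.measurable_sum _ fun k _ => hd.comp (hT.iterate k)

/-- The factor by which the moment of order `2 m` grows. -/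
noncomputable def momentConst (m : ℕ) : ℝ := 2 * 4 ^ m * Real.exp (4 ^ m)

theorem momentConst_pos (m : ℕ) : 0 < momentConst m := by unfold momentConst; positivity

theorem integrable_pow_mul_pow {s d : Ω → ℝ} {m k : ℕ} (hs : Measurable s) (hd : Measurable d)
    (hk : k ≤ 2 * m) (hs2 : Integrable (fun ω => s ω ^ (2 * m)) μ)
    (hd2 : Integrable (fun ω => d ω ^ (2 * m)) μ) :
    Integrable (fun ω => s ω ^ (2 * m - k) * d ω ^ k) μ := by
  refine (hs2.add hd2).mono' ((hs.pow_const _).mul (hd.pow_const _)).aestronglyMeasurable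
    (Filter.Eventually.of_forall fun ω => ?_)
  rw [Pi.add_apply, Real.norm_eq_abs, abs_mul, abs_pow, abs_pow,
    ← (even_two_mul m).pow_abs (s ω), ← (even_two_mul m).pow_abs (d ω)]
  have e : 2 * m = 2 * m - k + k := by omega
  rcases le_total |s ω| |d ω| with h | h
  · calc |s ω| ^ (2 * m - k) * |d ω| ^ k ≤ |d ω| ^ (2 * m - k) * |d ω| ^ k := by gcongr
      _ = |d ω| ^ (2 * m) := by rw [← pow_add, ← e]
      _ ≤ _ := le_add_of_nonneg_left (by positivity)
  · calc |s ω| ^ (2 * m - k) * |d ω| ^ k ≤ |s ω| ^ (2 * m - k) * |s ω| ^ k := by gcongr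
      _ = |s ω| ^ (2 * m) := by rw [← pow_add, ← e]
      _ ≤ _ := le_add_of_nonneg_right (by positivity)

theorem integrable_add_pow {s d : Ω → ℝ} {m : ℕ} (hs : Measurable s) (hd : Measurable d)
    (hs2 : Integrable (fun ω => s ω ^ (2 * m)) μ)
    (hd2 : Integrable (fun ω => d ω ^ (2 * m)) μ) :
    Integrable (fun ω => (s ω + d ω) ^ (2 * m)) μ := by
  simp_rw [fun ω => add_comm (s ω) (d ω), add_pow]
  refine integrable_finsetSum _ fun k hk => ?_
  have := integrable_pow_mul_pow hs hd (Nat.lt_succ_iff.1 (Finset.mem_range.1 hk)) hs2 hd2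
  refine (this.mul_const ((2 * m).choose k : ℝ)).congr (Filter.Eventually.of_forall fun ω => ?_)
  simp only []
  ring

/-- A discrete Gronwall argument: each new summand multiplies the moment by 1 + 4^m/N and adds a
term of order N^{m-1}. The horizon N is fixed throughout the induction on n ≤ N. -/
theorem integral_pow_pastSum_le [IsFiniteMeasure μ] {T : Ω ≃ᵐ Ω} (hT : MeasurePreserving T μ μ)
    (hG : G ≤ mΩ) (hGT : G ≤ G.comap T)
    {d : Ω → ℝ} (hdm : Measurable d) (hd : IsInnovation μ G (G.comap T) d) {m : ℕ} (hm : 1 ≤ m)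
    (hd2 : Integrable (fun ω => d ω ^ (2 * m)) μ) {N : ℕ} (hN : 1 ≤ N) (n : ℕ) (hn : n ≤ N) :
    Integrable (fun ω => pastSum T d n ω ^ (2 * m)) μ ∧
    ∫ ω, pastSum T d n ω ^ (2 * m) ∂μ ≤
      (1 + 4 ^ m / N) ^ n * (n * (4 ^ m * (2 * N ^ (m - 1)))) * ∫ ω, d ω ^ (2 * m) ∂μ := by
  have hN0 : (0 : ℝ) < N := by exact_mod_cast hN
  have hd1 : Integrable d μ := by
    refine (hd2.add (integrable_const 1)).mono' hdm.aestronglyMeasurable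
      (Filter.Eventually.of_forall fun ω => ?_)
    rw [Pi.add_apply, Real.norm_eq_abs, ← (even_two_mul m).pow_abs (d ω)]
    rcases le_total |d ω| 1 with h | h
    · have : 0 ≤ |d ω| ^ (2 * m) := by positivity
      linarith
    · have := le_self_pow₀ h (show 2 * m ≠ 0 by omega)
      linarith
  induction n with
  | zero =>
    have : 2 * m ≠ 0 := by omega
    simp [pastSum, this]
  | succ n ih =>
    obtain ⟨ih1, ih2⟩ := ih (by omega)
    have hR := measurable_pastSum T hdm n
    have hi := integrable_add_pow hR hdm ih1 hd2
    have e1 : (fun ω => pastSum T d (n + 1) ω ^ (2 * m))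
        = (fun ω => (pastSum T d n ω + d ω) ^ (2 * m)) ∘ T.symm := by
      rw [pastSum_succ]; rfl
    rw [e1]
    refine ⟨(hT.symm T).integrable_comp_of_integrable hi, ?_⟩
    have e2 : ∫ ω, ((fun ω => (pastSum T d n ω + d ω) ^ (2 * m)) ∘ T.symm) ω ∂μ
        = ∫ ω, (pastSum T d n ω + d ω) ^ (2 * m) ∂μ :=
      (hT.symm T).integral_comp T.symm.measurableEmbedding
        (fun ω => (pastSum T d n ω + d ω) ^ (2 * m))
    rw [e2]
    set R := pastSum T d n with hRdef
    have hRd : Integrable (fun ω => R ω ^ (2 * m - 1) * d ω) μ := by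
      simpa using integrable_pow_mul_pow (k := 1) hR hdm (by omega) ih1 hd2
    -- The martingale property enters only here: the linear term of the expansion vanishes.
    have hz : ∫ ω, R ω ^ (2 * m - 1) * d ω ∂μ = 0 :=
      integral_mul_eq_zero_of_condExp hG
        ((aestronglyMeasurable_pastSum hT hGT hd.aesm n).pow _) hd1 hRd hd.condExp_eq
    have hpt : ∀ ω, (R ω + d ω) ^ (2 * m) ≤
        ((1 + 4 ^ m / N) * R ω ^ (2 * m) + 2 * m * (R ω ^ (2 * m - 1) * d ω))
          + 4 ^ m * (2 * N ^ (m - 1)) * d ω ^ (2 * m) := by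
      intro ω
      have h1 := add_pow_two_mul_le (R ω) (d ω) hm
      have h2 := pow_mul_sq_le_young (R ω) (d ω) hm hN0
      have h3 : d ω ^ (2 * m) ≤ N ^ (m - 1) * d ω ^ (2 * m) :=
        le_mul_of_one_le_left ((even_two_mul m).pow_nonneg _)
          (one_le_pow₀ (by exact_mod_cast hN))
      have h4 : (4 : ℝ) ^ m * (R ω ^ (2 * m - 2) * d ω ^ 2 + d ω ^ (2 * m)) ≤
          4 ^ m * ((N : ℝ)⁻¹ * R ω ^ (2 * m) + N ^ (m - 1) * d ω ^ (2 * m)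
            + N ^ (m - 1) * d ω ^ (2 * m)) := by gcongr
      rw [div_eq_mul_inv]
      linarith
    have hb : 0 ≤ ∫ ω, d ω ^ (2 * m) ∂μ :=
      integral_nonneg fun ω => (even_two_mul m).pow_nonneg _
    have hA : Integrable
        (fun ω => (1 + 4 ^ m / N) * R ω ^ (2 * m) + 2 * m * (R ω ^ (2 * m - 1) * d ω)) μ :=
      (ih1.const_mul _).add (hRd.const_mul _)
    have h5 : ∫ ω, (R ω + d ω) ^ (2 * m) ∂μ ≤ (1 + 4 ^ m / N) * ∫ ω, R ω ^ (2 * m) ∂μ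
        + 4 ^ m * (2 * N ^ (m - 1)) * ∫ ω, d ω ^ (2 * m) ∂μ := by
      calc _ ≤ ∫ ω, (((1 + 4 ^ m / N) * R ω ^ (2 * m) + 2 * m * (R ω ^ (2 * m - 1) * d ω))
          + 4 ^ m * (2 * N ^ (m - 1)) * d ω ^ (2 * m)) ∂μ :=
            integral_mono hi (hA.add (hd2.const_mul _)) hpt
        _ = _ := by
            rw [integral_add hA (hd2.const_mul _),
              integral_add (ih1.const_mul _) (hRd.const_mul _), integral_const_mul,
              integral_const_mul, integral_const_mul, hz]
            ring
    refine h5.trans ?_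
    have h6 : (1 : ℝ) ≤ (1 + 4 ^ m / N) ^ (n + 1) := one_le_pow₀ (by
      have : (0 : ℝ) ≤ 4 ^ m / N := by positivity
      linarith)
    set b := ∫ ω, d ω ^ (2 * m) ∂μ
    set K : ℝ := 4 ^ m * (2 * N ^ (m - 1))
    have hK : 0 ≤ K := by positivity
    set c : ℝ := 1 + 4 ^ m / N
    have hc : 0 ≤ c := by positivity
    push_cast
    calc c * ∫ ω, R ω ^ (2 * m) ∂μ + K * b ≤ c * (c ^ n * (n * K) * b) + c ^ (n + 1) * (K * b) := by
          exact add_le_add (mul_le_mul_of_nonneg_left (ih2) hc)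
            (le_mul_of_one_le_left (by positivity) h6)
      _ = _ := by ring

/-- The moment of order `2 m` of a sum of `n` stationary martingale differences is at most of
order `n ^ m`. -/
theorem integral_pow_birkhoffSum_le [IsFiniteMeasure μ] {T : Ω ≃ᵐ Ω} (hT : MeasurePreserving T μ μ)
    (hG : G ≤ mΩ) (hGT : G ≤ G.comap T)
    {d : Ω → ℝ} (hdm : Measurable d) (hd : IsInnovation μ G (G.comap T) d) {m : ℕ} (hm : 1 ≤ m)
    (hd2 : Integrable (fun ω => d ω ^ (2 * m)) μ) {n : ℕ} (hn : 1 ≤ n) :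
    Integrable (fun ω => birkhoffSum T d n ω ^ (2 * m)) μ ∧
    ∫ ω, birkhoffSum T d n ω ^ (2 * m) ∂μ ≤
      momentConst m * (n : ℝ) ^ m * ∫ ω, d ω ^ (2 * m) ∂μ := by
  -- The horizon is taken to be n itself; the Birkhoff sum has the same law as the sum over the
  -- past.
  obtain ⟨h1, h2⟩ := integral_pow_pastSum_le hT hG hGT hdm hd hm hd2 hn n le_rfl
  have hσ := (hT.symm T).iterate n
  have e : (fun ω => pastSum T d n ω ^ (2 * m))
      = (fun ω => birkhoffSum T d n ω ^ (2 * m)) ∘ T.symm^[n] := by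
    funext ω; simp only [Function.comp_apply, birkhoffSum_iterate_symm]
  have hm' : AEStronglyMeasurable (fun ω => birkhoffSum T d n ω ^ (2 * m)) μ :=
    ((measurable_birkhoffSum T.measurable hdm n).pow_const _).aestronglyMeasurable
  rw [e] at h1
  refine ⟨(hσ.integrable_comp hm').1 h1, ?_⟩
  have e2 : ∫ ω, pastSum T d n ω ^ (2 * m) ∂μ = ∫ ω, birkhoffSum T d n ω ^ (2 * m) ∂μ := by
    rw [e]
    have h3 := integral_map (μ := μ) hσ.measurable.aemeasurable
      (f := fun ω => birkhoffSum T d n ω ^ (2 * m)) (by rw [hσ.map_eq]; exact hm')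
    rw [hσ.map_eq] at h3
    exact h3.symm
  rw [e2] at h2
  refine h2.trans ?_
  have hb : 0 ≤ ∫ ω, d ω ^ (2 * m) ∂μ :=
    integral_nonneg fun ω => (even_two_mul m).pow_nonneg _
  refine mul_le_mul_of_nonneg_right ?_ hb
  have hn0 : (0 : ℝ) < n := by exact_mod_cast hn
  have h4 : (1 + (4 : ℝ) ^ m / n) ^ n ≤ Real.exp (4 ^ m) := by
    calc (1 + (4 : ℝ) ^ m / n) ^ n ≤ (Real.exp (4 ^ m / n)) ^ n := by
          gcongr
          rw [add_comm]; exact Real.add_one_le_exp _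
      _ = Real.exp (4 ^ m) := by
          rw [← Real.exp_nat_mul]; congr 1; field_simp
  have h5 : (n : ℝ) * (4 ^ m * (2 * (n : ℝ) ^ (m - 1))) = 2 * 4 ^ m * (n : ℝ) ^ m := by
    obtain ⟨l, rfl⟩ : ∃ l, m = l + 1 := ⟨m - 1, by omega⟩
    rw [Nat.add_sub_cancel]; ring
  rw [h5, momentConst]
  calc _ ≤ Real.exp (4 ^ m) * (2 * 4 ^ m * (n : ℝ) ^ m) := by gcongr
    _ = _ := by ring

end Moments

/-! ### Hölder maxima of partial sums -/

/-- The constant of the dyadic chaining argument. -/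
noncomputable def chainConst (α : ℝ) : ℝ := 2 / (2 ^ α - 1)

theorem two_rpow_sub_one_pos {α : ℝ} (hα : 0 < α) : 0 < (2 : ℝ) ^ α - 1 := by
  have := Real.one_lt_rpow (by norm_num : (1 : ℝ) < 2) hα
  linarith

theorem chainConst_pos {α : ℝ} (hα : 0 < α) : 0 < chainConst α :=
  div_pos two_pos (two_rpow_sub_one_pos hα)

/-- Round i up and j down to even indices, at the cost of two unit increments 2Q, and pass to k ↦ S
(2k) with Q 2^α in place of Q. The subtracted constant c = `chainConst α` makes the induction close:
it solves c (2^α - 1) = 2, which absorbs the 2Q. The number N only bounds j - i for the induction.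
-/
theorem abs_sub_le_of_dyadic_aux {α : ℝ} (hα : 0 < α) (N : ℕ) : ∀ (S : ℕ → ℝ) (n l : ℕ) (Q : ℝ),
    (∀ k b : ℕ, 2 ^ k ≤ l → (b + 1) * 2 ^ k ≤ n →
      |S ((b + 1) * 2 ^ k) - S (b * 2 ^ k)| ≤ Q * ((2 : ℝ) ^ k) ^ α) →
    0 ≤ Q → ∀ i j : ℕ, i < j → j ≤ n → j ≤ i + l → j ≤ i + N →
    |S j - S i| ≤ Q * ((chainConst α + 2) * ((j : ℝ) - i) ^ α - chainConst α) := by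
  have hc := chainConst_pos hα
  induction N with
  | zero => intro S n l Q _ _ i j h1 h2 h3 h4; omega
  | succ N ih =>
    intro S n l Q h hQ i j hij hjn hjl hjN
    have step : ∀ b, b + 1 ≤ n → |S (b + 1) - S b| ≤ Q := by
      intro b hb
      simpa using h 0 b (by rw [pow_zero]; omega) (by simpa using hb)
    have hm1 : (1 : ℝ) ≤ (j : ℝ) - i := by
      have : (i : ℝ) + 1 ≤ j := by exact_mod_cast hij
      linarith
    have hmα : (1 : ℝ) ≤ ((j : ℝ) - i) ^ α := Real.one_le_rpow hm1 hα.le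
    have hbase : 2 * Q ≤ Q * ((chainConst α + 2) * ((j : ℝ) - i) ^ α - chainConst α) := by
      have : (chainConst α + 2) * 1 ≤ (chainConst α + 2) * ((j : ℝ) - i) ^ α := by gcongr
      nlinarith
    have hj2 : |S j - S (2 * (j / 2))| ≤ Q := by
      rcases Nat.even_or_odd' j with ⟨a, rfl | rfl⟩
      · simpa using hQ
      · have : (2 * a + 1) / 2 = a := by omega
        rw [this]; exact step _ (by omega)
    have hi2 : |S (2 * ((i + 1) / 2)) - S i| ≤ Q := by
      rcases Nat.even_or_odd' i with ⟨a, rfl | rfl⟩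
      · have : (2 * a + 1) / 2 = a := by omega
        rw [this]; simpa using hQ
      · have : 2 * ((2 * a + 1 + 1) / 2) = 2 * a + 1 + 1 := by omega
        rw [this]; exact step _ (by omega)
    rcases Nat.lt_or_ge j (i + 2) with h1 | h1
    · have : j = i + 1 := by omega
      subst this
      exact (step i hjn).trans (le_trans (by linarith) hbase)
    have htri : |S j - S i| ≤ |S (2 * (j / 2)) - S (2 * ((i + 1) / 2))| + 2 * Q := by
      have e : S j - S i = (S j - S (2 * (j / 2))) + (S (2 * (j / 2)) - S (2 * ((i + 1) / 2)))
        + (S (2 * ((i + 1) / 2)) - S i) := by ring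
      rw [e]
      refine (abs_add_three _ _ _).trans ?_
      linarith
    rcases (show (i + 1) / 2 ≤ j / 2 by omega).eq_or_lt with h2 | h2
    · rw [h2, sub_self, abs_zero, zero_add] at htri
      exact htri.trans hbase
    · have hS := ih (fun k => S (2 * k)) (n / 2) (l / 2) (Q * 2 ^ α) (by
        intro k b hk hb
        have := h (k + 1) b (by rw [pow_succ]; omega) (by rw [pow_succ, ← mul_assoc]; omega)
        have e1 : 2 * ((b + 1) * 2 ^ k) = (b + 1) * 2 ^ (k + 1) := by ring
        have e2 : 2 * (b * 2 ^ k) = b * 2 ^ (k + 1) := by ring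
        simp only [e1, e2]
        refine this.trans_eq ?_
        rw [pow_succ, Real.mul_rpow (by positivity) (by positivity)]
        ring) (by positivity) ((i + 1) / 2) (j / 2) h2 (by omega) (by omega) (by omega)
      have hhalf : (((j / 2 : ℕ) : ℝ) - ((i + 1) / 2 : ℕ)) ≤ ((j : ℝ) - i) / 2 := by
        have : 2 * (j / 2) + i ≤ j + 2 * ((i + 1) / 2) := by omega
        have : (2 : ℝ) * ((j / 2 : ℕ) : ℝ) + i ≤ j + 2 * (((i + 1) / 2 : ℕ) : ℝ) := by
          exact_mod_cast this
        linarith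
      have hpos : (0 : ℝ) ≤ (((j / 2 : ℕ) : ℝ) - ((i + 1) / 2 : ℕ)) := by
        have : (((i + 1) / 2 : ℕ) : ℝ) ≤ ((j / 2 : ℕ) : ℝ) := by exact_mod_cast h2.le
        linarith
      have hpow : (((j / 2 : ℕ) : ℝ) - ((i + 1) / 2 : ℕ)) ^ α ≤ ((j : ℝ) - i) ^ α / 2 ^ α := by
        rw [← Real.div_rpow (by linarith) (by norm_num)]
        exact Real.rpow_le_rpow hpos hhalf hα.le
      have hc2 : chainConst α * (2 ^ α - 1) = 2 := by
        rw [chainConst, div_mul_cancel₀ _ (two_rpow_sub_one_pos hα).ne']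
      have h2α : (0 : ℝ) < 2 ^ α := by positivity
      calc |S j - S i| ≤ _ := htri
        _ ≤ Q * 2 ^ α * ((chainConst α + 2) * (((j : ℝ) - i) ^ α / 2 ^ α) - chainConst α)
            + 2 * Q := by
            have : Q * 2 ^ α * ((chainConst α + 2) *
                (((j / 2 : ℕ) : ℝ) - ((i + 1) / 2 : ℕ)) ^ α - chainConst α) ≤
                Q * 2 ^ α * ((chainConst α + 2) * (((j : ℝ) - i) ^ α / 2 ^ α) - chainConst α) := by
              gcongr
            linarith
        _ = Q * ((chainConst α + 2) * ((j : ℝ) - i) ^ α - chainConst α * (2 ^ α - 1) + 2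
              - chainConst α) := by
            field_simp
            ring
        _ = _ := by rw [hc2]; ring

/-- A sequence whose dyadic increments of length `2 ^ k ≤ l` are at most `Q (2 ^ k) ^ α` is
`α`-Hölder at distances up to `l`. -/
theorem abs_sub_le_of_dyadic {α : ℝ} (hα : 0 < α) {S : ℕ → ℝ} {n l : ℕ} {Q : ℝ} (hQ : 0 ≤ Q)
    (h : ∀ k b : ℕ, 2 ^ k ≤ l → (b + 1) * 2 ^ k ≤ n →
      |S ((b + 1) * 2 ^ k) - S (b * 2 ^ k)| ≤ Q * ((2 : ℝ) ^ k) ^ α)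
    {i j : ℕ} (hij : i < j) (hjn : j ≤ n) (hjl : j ≤ i + l) :
    |S j - S i| ≤ (chainConst α + 2) * Q * ((j : ℝ) - i) ^ α := by
  have h1 := abs_sub_le_of_dyadic_aux hα (j - i) S n l Q h hQ i j hij hjn hjl (by omega)
  have := mul_nonneg hQ (chainConst_pos hα).le
  calc _ ≤ _ := h1
    _ ≤ _ := by linarith

section HolderMax

variable {Ω : Type*}

/-- The largest `|S_j - S_i| / (j - i) ^ α` over `i < j ≤ n` with `j - i ≤ l`, for the partial sums
`S_k` of `f` along `T`. -/
noncomputable def holderMax (α : ℝ) (T : Ω → Ω) (f : Ω → ℝ) (n l : ℕ) (ω : Ω) : ℝ≥0∞ :=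
  ⨆ (i : ℕ) (j : ℕ) (_ : i < j ∧ j ≤ n ∧ j ≤ i + l),
    ENNReal.ofReal (|birkhoffSum T f j ω - birkhoffSum T f i ω| / ((j : ℝ) - i) ^ α)

variable {α : ℝ} {T : Ω → Ω} {f g : Ω → ℝ} {n l : ℕ} {ω : Ω}

theorem holderMax_le {c : ℝ≥0∞} (h : ∀ i j : ℕ, i < j → j ≤ n → j ≤ i + l →
    ENNReal.ofReal (|birkhoffSum T f j ω - birkhoffSum T f i ω| / ((j : ℝ) - i) ^ α) ≤ c) :
    holderMax α T f n l ω ≤ c :=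
  iSup₂_le fun i j => iSup_le fun hij => h i j hij.1 hij.2.1 hij.2.2

theorem le_holderMax {i j : ℕ} (hij : i < j) (hj : j ≤ n) (hl : j ≤ i + l) :
    ENNReal.ofReal (|birkhoffSum T f j ω - birkhoffSum T f i ω| / ((j : ℝ) - i) ^ α)
      ≤ holderMax α T f n l ω :=
  le_iSup₂_of_le i j (le_iSup_of_le ⟨hij, hj, hl⟩ le_rfl)

@[simp]
theorem holderMax_zero_left : holderMax α T f 0 l ω = 0 :=
  le_antisymm (holderMax_le fun i j h1 h2 _ => by omega) bot_le

theorem measurable_holderMax [MeasurableSpace Ω] (hT : Measurable T) (hf : Measurable f) :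
    Measurable (holderMax α T f n l) := by
  refine Measurable.iSup fun i => Measurable.iSup fun j => Measurable.iSup fun _ => ?_
  have h1 := measurable_birkhoffSum hT hf j
  have h2 := measurable_birkhoffSum hT hf i
  fun_prop

theorem holderMax_add_le :
    holderMax α T (f + g) n l ω ≤ holderMax α T f n l ω + holderMax α T g n l ω := by
  refine holderMax_le fun i j hij hj hl => ?_
  refine le_trans ?_ (add_le_add (le_holderMax hij hj hl) (le_holderMax hij hj hl))
  rw [birkhoffSum_add', birkhoffSum_add']
  have : (0 : ℝ) ≤ (j : ℝ) - i := sub_nonneg.2 (by exact_mod_cast hij.le)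
  rw [← ENNReal.ofReal_add (by positivity) (by positivity), ← add_div]
  gcongr
  rw [add_sub_add_comm]
  exact abs_add_le _ _

theorem birkhoffSum_comp_of_commute {S : Ω → Ω} (h : Function.Commute T S) (k : ℕ) (ω : Ω) :
    birkhoffSum T (f ∘ S) k ω = birkhoffSum T f k (S ω) := by
  unfold birkhoffSum
  refine Finset.sum_congr rfl fun i _ => ?_
  rw [Function.comp_apply, (h.iterate_left i).eq]

theorem holderMax_comp {S : Ω → Ω} (h : Function.Commute T S) :
    holderMax α T (f ∘ S) n l = holderMax α T f n l ∘ S := by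
  funext ω
  simp only [holderMax, birkhoffSum_comp_of_commute h, Function.comp_apply]

theorem holderMax_congr_ae [MeasurableSpace Ω] {μ : Measure Ω} (hT : MeasurePreserving T μ μ)
    (h : f =ᵐ[μ] g) (α : ℝ) (n l : ℕ) : holderMax α T f n l =ᵐ[μ] holderMax α T g n l := by
  have : ∀ᵐ ω ∂μ, ∀ k : ℕ, f (T^[k] ω) = g (T^[k] ω) :=
    ae_all_iff.2 fun k => (hT.iterate k).quasiMeasurePreserving.ae_eq_comp h
  filter_upwards [this] with ω hω
  simp only [holderMax, birkhoffSum, hω]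

theorem birkhoffSum_two_mul (k : ℕ) (ω : Ω) :
    birkhoffSum T f (2 * k) ω = birkhoffSum (T ∘ T) (f + f ∘ T) k ω := by
  induction k with
  | zero => simp
  | succ k ih =>
    have e : (T ∘ T)^[k] = T^[2 * k] := by
      rw [Function.iterate_mul]; rfl
    rw [show 2 * (k + 1) = 2 * k + 1 + 1 by ring, birkhoffSum_succ, birkhoffSum_succ,
      birkhoffSum_succ, ih, e, Pi.add_apply, Function.comp_apply,
      Function.iterate_succ_apply' T, add_assoc]

/-- Grouping the summands into pairs. -/
theorem holderMax_le_pairing (hα : 0 < α) :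
    holderMax α T f n l ω ≤ 2 * holderMax α T f n 1 ω
      + ENNReal.ofReal (2 ^ (-α)) * holderMax α (T ∘ T) (f + f ∘ T) (n / 2) (l / 2) ω := by
  refine holderMax_le fun i j hij hj hl => ?_
  set S := fun k => birkhoffSum T f k ω with hS
  change ENNReal.ofReal (|S j - S i| / ((j : ℝ) - i) ^ α) ≤ _
  have hm1 : (1 : ℝ) ≤ (j : ℝ) - i := by
    have : (i : ℝ) + 1 ≤ j := by exact_mod_cast hij
    linarith
  have hmα : (1 : ℝ) ≤ ((j : ℝ) - i) ^ α := Real.one_le_rpow hm1 hα.le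
  have step : ∀ b, b + 1 ≤ n → ENNReal.ofReal |S (b + 1) - S b| ≤ holderMax α T f n 1 ω := by
    intro b hb
    have := le_holderMax (α := α) (T := T) (f := f) (ω := ω) (l := 1) (Nat.lt_succ_self b) hb le_rfl
    simpa using this
  -- Rounding j down or i up to an even index drops at most one summand, which the maximum over
  -- increments of length 1 controls; the denominator (j - i)^α is at least 1.
  have hj2 : ENNReal.ofReal |S j - S (2 * (j / 2))| ≤ holderMax α T f n 1 ω := by
    rcases Nat.even_or_odd' j with ⟨a, rfl | rfl⟩
    · simp
    · have : (2 * a + 1) / 2 = a := by omega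
      rw [this]; exact step _ (by omega)
  have hi2 : ENNReal.ofReal |S (2 * ((i + 1) / 2)) - S i| ≤ holderMax α T f n 1 ω := by
    rcases Nat.even_or_odd' i with ⟨a, rfl | rfl⟩
    · have : (2 * a + 1) / 2 = a := by omega
      rw [this]; simp
    · have : 2 * ((2 * a + 1 + 1) / 2) = 2 * a + 1 + 1 := by omega
      rw [this]; exact step _ (by omega)
  -- Between the even indices, S is the partial sum of the pairs, over at most half the distance;
  -- hence the factor 2^{-α}.
  have hmid : ENNReal.ofReal (|S (2 * (j / 2)) - S (2 * ((i + 1) / 2))| / ((j : ℝ) - i) ^ α)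
      ≤ ENNReal.ofReal (2 ^ (-α)) * holderMax α (T ∘ T) (f + f ∘ T) (n / 2) (l / 2) ω := by
    rcases (show (i + 1) / 2 ≤ j / 2 by omega).eq_or_lt with h2 | h2
    · rw [h2]; simp
    · refine le_trans ?_ (mul_le_mul_right (le_holderMax h2 (by omega) (by omega)) _)
      rw [← ENNReal.ofReal_mul (by positivity)]
      refine ENNReal.ofReal_le_ofReal ?_
      simp only [hS, birkhoffSum_two_mul]
      have hhalf : (((j / 2 : ℕ) : ℝ) - ((i + 1) / 2 : ℕ)) ≤ ((j : ℝ) - i) / 2 := by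
        have : 2 * (j / 2) + i ≤ j + 2 * ((i + 1) / 2) := by omega
        have : (2 : ℝ) * ((j / 2 : ℕ) : ℝ) + i ≤ j + 2 * (((i + 1) / 2 : ℕ) : ℝ) := by
          exact_mod_cast this
        linarith
      have hpos : (0 : ℝ) < (((j / 2 : ℕ) : ℝ) - ((i + 1) / 2 : ℕ)) := by
        have : (((i + 1) / 2 : ℕ) : ℝ) < ((j / 2 : ℕ) : ℝ) := by exact_mod_cast h2
        linarith
      have hpow : (((j / 2 : ℕ) : ℝ) - ((i + 1) / 2 : ℕ)) ^ α ≤ ((j : ℝ) - i) ^ α / 2 ^ α := by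
        rw [← Real.div_rpow (by linarith) (by norm_num)]
        exact Real.rpow_le_rpow hpos.le hhalf hα.le
      have hpos' := Real.rpow_pos_of_pos hpos α
      have h2α : (0 : ℝ) < 2 ^ α := by positivity
      rw [Real.rpow_neg two_pos.le, inv_mul_eq_div, div_div]
      gcongr
      rwa [le_div_iff₀ h2α] at hpow
  calc ENNReal.ofReal (|S j - S i| / ((j : ℝ) - i) ^ α)
      ≤ ENNReal.ofReal (|S j - S (2 * (j / 2))| + |S (2 * ((i + 1) / 2)) - S i|
        + |S (2 * (j / 2)) - S (2 * ((i + 1) / 2))| / ((j : ℝ) - i) ^ α) := by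
        refine ENNReal.ofReal_le_ofReal ?_
        have e : S j - S i = (S j - S (2 * (j / 2))) + (S (2 * (j / 2)) - S (2 * ((i + 1) / 2)))
          + (S (2 * ((i + 1) / 2)) - S i) := by ring
        have h3 := abs_add_three (S j - S (2 * (j / 2))) (S (2 * (j / 2)) - S (2 * ((i + 1) / 2)))
          (S (2 * ((i + 1) / 2)) - S i)
        rw [← e] at h3
        rw [div_le_iff₀ (by linarith), add_mul, div_mul_cancel₀ _ (by linarith)]
        have h4 := le_mul_of_one_le_right
          (add_nonneg (abs_nonneg (S j - S (2 * (j / 2))))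
            (abs_nonneg (S (2 * ((i + 1) / 2)) - S i))) hmα
        linarith
    _ ≤ _ := by
        rw [ENNReal.ofReal_add (by positivity) (by positivity),
          ENNReal.ofReal_add (by positivity) (by positivity), two_mul (holderMax _ _ _ _ _ _)]
        exact add_le_add (add_le_add hj2 hi2) hmid

end HolderMax

/-! ### The maximal inequality for stationary martingale differences -/

/-- A geometric sum of ratio 2^β is comparable to its last term. The minimum with 2 appears because
the last admissible k has v 2^{k+1} ≤ 2. -/
theorem sum_small_le {β : ℝ} (hβ : 0 < β) {v : ℝ} (hv : 0 ≤ v) (K : ℕ) :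
    ∑ k ∈ Finset.range K, (if v * 2 ^ k ≤ 1 then (v * 2 ^ k) ^ β else 0)
      ≤ 1 / (2 ^ β - 1) * (min 2 (v * 2 ^ K)) ^ β := by
  have h2 := two_rpow_sub_one_pos hβ
  induction K with
  | zero => simp; positivity
  | succ K ih =>
    rw [Finset.sum_range_succ]
    have hle : min 2 (v * 2 ^ K) ≤ min 2 (v * 2 ^ (K + 1)) := by
      gcongr <;> norm_num
    split_ifs with h
    · have e1 : min 2 (v * 2 ^ K) = v * 2 ^ K := min_eq_right (by linarith)
      have e2 : min 2 (v * 2 ^ (K + 1)) = 2 * (v * 2 ^ K) := by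
        rw [pow_succ, min_eq_right (by linarith)]; ring
      rw [e1] at ih
      rw [e2]
      have hy : 0 ≤ v * 2 ^ K := by positivity
      generalize v * 2 ^ K = y at *
      rw [Real.mul_rpow (by norm_num) hy]
      calc _ ≤ 1 / (2 ^ β - 1) * y ^ β + y ^ β := by gcongr
        _ = _ := by field_simp; ring
    · rw [add_zero]
      refine ih.trans ?_
      gcongr

/-- A geometric sum of ratio 2^{-γ} is comparable to its first term. Removing the level k = 0
replaces v by 2v, so the induction runs over all v. -/
theorem sum_large_le {γ : ℝ} (hγ : 0 < γ) (K : ℕ) : ∀ {v : ℝ}, 0 ≤ v →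
    ∑ k ∈ Finset.range K, (if v * 2 ^ k ≤ 1 then 0 else (v * 2 ^ k) ^ (-γ))
      ≤ 1 / (1 - 2 ^ (-γ)) * (max 1 v) ^ (-γ) := by
  have h2 : (0 : ℝ) < 1 - 2 ^ (-γ) := by
    have := Real.rpow_lt_one_of_one_lt_of_neg (by norm_num : (1 : ℝ) < 2) (neg_neg_of_pos hγ)
    linarith
  induction K with
  | zero => intro v _; simp; positivity
  | succ K ih =>
    intro v hv
    rw [Finset.sum_range_succ']
    have hs := ih (v := v * 2) (by positivity)
    have e : ∀ k : ℕ, v * 2 * 2 ^ k = v * 2 ^ (k + 1) := fun k => by ring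
    simp only [e] at hs
    rw [pow_zero, mul_one]
    split_ifs with h
    · rw [add_zero, max_eq_left h, Real.one_rpow, mul_one]
      refine hs.trans ?_
      exact mul_le_of_le_one_right (by positivity)
        (Real.rpow_le_one_of_one_le_of_nonpos (le_max_left _ _) (by linarith))
    · push Not at h
      rw [max_eq_right (by linarith)] at hs
      rw [max_eq_right h.le]
      calc _ ≤ 1 / (1 - 2 ^ (-γ)) * (v * 2) ^ (-γ) + v ^ (-γ) := by gcongr
        _ = _ := by rw [Real.mul_rpow hv (by norm_num)]; field_simp; ring

/-- The constant in `sum_dyadic_le`. -/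
noncomputable def dyadicConst (β γ : ℝ) : ℝ := 2 ^ β / (2 ^ β - 1) + 1 / (1 - 2 ^ (-γ))

theorem dyadicConst_pos {β γ : ℝ} (hβ : 0 < β) (hγ : 0 < γ) : 0 < dyadicConst β γ := by
  have h1 := two_rpow_sub_one_pos hβ
  have h2 : (0 : ℝ) < 1 - 2 ^ (-γ) := by
    have := Real.rpow_lt_one_of_one_lt_of_neg (by norm_num : (1 : ℝ) < 2) (neg_neg_of_pos hγ)
    linarith
  unfold dyadicConst; positivity

/-- Every level k < K has 2^k ≤ l. If v l ≤ 1, no level lies above the cutoff, and the sum is of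
order (v l)^β; otherwise a constant bounds it. This factor is the source of the gain at short range.
-/
theorem sum_dyadic_le {β γ : ℝ} (hβ : 0 < β) (hγ : 0 < γ) {v l : ℝ} (hv : 0 ≤ v) {K : ℕ}
    (hK : (2 : ℝ) ^ K ≤ 2 * l) :
    ∑ k ∈ Finset.range K, (if v * 2 ^ k ≤ 1 then (v * 2 ^ k) ^ β else (v * 2 ^ k) ^ (-γ))
      ≤ dyadicConst β γ * (min 1 (v * l)) ^ β := by
  have h1 := two_rpow_sub_one_pos hβ
  have h2 : (0 : ℝ) < 1 - 2 ^ (-γ) := by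
    have := Real.rpow_lt_one_of_one_lt_of_neg (by norm_num : (1 : ℝ) < 2) (neg_neg_of_pos hγ)
    linarith
  have hl : 0 < l := by
    have : (0 : ℝ) < 2 ^ K := by positivity
    linarith
  have hS : ∑ k ∈ Finset.range K, (if v * 2 ^ k ≤ 1 then (v * 2 ^ k) ^ β else 0)
      ≤ 2 ^ β / (2 ^ β - 1) * (min 1 (v * l)) ^ β := by
    refine (sum_small_le hβ hv K).trans ?_
    have : min 2 (v * 2 ^ K) ≤ 2 * min 1 (v * l) := by
      rw [mul_min_of_nonneg _ _ zero_le_two, mul_one]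
      refine min_le_min le_rfl ?_
      calc v * 2 ^ K ≤ v * (2 * l) := by gcongr
        _ = _ := by ring
    calc _ ≤ 1 / (2 ^ β - 1) * (2 * min 1 (v * l)) ^ β := by gcongr
      _ = _ := by
        rw [Real.mul_rpow zero_le_two (by positivity)]; ring
  have e : ∀ k : ℕ, (if v * 2 ^ k ≤ 1 then (v * 2 ^ k) ^ β else (v * 2 ^ k) ^ (-γ))
      = (if v * 2 ^ k ≤ 1 then (v * 2 ^ k) ^ β else 0)
        + (if v * 2 ^ k ≤ 1 then 0 else (v * 2 ^ k) ^ (-γ)) := by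
    intro k; split_ifs <;> simp
  simp only [e, Finset.sum_add_distrib]
  rw [dyadicConst, add_mul]
  refine add_le_add hS ?_
  rcases le_total (v * l) 1 with h | h
  · have : ∑ k ∈ Finset.range K, (if v * 2 ^ k ≤ 1 then 0 else (v * 2 ^ k) ^ (-γ)) = 0 := by
      refine Finset.sum_eq_zero fun k hk => if_pos ?_
      have : (2 : ℝ) ^ (k + 1) ≤ 2 ^ K := pow_le_pow_right₀ one_le_two (Finset.mem_range.1 hk)
      calc v * 2 ^ k ≤ v * l := by gcongr; rw [pow_succ] at this; linarith
        _ ≤ 1 := h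
    rw [this]; positivity
  · rw [min_eq_left h, Real.one_rpow]
    refine (sum_large_le hγ K hv).trans ?_
    gcongr
    exact Real.rpow_le_one_of_one_le_of_nonpos (le_max_left _ _) (by linarith)

/-- The excess of |u| over a threshold is paid for by a high power, as in Markov's inequality. -/
theorem abs_le_add_pow_mul {a u : ℝ} (ha : 0 < a) {m : ℕ} (hm : 1 ≤ m) :
    |u| ≤ a + u ^ (2 * m) * (a ^ (2 * m - 1))⁻¹ := by
  have h0 : 0 ≤ u ^ (2 * m) * (a ^ (2 * m - 1))⁻¹ :=
    mul_nonneg ((even_two_mul m).pow_nonneg _) (by positivity)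
  rcases le_total |u| a with h | h
  · linarith
  · have : |u| ≤ u ^ (2 * m) * (a ^ (2 * m - 1))⁻¹ := by
      rw [le_mul_inv_iff₀ (by positivity), ← (even_two_mul m).pow_abs]
      calc |u| * a ^ (2 * m - 1) ≤ |u| * |u| ^ (2 * m - 1) := by gcongr
        _ = |u| ^ (2 * m) := by rw [← pow_succ']; congr 1; omega
    linarith

/-! ### Recentring by conditional expectations -/

section Truncation

variable {Ω : Type*} {G G' : MeasurableSpace Ω} {mΩ : MeasurableSpace Ω} {μ : Measure Ω}

theorem IsInnovation.congr {f g : Ω → ℝ} (hf : IsInnovation μ G G' f) (h : f =ᵐ[μ] g) :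
    IsInnovation μ G G' g :=
  ⟨hf.aesm.congr h, (condExp_congr_ae h).symm.trans hf.condExp_eq⟩

theorem IsInnovation.mono [IsFiniteMeasure μ] {G₁ G₁' : MeasurableSpace Ω} {f : Ω → ℝ} (hf : IsInnovation μ G G' f)
    (h₁ : G₁ ≤ G) (h₁' : G' ≤ G₁') (hG : G ≤ mΩ) :
    IsInnovation μ G₁ G₁' f := by
  refine ⟨hf.aesm.mono h₁', ?_⟩
  have h1 : μ[μ[f | G] | G₁] =ᵐ[μ] μ[f | G₁] := condExp_condExp_of_le h₁ hG
  refine h1.symm.trans ((condExp_congr_ae hf.condExp_eq).trans ?_)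
  rw [condExp_zero]

/-- `f` minus its conditional expectation given `G`. -/
noncomputable def recentre (μ : Measure Ω) (G : MeasurableSpace Ω) (f : Ω → ℝ) : Ω → ℝ :=
  f - μ[f | G]

theorem isInnovation_recentre [IsFiniteMeasure μ] (hGG : G ≤ G') (hG' : G' ≤ mΩ) {f : Ω → ℝ}
    (hf : AEStronglyMeasurable[G'] f μ) (hi : Integrable f μ) :
    IsInnovation μ G G' (recentre μ G f) := by
  refine ⟨hf.sub ((stronglyMeasurable_condExp.mono hGG).aestronglyMeasurable), ?_⟩
  have h1 := condExp_sub hi (integrable_condExp (f := f) (m := G) (μ := μ)) G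
  have h2 : μ[μ[f | G] | G] = μ[f | G] :=
    condExp_of_stronglyMeasurable (hGG.trans hG') stronglyMeasurable_condExp integrable_condExp
  rw [h2, sub_self] at h1
  exact h1

theorem measurable_recentre (hG : G ≤ mΩ) {f : Ω → ℝ} (hf : Measurable f) :
    Measurable (recentre μ G f) :=
  hf.sub (stronglyMeasurable_condExp.mono hG).measurable

theorem integral_pow_recentre_le [IsFiniteMeasure μ] {f : Ω → ℝ} (hG : G ≤ mΩ) (hf : Measurable f) {m : ℕ}
    (hm : 1 ≤ m) (hi : Integrable (fun ω => f ω ^ (2 * m)) μ) :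
    Integrable (fun ω => recentre μ G f ω ^ (2 * m)) μ ∧
      ∫ ω, recentre μ G f ω ^ (2 * m) ∂μ ≤ 4 ^ m * ∫ ω, f ω ^ (2 * m) ∂μ := by
  have e : ∀ x : ℝ, ‖x‖ ^ ((2 * m : ℕ) : ℝ) = x ^ (2 * m) := fun x => by
    rw [Real.rpow_natCast, Real.norm_eq_abs, (even_two_mul m).pow_abs]
  have h1m : (1 : ℝ) ≤ ((2 * m : ℕ) : ℝ) := by exact_mod_cast (by omega : 1 ≤ 2 * m)
  have hi' : Integrable (fun ω => ‖f ω‖ ^ ((2 * m : ℕ) : ℝ)) μ := by simpa only [e] using hi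
  have h1 := integral_norm_condExp_rpow_le (m := G) h1m hi'
  have h2 : Integrable (fun ω => (μ[f | G]) ω ^ (2 * m)) μ := by
    have h0 : ((2 * m : ℕ) : ℝ≥0∞) ≠ 0 := by
      simpa using (by omega : m ≠ 0)
    have hL : MemLp f ((2 * m : ℕ) : ℝ≥0∞) μ := by
      rw [← integrable_norm_rpow_iff hf.aestronglyMeasurable h0 (ENNReal.natCast_ne_top _)]
      simpa using hi'
    have := hL.condExp (m := G) (by exact_mod_cast (by omega : 1 ≤ 2 * m))
    have := this.integrable_norm_rpow h0 (ENNReal.natCast_ne_top _)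
    rw [ENNReal.toReal_natCast] at this
    simpa only [e] using this
  simp only [e] at h1
  have hpt : ∀ ω, recentre μ G f ω ^ (2 * m)
      ≤ 2 ^ (2 * m - 1) * (f ω ^ (2 * m) + (μ[f | G]) ω ^ (2 * m)) := by
    intro ω
    have h3 := (even_two_mul m).add_pow_le (a := f ω) (b := -(μ[f | G]) ω)
    rwa [(even_two_mul m).neg_pow, ← sub_eq_add_neg] at h3
  have hb := (hi.add h2).const_mul (2 ^ (2 * m - 1))
  have hint : Integrable (fun ω => recentre μ G f ω ^ (2 * m)) μ := by
    refine hb.mono' ((measurable_recentre hG hf).pow_const _).aestronglyMeasurable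
      (Filter.Eventually.of_forall fun ω => ?_)
    rw [Real.norm_eq_abs, abs_of_nonneg ((even_two_mul m).pow_nonneg _)]
    exact hpt ω
  refine ⟨hint, ?_⟩
  calc _ ≤ ∫ ω, 2 ^ (2 * m - 1) * (f ω ^ (2 * m) + (μ[f | G]) ω ^ (2 * m)) ∂μ :=
        integral_mono hint hb hpt
    _ = 2 ^ (2 * m - 1) * (∫ ω, f ω ^ (2 * m) ∂μ + ∫ ω, (μ[f | G]) ω ^ (2 * m) ∂μ) := by
        rw [integral_const_mul, integral_add hi h2]
    _ ≤ 2 ^ (2 * m - 1) * (∫ ω, f ω ^ (2 * m) ∂μ + ∫ ω, f ω ^ (2 * m) ∂μ) := by gcongr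
    _ = 4 ^ m * ∫ ω, f ω ^ (2 * m) ∂μ := by
        have : (4 : ℝ) ^ m = 2 ^ (2 * m - 1) * 2 := by
          rw [← pow_succ, show 2 * m - 1 + 1 = 2 * m by omega, pow_mul]; norm_num
        rw [this]; ring

end Truncation

/-! ### Truncation at a level and moments of dyadic blocks -/

section Master

variable {Ω : Type*} {G : MeasurableSpace Ω} {mΩ : MeasurableSpace Ω} {μ : Measure Ω}

/-- The part of `f` with values in `[-L, L]`. -/
noncomputable def smallPart (L : ℝ) (f : Ω → ℝ) : Ω → ℝ := fun ω => if |f ω| ≤ L then f ω else 0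

/-- The part of `f` with values outside `[-L, L]`. -/
noncomputable def largePart (L : ℝ) (f : Ω → ℝ) : Ω → ℝ := fun ω => if |f ω| ≤ L then 0 else f ω

theorem smallPart_add_largePart (L : ℝ) (f : Ω → ℝ) : smallPart L f + largePart L f = f := by
  funext ω; simp only [smallPart, largePart, Pi.add_apply]; split_ifs <;> simp

theorem measurable_smallPart (L : ℝ) {f : Ω → ℝ} (hf : Measurable f) :
    Measurable (smallPart L f) :=
  Measurable.ite (measurableSet_le hf.abs measurable_const) hf measurable_const

theorem measurable_largePart (L : ℝ) {f : Ω → ℝ} (hf : Measurable f) :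
    Measurable (largePart L f) :=
  Measurable.ite (measurableSet_le hf.abs measurable_const) measurable_const hf

theorem aestronglyMeasurable_smallPart {G' : MeasurableSpace Ω} (L : ℝ) {f : Ω → ℝ}
    (hf : AEStronglyMeasurable[G'] f μ) : AEStronglyMeasurable[G'] (smallPart L f) μ := by
  obtain ⟨g, hg, hfg⟩ := hf
  refine ⟨smallPart L g, (@measurable_smallPart Ω G' L g hg.measurable).stronglyMeasurable, ?_⟩
  filter_upwards [hfg] with ω h
  simp only [smallPart, h]

theorem aestronglyMeasurable_largePart {G' : MeasurableSpace Ω} (L : ℝ) {f : Ω → ℝ}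
    (hf : AEStronglyMeasurable[G'] f μ) : AEStronglyMeasurable[G'] (largePart L f) μ := by
  obtain ⟨g, hg, hfg⟩ := hf
  refine ⟨largePart L g, (@measurable_largePart Ω G' L g hg.measurable).stronglyMeasurable, ?_⟩
  filter_upwards [hfg] with ω h
  simp only [largePart, h]

theorem integrable_smallPart_pow [IsFiniteMeasure μ] {L : ℝ} (hL : 0 ≤ L) {f : Ω → ℝ}
    (hf : Measurable f) (k : ℕ) : Integrable (fun ω => smallPart L f ω ^ k) μ := by
  refine (integrable_const (L ^ k)).mono' ((measurable_smallPart L hf).pow_const _).aestronglyMeasurable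
    (Filter.Eventually.of_forall fun ω => ?_)
  rw [norm_pow, Real.norm_eq_abs]
  gcongr
  simp only [smallPart]
  split_ifs with h
  · exact h
  · simpa using hL

theorem integrable_pow_of_rpow [IsFiniteMeasure μ] {p : ℝ} {f : Ω → ℝ} (hf : Measurable f)
    (hfp : Integrable (fun ω => |f ω| ^ p) μ) {k : ℕ} (hk : (k : ℝ) ≤ p) :
    Integrable (fun ω => f ω ^ k) μ := by
  refine ((integrable_const 1).add hfp).mono' (hf.pow_const _).aestronglyMeasurable
    (Filter.Eventually.of_forall fun ω => ?_)
  rw [norm_pow, Real.norm_eq_abs, Pi.add_apply]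
  rcases le_total |f ω| 1 with h | h
  · have h1 : |f ω| ^ k ≤ 1 := pow_le_one₀ (abs_nonneg _) h
    have h2 : 0 ≤ |f ω| ^ p := by positivity
    linarith
  · have h1 : |f ω| ^ k ≤ |f ω| ^ p := by
      rw [← Real.rpow_natCast]; exact Real.rpow_le_rpow_of_exponent_le h hk
    linarith

theorem integrable_largePart_pow [IsFiniteMeasure μ] {p L : ℝ} {f : Ω → ℝ} (hf : Measurable f)
    (hfp : Integrable (fun ω => |f ω| ^ p) μ) {k : ℕ} (hk0 : k ≠ 0) (hk : (k : ℝ) ≤ p) :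
    Integrable (fun ω => largePart L f ω ^ k) μ := by
  refine (integrable_pow_of_rpow hf hfp hk).mono
    ((measurable_largePart L hf).pow_const _).aestronglyMeasurable
    (Filter.Eventually.of_forall fun ω => ?_)
  simp only [largePart]
  split_ifs with h
  · simp [hk0]
  · exact le_rfl

/-- Truncation destroys the martingale property and recentring restores it. The two corrections
cancel because their sum is the conditional expectation of D, which is zero. -/
theorem recentre_small_add_large [IsFiniteMeasure μ] {L : ℝ} (hL : 0 ≤ L) {D : Ω → ℝ}
    (hDm : Measurable D) (hDi : Integrable D μ) (hD : μ[D | G] =ᵐ[μ] 0) :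
    D =ᵐ[μ] recentre μ G (smallPart L D) + recentre μ G (largePart L D) := by
  have hi1 : Integrable (smallPart L D) μ := by
    simpa using integrable_smallPart_pow (μ := μ) hL hDm 1
  have hi2 : Integrable (largePart L D) μ := by
    have e : largePart L D = D - smallPart L D := by
      rw [eq_sub_iff_add_eq', smallPart_add_largePart]
    rw [e]
    exact hDi.sub hi1
  have h1 := condExp_add hi1 hi2 G
  rw [smallPart_add_largePart] at h1
  filter_upwards [h1, hD] with ω h1 h2
  rw [h2] at h1
  have h3 := congrFun (smallPart_add_largePart L D) ω
  simp only [recentre, Pi.add_apply, Pi.sub_apply, Pi.zero_apply] at h1 h3 ⊢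
  linarith

/-- The normalized excess of a block of length `2 ^ k` over the threshold `2 a`. -/
noncomputable def blockExcess (μ : Measure Ω) (G : MeasurableSpace Ω) (T : Ω → Ω) (p : ℝ) (m : ℕ)
    (a : ℝ) (D : Ω → ℝ) (k : ℕ) (ω : Ω) : ℝ :=
  (birkhoffSum T (recentre μ G (smallPart (a / ((2 : ℝ) ^ k) ^ (1 / p)) D)) (2 ^ k) ω
    / ((2 : ℝ) ^ k) ^ (1 / 2 - 1 / p)) ^ (2 * m) * (a ^ (2 * m - 1))⁻¹
  + (birkhoffSum T (recentre μ G (largePart (a / ((2 : ℝ) ^ k) ^ (1 / p)) D)) (2 ^ k) ω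
    / ((2 : ℝ) ^ k) ^ (1 / 2 - 1 / p)) ^ (2 * 1) * (a ^ (2 * 1 - 1))⁻¹

theorem blockExcess_nonneg {T : Ω → Ω} {p : ℝ} {m : ℕ} {a : ℝ} (ha : 0 < a) {D : Ω → ℝ} {k : ℕ}
    {ω : Ω} : 0 ≤ blockExcess μ G T p m a D k ω :=
  add_nonneg (mul_nonneg ((even_two_mul m).pow_nonneg _) (by positivity))
    (mul_nonneg ((even_two_mul 1).pow_nonneg _) (by positivity))

theorem abs_birkhoffSum_le_blockExcess {T : Ω → Ω} {p : ℝ} {m : ℕ} (hm : 1 ≤ m) {a : ℝ}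
    (ha : 0 < a) {D : Ω → ℝ} {k : ℕ} {ω : Ω}
    (h : ∀ i : ℕ, D (T^[i] ω) = (recentre μ G (smallPart (a / ((2 : ℝ) ^ k) ^ (1 / p)) D)
      + recentre μ G (largePart (a / ((2 : ℝ) ^ k) ^ (1 / p)) D)) (T^[i] ω)) :
    |birkhoffSum T D (2 ^ k) ω| ≤
      (2 * a + blockExcess μ G T p m a D k ω) * ((2 : ℝ) ^ k) ^ (1 / 2 - 1 / p) := by
  have ht : (0 : ℝ) < ((2 : ℝ) ^ k) ^ (1 / 2 - 1 / p) := by positivity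
  have e : birkhoffSum T D (2 ^ k) ω
      = birkhoffSum T (recentre μ G (smallPart (a / ((2 : ℝ) ^ k) ^ (1 / p)) D)) (2 ^ k) ω
      + birkhoffSum T (recentre μ G (largePart (a / ((2 : ℝ) ^ k) ^ (1 / p)) D)) (2 ^ k) ω := by
    rw [← birkhoffSum_add']
    unfold birkhoffSum
    exact Finset.sum_congr rfl fun i _ => h i
  rw [e, ← div_le_iff₀ ht]
  unfold blockExcess
  generalize birkhoffSum T (recentre μ G (smallPart (a / ((2 : ℝ) ^ k) ^ (1 / p)) D)) (2 ^ k) ω = u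
  generalize birkhoffSum T (recentre μ G (largePart (a / ((2 : ℝ) ^ k) ^ (1 / p)) D)) (2 ^ k) ω = v
  generalize ((2 : ℝ) ^ k) ^ (1 / 2 - 1 / p) = t at *
  have h1 := abs_le_add_pow_mul (u := u / t) ha hm
  have h2 := abs_le_add_pow_mul (u := v / t) ha le_rfl
  calc |u + v| / t = |u / t + v / t| := by rw [← add_div, abs_div, abs_of_pos ht]
    _ ≤ |u / t| + |v / t| := abs_add_le _ _
    _ ≤ _ := by linarith

/-- Since (1/2 - 1/p) + 1/p = 1/2, the growth (2^k)^m of the moment cancels against the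
normalization of the block, and only the truncation level remains. -/
theorem moment_scaling {p a : ℝ} (ha : 0 < a) (k : ℕ) {m : ℕ} (hm : 1 ≤ m) :
    ((2 ^ k : ℕ) : ℝ) ^ m / (((2 : ℝ) ^ k) ^ (1 / 2 - 1 / p)) ^ (2 * m) * (a ^ (2 * m - 1))⁻¹
      = a / (a / ((2 : ℝ) ^ k) ^ (1 / p)) ^ (2 * m) := by
  have hy : (0 : ℝ) < 2 ^ k := by positivity
  have hts : (((2 : ℝ) ^ k) ^ (1 / 2 - 1 / p) * ((2 : ℝ) ^ k) ^ (1 / p)) ^ 2 = 2 ^ k := by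
    rw [← Real.rpow_add hy, sub_add_cancel, ← Real.sqrt_eq_rpow, Real.sq_sqrt hy.le]
  have ht : (0 : ℝ) < ((2 : ℝ) ^ k) ^ (1 / 2 - 1 / p) := by positivity
  have hs : (0 : ℝ) < ((2 : ℝ) ^ k) ^ (1 / p) := by positivity
  push_cast
  generalize ((2 : ℝ) ^ k) ^ (1 / 2 - 1 / p) = t at *
  generalize ((2 : ℝ) ^ k) ^ (1 / p) = s at *
  rw [← hts, div_pow, ← pow_mul, mul_pow]
  have ea : a ^ (2 * m) = a * a ^ (2 * m - 1) := by rw [← pow_succ']; congr 1; omega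
  rw [ea]
  field_simp

/-- The order 2m is used where |D| is below the truncation level and the order 2 where it is above,
so each power of the ratio is favourable on its range. The factors 4^m and 4 come from recentring.
-/
theorem integral_blockExcess_le [IsFiniteMeasure μ] {T : Ω ≃ᵐ Ω} (hT : MeasurePreserving T μ μ)
    (hG : G ≤ mΩ) (hGT : G ≤ G.comap T) {D : Ω → ℝ} (hDm : Measurable D)
    (hD : IsInnovation μ G (G.comap T) D) {p : ℝ} (hp : 2 ≤ p)
    (hDp : Integrable (fun ω => |D ω| ^ p) μ) {m : ℕ} (hm : 1 ≤ m) {a : ℝ} (ha : 0 < a) (k : ℕ) :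
    Integrable (blockExcess μ G T p m a D k) μ ∧
    Integrable (fun ω => if |D ω| ≤ a / ((2 : ℝ) ^ k) ^ (1 / p)
        then (|D ω| / (a / ((2 : ℝ) ^ k) ^ (1 / p))) ^ (2 * m)
        else (|D ω| / (a / ((2 : ℝ) ^ k) ^ (1 / p))) ^ 2) μ ∧
    ∫ ω, blockExcess μ G T p m a D k ω ∂μ ≤ (momentConst m * 4 ^ m + momentConst 1 * 4) * a *
      ∫ ω, (if |D ω| ≤ a / ((2 : ℝ) ^ k) ^ (1 / p)
        then (|D ω| / (a / ((2 : ℝ) ^ k) ^ (1 / p))) ^ (2 * m)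
        else (|D ω| / (a / ((2 : ℝ) ^ k) ^ (1 / p))) ^ 2) ∂μ := by
  set L := a / ((2 : ℝ) ^ k) ^ (1 / p) with hLdef
  have hL : 0 < L := by positivity
  have hG' : G.comap T ≤ mΩ := (MeasurableSpace.comap_mono hG).trans T.measurable.comap_le
  have hDi : Integrable D μ := by
    simpa using integrable_pow_of_rpow hDm hDp (k := 1) (by push_cast; linarith)
  have hs := measurable_smallPart L hDm
  have hl := measurable_largePart L hDm
  have is := integrable_smallPart_pow (μ := μ) hL.le hDm (2 * m)
  have is1 : Integrable (smallPart L D) μ := by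
    simpa using integrable_smallPart_pow (μ := μ) hL.le hDm 1
  have il : Integrable (fun ω => largePart L D ω ^ (2 * 1)) μ :=
    integrable_largePart_pow hDm hDp (by norm_num) (by push_cast; linarith)
  have il1 : Integrable (largePart L D) μ := by
    simpa using integrable_largePart_pow (L := L) hDm hDp (k := 1) (by norm_num)
      (by push_cast; linarith)
  have inn_s := isInnovation_recentre hGT hG' (aestronglyMeasurable_smallPart L hD.aesm) is1
  have inn_l := isInnovation_recentre hGT hG' (aestronglyMeasurable_largePart L hD.aesm) il1
  obtain ⟨rs, rs'⟩ := integral_pow_recentre_le hG hs hm is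
  obtain ⟨rl, rl'⟩ := integral_pow_recentre_le hG hl le_rfl il
  obtain ⟨bs, bs'⟩ := integral_pow_birkhoffSum_le hT hG hGT (measurable_recentre hG hs) inn_s hm rs
    (n := 2 ^ k) Nat.one_le_two_pow
  obtain ⟨bl, bl'⟩ := integral_pow_birkhoffSum_le hT hG hGT (measurable_recentre hG hl) inn_l
    le_rfl rl (n := 2 ^ k) Nat.one_le_two_pow
  set t := ((2 : ℝ) ^ k) ^ (1 / 2 - 1 / p) with htdef
  have ht : 0 < t := by positivity
  have J1 : Integrable (fun ω => (birkhoffSum T (recentre μ G (smallPart L D)) (2 ^ k) ω / t)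
      ^ (2 * m) * (a ^ (2 * m - 1))⁻¹) μ := by
    simp only [div_pow]
    exact (bs.div_const _).mul_const _
  have J2 : Integrable (fun ω => (birkhoffSum T (recentre μ G (largePart L D)) (2 ^ k) ω / t)
      ^ (2 * 1) * (a ^ (2 * 1 - 1))⁻¹) μ := by
    simp only [div_pow]
    exact (bl.div_const _).mul_const _
  have eψ : (fun ω => if |D ω| ≤ L then (|D ω| / L) ^ (2 * m) else (|D ω| / L) ^ 2)
      = fun ω => smallPart L D ω ^ (2 * m) / L ^ (2 * m)
        + largePart L D ω ^ (2 * 1) / L ^ (2 * 1) := by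
    have : 2 * m ≠ 0 := by omega
    funext ω
    simp only [smallPart, largePart]
    split_ifs with h
    · simp [div_pow, (even_two_mul m).pow_abs]
    · simp [this, div_pow]
  have K1 := is.div_const (L ^ (2 * m))
  have K2 := il.div_const (L ^ (2 * 1))
  refine ⟨J1.add J2, by rw [eψ]; exact K1.add K2, ?_⟩
  have hI1 : ∫ ω, (birkhoffSum T (recentre μ G (smallPart L D)) (2 ^ k) ω / t)
      ^ (2 * m) * (a ^ (2 * m - 1))⁻¹ ∂μ ≤
      momentConst m * 4 ^ m * a * ∫ ω, smallPart L D ω ^ (2 * m) / L ^ (2 * m) ∂μ := by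
    simp only [div_pow]
    rw [integral_mul_const, integral_div, integral_div]
    have e1 := moment_scaling (p := p) ha k hm
    rw [← htdef, ← hLdef] at e1
    have h0 : 0 ≤ ∫ ω, smallPart L D ω ^ (2 * m) ∂μ :=
      integral_nonneg fun ω => (even_two_mul m).pow_nonneg _
    have hc := momentConst_pos m
    calc _ ≤ (momentConst m * ((2 ^ k : ℕ) : ℝ) ^ m * (4 ^ m * ∫ ω, smallPart L D ω ^ (2 * m) ∂μ))
          / t ^ (2 * m) * (a ^ (2 * m - 1))⁻¹ := by
          gcongr
          exact bs'.trans (by gcongr)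
      _ = momentConst m * 4 ^ m * (∫ ω, smallPart L D ω ^ (2 * m) ∂μ) *
          (((2 ^ k : ℕ) : ℝ) ^ m / t ^ (2 * m) * (a ^ (2 * m - 1))⁻¹) := by ring
      _ = _ := by rw [e1]; ring
  have hI2 : ∫ ω, (birkhoffSum T (recentre μ G (largePart L D)) (2 ^ k) ω / t)
      ^ (2 * 1) * (a ^ (2 * 1 - 1))⁻¹ ∂μ ≤
      momentConst 1 * 4 ^ 1 * a * ∫ ω, largePart L D ω ^ (2 * 1) / L ^ (2 * 1) ∂μ := by
    simp only [div_pow]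
    rw [integral_mul_const, integral_div, integral_div]
    have e1 := moment_scaling (p := p) ha k le_rfl
    rw [← htdef, ← hLdef] at e1
    have h0 : 0 ≤ ∫ ω, largePart L D ω ^ (2 * 1) ∂μ :=
      integral_nonneg fun ω => (even_two_mul 1).pow_nonneg _
    have hc := momentConst_pos 1
    calc _ ≤ (momentConst 1 * ((2 ^ k : ℕ) : ℝ) ^ 1 * (4 ^ 1 * ∫ ω, largePart L D ω ^ (2 * 1) ∂μ))
          / t ^ (2 * 1) * (a ^ (2 * 1 - 1))⁻¹ := by
          gcongr
          exact bl'.trans (by gcongr)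
      _ = momentConst 1 * 4 ^ 1 * (∫ ω, largePart L D ω ^ (2 * 1) ∂μ) *
          (((2 ^ k : ℕ) : ℝ) ^ 1 / t ^ (2 * 1) * (a ^ (2 * 1 - 1))⁻¹) := by ring
      _ = _ := by rw [e1]; ring
  rw [eψ, integral_add K1 K2]
  have p1 : 0 ≤ ∫ ω, smallPart L D ω ^ (2 * m) / L ^ (2 * m) ∂μ :=
    integral_nonneg fun ω => div_nonneg ((even_two_mul m).pow_nonneg _) (by positivity)
  have p2 : 0 ≤ ∫ ω, largePart L D ω ^ (2 * 1) / L ^ (2 * 1) ∂μ :=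
    integral_nonneg fun ω => div_nonneg ((even_two_mul 1).pow_nonneg _) (by positivity)
  have q1 : 0 ≤ momentConst m * 4 ^ m * a := by have := momentConst_pos m; positivity
  have q2 : 0 ≤ momentConst 1 * 4 * a := by have := momentConst_pos 1; positivity
  have r1 := mul_nonneg q1 p2
  have r2 := mul_nonneg q2 p1
  refine (integral_add J1 J2).trans_le ((add_le_add hI1 hI2).trans ?_)
  rw [pow_one]
  linarith

end Master

/-- The constant of the maximal inequality for martingale differences. -/
noncomputable def martingaleConst (p : ℝ) (m : ℕ) : ℝ :=
  (chainConst (1 / 2 - 1 / p) + 2) *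
    (2 + (momentConst m * 4 ^ m + momentConst 1 * 4) * dyadicConst (2 * m / p - 1) (1 - 2 / p))

/-- If r is the ratio of y to the truncation level, then r^p = v 2^k with v = y^p / (x^p n), and (n
/ 2^k) r^p does not depend on k. Extracting r^p from r^{2m} or r² leaves the powers 2m/p - 1 or 2/p
- 1 of v 2^k, which can be summed over k. -/
theorem level_term_eq {p x y : ℝ} (hp : 2 < p) (hx : 0 < x) (hy : 0 ≤ y) {n : ℕ} (hn : 1 ≤ n)
    (k : ℕ) {m : ℕ} (hm : p < 2 * m) :
    ((n : ℝ) / 2 ^ k) * (if y ≤ x * (n : ℝ) ^ (1 / p) / ((2 : ℝ) ^ k) ^ (1 / p)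
        then (y / (x * (n : ℝ) ^ (1 / p) / ((2 : ℝ) ^ k) ^ (1 / p))) ^ (2 * m)
        else (y / (x * (n : ℝ) ^ (1 / p) / ((2 : ℝ) ^ k) ^ (1 / p))) ^ 2)
      = y ^ p / x ^ p * (if y ^ p / (x ^ p * n) * 2 ^ k ≤ 1
        then (y ^ p / (x ^ p * n) * 2 ^ k) ^ (2 * m / p - 1)
        else (y ^ p / (x ^ p * n) * 2 ^ k) ^ (-(1 - 2 / p))) := by
  have hn0 : (0 : ℝ) < n := by exact_mod_cast hn
  have hk0 : (0 : ℝ) < 2 ^ k := by positivity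
  have hp0 : 0 < p := by linarith
  set L := x * (n : ℝ) ^ (1 / p) / ((2 : ℝ) ^ k) ^ (1 / p) with hLdef
  have hL : 0 < L := by positivity
  have hLp : L ^ p = x ^ p * n / 2 ^ k := by
    rw [hLdef, Real.div_rpow (by positivity) (by positivity),
      Real.mul_rpow (by positivity) (by positivity), ← Real.rpow_mul hn0.le,
      ← Real.rpow_mul hk0.le, one_div_mul_cancel hp0.ne', Real.rpow_one, Real.rpow_one]
  have hr : y ^ p / (x ^ p * n) * 2 ^ k = (y / L) ^ p := by
    rw [Real.div_rpow hy hL.le, hLp]; field_simp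
  have hr2 : y ^ p / x ^ p = (n / 2 ^ k) * (y / L) ^ p := by
    rw [← hr]
    have := Real.rpow_pos_of_pos hx p
    field_simp
  rw [hr, hr2, mul_assoc]
  congr 1
  have hr0 : 0 ≤ y / L := by positivity
  have hiff : y ≤ L ↔ (y / L) ^ p ≤ 1 := by
    have h1 := Real.rpow_le_rpow_iff hr0 zero_le_one hp0
    rw [Real.one_rpow] at h1
    rw [h1, div_le_one hL]
  by_cases h : y ≤ L
  · rw [if_pos h, if_pos (hiff.1 h)]
    rcases hr0.eq_or_lt with h0 | h0
    · rw [← h0, Real.zero_rpow hp0.ne', zero_mul, zero_pow]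
      rintro h1
      have : (2 * m : ℝ) = 0 := by exact_mod_cast h1
      linarith
    · rw [← Real.rpow_mul hr0, ← Real.rpow_add h0, ← Real.rpow_natCast]
      congr 1
      push_cast
      field_simp
      ring
  · rw [if_neg h, if_neg (fun h' => h (hiff.2 h'))]
    have h0 : 0 < y / L := by
      push Not at h
      exact div_pos (hL.trans h) hL
    rw [← Real.rpow_mul hr0, ← Real.rpow_add h0, ← Real.rpow_natCast]
    congr 1
    push_cast
    field_simp
    ring

section

variable {Ω : Type*} {G : MeasurableSpace Ω} {mΩ : MeasurableSpace Ω} {μ : Measure Ω}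

/-- The Hölder maximum is controlled by the threshold and the excesses of all dyadic blocks. -/
theorem holderMax_le_sum_blockExcess [IsFiniteMeasure μ] {T : Ω ≃ᵐ Ω}
    (hT : MeasurePreserving T μ μ) {D : Ω → ℝ} (hDm : Measurable D) (hDi : Integrable D μ)
    (hD : μ[D | G] =ᵐ[μ] 0) {p : ℝ} (hp : 2 < p) {m : ℕ} (hm : 1 ≤ m) {a : ℝ} (ha : 0 < a)
    (n l : ℕ) :
    ∀ᵐ ω ∂μ, holderMax (1 / 2 - 1 / p) T D n l ω ≤ ENNReal.ofReal
      ((chainConst (1 / 2 - 1 / p) + 2) * (2 * a + ∑ k ∈ Finset.range (Nat.log 2 l + 1),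
        ∑ b ∈ Finset.range (n / 2 ^ k), blockExcess μ G T p m a D k (T^[b * 2 ^ k] ω))) := by
  have hα : 0 < 1 / 2 - 1 / p := by
    have := one_div_lt_one_div_of_lt two_pos hp
    linarith
  have hae : ∀ᵐ ω ∂μ, ∀ k i : ℕ, D (T^[i] ω) =
      (recentre μ G (smallPart (a / ((2 : ℝ) ^ k) ^ (1 / p)) D)
      + recentre μ G (largePart (a / ((2 : ℝ) ^ k) ^ (1 / p)) D)) (T^[i] ω) := by
    refine ae_all_iff.2 fun k => ae_all_iff.2 fun i => ?_
    have hL : 0 ≤ a / ((2 : ℝ) ^ k) ^ (1 / p) := by positivity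
    exact (hT.iterate i).quasiMeasurePreserving.ae_eq_comp
      (recentre_small_add_large hL hDm hDi hD)
  filter_upwards [hae] with ω hω
  have hnn : ∀ k b, 0 ≤ blockExcess μ G T p m a D k (T^[b * 2 ^ k] ω) :=
    fun k b => blockExcess_nonneg ha
  refine holderMax_le fun i j hij hj hl => ENNReal.ofReal_le_ofReal ?_
  have hpos : (0 : ℝ) < (j : ℝ) - i := sub_pos.2 (by exact_mod_cast hij)
  rw [div_le_iff₀ (Real.rpow_pos_of_pos hpos _)]
  have h_sum : 0 ≤ ∑ k ∈ Finset.range (Nat.log 2 l + 1),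
        ∑ b ∈ Finset.range (n / 2 ^ k), blockExcess μ G T p m a D k (T^[b * 2 ^ k] ω) :=
    Finset.sum_nonneg fun k _ => Finset.sum_nonneg fun b _ => hnn k b
  refine abs_sub_le_of_dyadic (S := fun k => birkhoffSum T D k ω) hα (by positivity) ?_ hij hj hl
  intro k b hk hb
  have e : birkhoffSum T D ((b + 1) * 2 ^ k) ω - birkhoffSum T D (b * 2 ^ k) ω
      = birkhoffSum T D (2 ^ k) (T^[b * 2 ^ k] ω) := by
    rw [add_mul, one_mul, birkhoffSum_add, add_sub_cancel_left]
  simp only [e]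
  refine (abs_birkhoffSum_le_blockExcess (G := G) (μ := μ) (p := p) hm ha ?_).trans ?_
  · intro i
    rw [← Function.iterate_add_apply]
    exact hω k _
  · gcongr
    -- The levels k ≤ `Nat.log 2 l` are those with 2^k ≤ l; the maximum over blocks is bounded by
    -- the sum over blocks.
    refine le_trans ?_ (Finset.single_le_sum (fun k _ => Finset.sum_nonneg fun b _ => hnn k b)
      (Finset.mem_range.2 (Nat.lt_succ_of_le (Nat.le_log_of_pow_le one_lt_two hk))))
    refine Finset.single_le_sum (f := fun b => blockExcess μ G T p m a D k (T^[b * 2 ^ k] ω))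
      (fun b _ => hnn k b) (Finset.mem_range.2 ?_)
    exact (Nat.le_div_iff_mul_le (by positivity)).2 hb

/-- The maximal inequality for stationary martingale differences, with a threshold `x`. -/
theorem lintegral_holderMax_le [IsProbabilityMeasure μ] {T : Ω ≃ᵐ Ω}
    (hT : MeasurePreserving T μ μ) (hG : G ≤ mΩ) (hGT : G ≤ G.comap T) {D : Ω → ℝ}
    (hDm : Measurable D) (hD : IsInnovation μ G (G.comap T) D) {p : ℝ} (hp : 2 < p)
    (hDp : Integrable (fun ω => |D ω| ^ p) μ) {m : ℕ} (hm : p < 2 * m) {x : ℝ} (hx : 0 < x)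
    {n l : ℕ} (hn : 1 ≤ n) (hl : 1 ≤ l) :
    ∫⁻ ω, holderMax (1 / 2 - 1 / p) T D n l ω ∂μ ≤ ENNReal.ofReal
      (martingaleConst p m * (n : ℝ) ^ (1 / p) * x * (1 + ∫ ω, |D ω| ^ p / x ^ p *
        (min 1 (|D ω| ^ p / (x ^ p * n) * l)) ^ (2 * m / p - 1) ∂μ)) := by
  have hm1 : 1 ≤ m := by
    by_contra h
    have : m = 0 := by omega
    rw [this] at hm; simp at hm; linarith
  have hp0 : 0 < p := by linarith
  have hn0 : (0 : ℝ) < n := by exact_mod_cast hn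
  have hα : 0 < 1 / 2 - 1 / p := by
    have := one_div_lt_one_div_of_lt two_pos hp
    linarith
  have hβ : 0 < 2 * m / p - 1 := by
    rw [sub_pos, lt_div_iff₀ hp0]; linarith
  have hγ : 0 < 1 - 2 / p := by
    rw [sub_pos, div_lt_one hp0]; exact hp
  have hDi : Integrable D μ := by
    simpa using integrable_pow_of_rpow hDm hDp (k := 1) (by push_cast; linarith)
  set a := x * (n : ℝ) ^ (1 / p) with hadef
  have ha : 0 < a := by positivity
  set C₁ := momentConst m * 4 ^ m + momentConst 1 * 4 with hC₁def
  have hC₁ : 0 < C₁ := by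
    have h1 := momentConst_pos m
    have h2 := momentConst_pos 1
    positivity
  set C₂ := dyadicConst (2 * m / p - 1) (1 - 2 / p)
  have hC₂ : 0 < C₂ := dyadicConst_pos hβ hγ
  have hB := chainConst_pos hα
  set F : Ω → ℝ := fun ω => |D ω| ^ p / x ^ p *
        (min 1 (|D ω| ^ p / (x ^ p * n) * l)) ^ (2 * m / p - 1) with hF
  have hFi : Integrable F μ := by
    refine (hDp.div_const (x ^ p)).mono' ?_ (Filter.Eventually.of_forall fun ω => ?_)
    · refine Measurable.aestronglyMeasurable ?_
      have := hDm.abs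
      fun_prop
    · have h0 : 0 ≤ |D ω| ^ p / x ^ p := by positivity
      have h1 : 0 ≤ min 1 (|D ω| ^ p / (x ^ p * n) * l) := by positivity
      rw [Real.norm_eq_abs, abs_of_nonneg (by positivity)]
      exact mul_le_of_le_one_right h0 (Real.rpow_le_one h1 (min_le_left _ _) hβ.le)
  have hblock := fun k => integral_blockExcess_le hT hG hGT hDm hD hp.le hDp hm1 ha k
  set ψ : ℕ → Ω → ℝ := fun k ω => if |D ω| ≤ a / ((2 : ℝ) ^ k) ^ (1 / p)
    then (|D ω| / (a / ((2 : ℝ) ^ k) ^ (1 / p))) ^ (2 * m)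
    else (|D ω| / (a / ((2 : ℝ) ^ k) ^ (1 / p))) ^ 2
  have hcomp : ∀ k b, Integrable (fun ω => blockExcess μ G T p m a D k (T^[b * 2 ^ k] ω)) μ :=
    fun k b => (hT.iterate (b * 2 ^ k)).integrable_comp_of_integrable (hblock k).1
  have hcompI : ∀ k b, ∫ ω, blockExcess μ G T p m a D k (T^[b * 2 ^ k] ω) ∂μ
      = ∫ ω, blockExcess μ G T p m a D k ω ∂μ := by
    intro k b
    have h3 := integral_map (μ := μ) (hT.iterate (b * 2 ^ k)).measurable.aemeasurable
      (f := blockExcess μ G T p m a D k)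
      (by rw [(hT.iterate (b * 2 ^ k)).map_eq]; exact (hblock k).1.aestronglyMeasurable)
    rw [(hT.iterate (b * 2 ^ k)).map_eq] at h3
    exact h3.symm
  have hIi : Integrable (fun ω => 2 * a + ∑ k ∈ Finset.range (Nat.log 2 l + 1),
        ∑ b ∈ Finset.range (n / 2 ^ k), blockExcess μ G T p m a D k (T^[b * 2 ^ k] ω)) μ :=
    (integrable_const _).add (integrable_finsetSum _ fun k _ => integrable_finsetSum _
      fun b _ => hcomp k b)
  have hsum : ∑ k ∈ Finset.range (Nat.log 2 l + 1), ∑ b ∈ Finset.range (n / 2 ^ k),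
      ∫ ω, blockExcess μ G T p m a D k (T^[b * 2 ^ k] ω) ∂μ ≤ C₁ * a * (C₂ * ∫ ω, F ω ∂μ) := by
    calc _ ≤ ∑ k ∈ Finset.range (Nat.log 2 l + 1), C₁ * a *
          ∫ ω, |D ω| ^ p / x ^ p * (if |D ω| ^ p / (x ^ p * n) * 2 ^ k ≤ 1
            then (|D ω| ^ p / (x ^ p * n) * 2 ^ k) ^ (2 * m / p - 1)
            else (|D ω| ^ p / (x ^ p * n) * 2 ^ k) ^ (-(1 - 2 / p))) ∂μ := by
          refine Finset.sum_le_sum fun k _ => ?_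
          simp only [hcompI, Finset.sum_const, Finset.card_range, nsmul_eq_mul]
          have hI0 : 0 ≤ ∫ ω, blockExcess μ G T p m a D k ω ∂μ :=
            integral_nonneg fun ω => blockExcess_nonneg ha
          -- By stationarity all blocks of level k contribute equally, and there are at most n / 2^k
          -- of them.
          calc _ ≤ ((n : ℝ) / 2 ^ k) * ∫ ω, blockExcess μ G T p m a D k ω ∂μ := by
                gcongr
                exact Nat.cast_div_le.trans_eq (by push_cast; rfl)
            _ ≤ ((n : ℝ) / 2 ^ k) * (C₁ * a * ∫ ω, ψ k ω ∂μ) := by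
                gcongr
                exact (hblock k).2.2
            _ = C₁ * a * ∫ ω, ((n : ℝ) / 2 ^ k) * ψ k ω ∂μ := by rw [integral_const_mul]; ring
            _ = _ := by
                congr 2
                funext ω
                exact level_term_eq hp hx (abs_nonneg _) hn k hm
      _ = C₁ * a * ∫ ω, ∑ k ∈ Finset.range (Nat.log 2 l + 1),
          |D ω| ^ p / x ^ p * (if |D ω| ^ p / (x ^ p * n) * 2 ^ k ≤ 1
            then (|D ω| ^ p / (x ^ p * n) * 2 ^ k) ^ (2 * m / p - 1)
            else (|D ω| ^ p / (x ^ p * n) * 2 ^ k) ^ (-(1 - 2 / p))) ∂μ := by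
          rw [← Finset.mul_sum, integral_finsetSum]
          intro k _
          refine ((hblock k).2.1.const_mul ((n : ℝ) / 2 ^ k)).congr
            (Filter.Eventually.of_forall fun ω => ?_)
          exact level_term_eq hp hx (abs_nonneg _) hn k hm
      _ ≤ C₁ * a * ∫ ω, C₂ * F ω ∂μ := by
          refine mul_le_mul_of_nonneg_left ?_ (by positivity)
          refine integral_mono_of_nonneg (Filter.Eventually.of_forall fun ω => ?_)
            (hFi.const_mul _) (Filter.Eventually.of_forall fun ω => ?_)
          · refine Finset.sum_nonneg fun k _ => mul_nonneg (by positivity) ?_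
            split_ifs <;> positivity
          · simp only []
            rw [← Finset.mul_sum]
            have hK : (2 : ℝ) ^ (Nat.log 2 l + 1) ≤ 2 * l := by
              have := Nat.pow_log_le_self 2 (show l ≠ 0 by omega)
              rw [pow_succ, mul_comm]
              exact mul_le_mul_of_nonneg_left (by exact_mod_cast this) zero_le_two
            calc _ ≤ |D ω| ^ p / x ^ p * (C₂ *
                  (min 1 (|D ω| ^ p / (x ^ p * n) * l)) ^ (2 * m / p - 1)) := by
                  gcongr
                  exact sum_dyadic_le hβ hγ (by positivity) hK
              _ = _ := by rw [hF]; ring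
      _ = _ := by rw [integral_const_mul]
  calc ∫⁻ ω, holderMax (1 / 2 - 1 / p) T D n l ω ∂μ
    _ ≤ ∫⁻ ω, ENNReal.ofReal ((chainConst (1 / 2 - 1 / p) + 2) * (2 * a + ∑ k ∈ Finset.range (Nat.log 2 l + 1),
        ∑ b ∈ Finset.range (n / 2 ^ k), blockExcess μ G T p m a D k (T^[b * 2 ^ k] ω))) ∂μ :=
        lintegral_mono_ae (holderMax_le_sum_blockExcess hT hDm hDi hD.condExp_eq hp hm1 ha n l)
    _ = ENNReal.ofReal ((chainConst (1 / 2 - 1 / p) + 2) * (2 * a +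
        ∑ k ∈ Finset.range (Nat.log 2 l + 1), ∑ b ∈ Finset.range (n / 2 ^ k),
        ∫ ω, blockExcess μ G T p m a D k (T^[b * 2 ^ k] ω) ∂μ)) := by
        rw [← ofReal_integral_eq_lintegral_ofReal (hIi.const_mul _)
          (Filter.Eventually.of_forall fun ω => ?_), integral_const_mul,
          integral_add (integrable_const _) (integrable_finsetSum _ fun k _ =>
            integrable_finsetSum _ fun b _ => hcomp k b), integral_finsetSum _
            (fun k _ => integrable_finsetSum _ fun b _ => hcomp k b)]
        · simp only [integral_finsetSum _ (fun b _ => hcomp _ b), integral_const]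
          simp
        · exact mul_nonneg (by positivity) (add_nonneg (by positivity) (Finset.sum_nonneg
            fun k _ => Finset.sum_nonneg fun b _ => blockExcess_nonneg ha))
    _ ≤ _ := by
        refine ENNReal.ofReal_le_ofReal ?_
        have hF0 : 0 ≤ ∫ ω, F ω ∂μ := integral_nonneg fun ω => by
          simp only [hF, Pi.zero_apply]; positivity
        calc _ ≤ (chainConst (1 / 2 - 1 / p) + 2) * (2 * a + C₁ * a * (C₂ * ∫ ω, F ω ∂μ)) := by
              gcongr
          _ ≤ (chainConst (1 / 2 - 1 / p) + 2) *
              ((2 + C₁ * C₂) * (a * (1 + ∫ ω, F ω ∂μ))) := by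
              gcongr
              have h1 : 0 ≤ C₁ * C₂ * a := by positivity
              have h2 : 0 ≤ 2 * a * ∫ ω, F ω ∂μ := by positivity
              linarith
          _ = _ := by rw [martingaleConst, hadef]; ring

end

/-! ### Bounds in `L^p` and short-range smallness -/

section

variable {Ω : Type*} {G : MeasurableSpace Ω} {mΩ : MeasurableSpace Ω} {μ : Measure Ω}

theorem holderMax_zero_fun {α : ℝ} {T : Ω → Ω} {n l : ℕ} {ω : Ω} :
    holderMax α T 0 n l ω = 0 :=
  le_antisymm (holderMax_le fun i j _ _ _ => by simp [birkhoffSum]) bot_le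

theorem holderMax_zero_right {α : ℝ} {T : Ω → Ω} {f : Ω → ℝ} {n : ℕ} {ω : Ω} :
    holderMax α T f n 0 ω = 0 :=
  le_antisymm (holderMax_le fun i j h1 _ h2 => by omega) bot_le

theorem integrable_abs_rpow {p : ℝ} (hp : 0 < p) {f : Ω → ℝ}
    (hf : MemLp f (ENNReal.ofReal p) μ) : Integrable (fun ω => |f ω| ^ p) μ := by
  have := hf.integrable_norm_rpow (by simpa using hp) ENNReal.ofReal_ne_top
  rwa [ENNReal.toReal_ofReal hp.le] at this

theorem toReal_eLpNorm_rpow {p : ℝ} (hp : 0 < p) {f : Ω → ℝ}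
    (hf : MemLp f (ENNReal.ofReal p) μ) :
    (eLpNorm f (ENNReal.ofReal p) μ).toReal ^ p = ∫ ω, |f ω| ^ p ∂μ := by
  rw [hf.eLpNorm_eq_integral_rpow_norm (by simpa using hp) ENNReal.ofReal_ne_top,
    ENNReal.toReal_ofReal hp.le]
  have h0 : 0 ≤ ∫ ω, ‖f ω‖ ^ p ∂μ := integral_nonneg fun ω => by positivity
  rw [ENNReal.toReal_ofReal (by positivity), ← Real.rpow_mul h0, inv_mul_cancel₀ hp.ne',
    Real.rpow_one]
  rfl

/-- If the integral of the Hölder maximum is controlled for every threshold `x`, then it is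
controlled by the `L^p` norm. -/
theorem lintegral_holderMax_le_eLpNorm_of_threshold {T : Ω → Ω} (hT : MeasurePreserving T μ μ)
    {f : Ω → ℝ} {p : ℝ} (hp : 0 < p) (hf : MemLp f (ENNReal.ofReal p) μ) {α C : ℝ} (hC : 0 ≤ C)
    {n l : ℕ} (h : ∀ x : ℝ, 0 < x → ∫⁻ ω, holderMax α T f n l ω ∂μ ≤
      ENNReal.ofReal (C * (n : ℝ) ^ (1 / p) * x * (1 + ∫ ω, |f ω| ^ p / x ^ p ∂μ))) :
    ∫⁻ ω, holderMax α T f n l ω ∂μ ≤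
      ENNReal.ofReal (2 * C * (n : ℝ) ^ (1 / p)) * eLpNorm f (ENNReal.ofReal p) μ := by
  have hp' : ENNReal.ofReal p ≠ 0 := by simpa using hp
  rcases eq_or_ne (eLpNorm f (ENNReal.ofReal p) μ) 0 with h0 | h0
  · have hz : f =ᵐ[μ] 0 := (eLpNorm_eq_zero_iff hf.1 hp').1 h0
    rw [lintegral_congr_ae (holderMax_congr_ae hT hz α n l)]
    simp [holderMax_zero_fun]
  -- The threshold x = ‖f‖_p makes the bracket equal to 2.
  · set s := (eLpNorm f (ENNReal.ofReal p) μ).toReal with hs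
    have hspos : 0 < s := ENNReal.toReal_pos h0 hf.2.ne
    refine (h s hspos).trans_eq ?_
    rw [integral_div, ← toReal_eLpNorm_rpow hp hf, ← hs,
      div_self (Real.rpow_pos_of_pos hspos p).ne', ← ENNReal.ofReal_toReal hf.2.ne, ← hs,
      ← ENNReal.ofReal_mul (by positivity)]
    congr 1; ring

theorem martingaleConst_pos {p : ℝ} (hp : 2 < p) {m : ℕ} (hm : p < 2 * m) :
    0 < martingaleConst p m := by
  have hp0 : 0 < p := by linarith
  have hα : 0 < 1 / 2 - 1 / p := by
    have := one_div_lt_one_div_of_lt two_pos hp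
    linarith
  have hβ : 0 < 2 * m / p - 1 := by
    rw [sub_pos, lt_div_iff₀ hp0]; linarith
  have hγ : 0 < 1 - 2 / p := by
    rw [sub_pos, div_lt_one hp0]; exact hp
  have h1 := momentConst_pos m
  have h2 := momentConst_pos 1
  have h3 := dyadicConst_pos hβ hγ
  have h4 := chainConst_pos hα
  unfold martingaleConst; positivity

/-- The maximal inequality for stationary martingale differences in `L^p`. -/
theorem lintegral_holderMax_le_eLpNorm [IsProbabilityMeasure μ] {T : Ω ≃ᵐ Ω}
    (hT : MeasurePreserving T μ μ) (hG : G ≤ mΩ) (hGT : G ≤ G.comap T) {D : Ω → ℝ}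
    (hDm : Measurable D) (hD : IsInnovation μ G (G.comap T) D) {p : ℝ} (hp : 2 < p)
    (hDp : MemLp D (ENNReal.ofReal p) μ) {m : ℕ} (hm : p < 2 * m) (n l : ℕ) :
    ∫⁻ ω, holderMax (1 / 2 - 1 / p) T D n l ω ∂μ ≤
      ENNReal.ofReal (2 * martingaleConst p m * (n : ℝ) ^ (1 / p))
        * eLpNorm D (ENNReal.ofReal p) μ := by
  have hp0 : 0 < p := by linarith
  rcases Nat.eq_zero_or_pos n with rfl | hn
  · simp
  rcases Nat.eq_zero_or_pos l with rfl | hl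
  · simp [holderMax_zero_right]
  have hC := martingaleConst_pos hp hm
  have hi := integrable_abs_rpow hp0 hDp
  refine lintegral_holderMax_le_eLpNorm_of_threshold hT hp0 hDp hC.le fun x hx => ?_
  refine (lintegral_holderMax_le hT hG hGT hDm hD hp hi hm hx hn hl).trans
    (ENNReal.ofReal_le_ofReal ?_)
  have hβ : 0 < 2 * m / p - 1 := by
    rw [sub_pos, lt_div_iff₀ hp0]; linarith
  gcongr ?_ * _ * _ * (_ + ?_)
  refine integral_mono_of_nonneg (Filter.Eventually.of_forall fun ω => ?_)
    (hi.div_const _) (Filter.Eventually.of_forall fun ω => ?_)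
  · simp only [Pi.zero_apply]; positivity
  · exact mul_le_of_le_one_right (by positivity)
      (Real.rpow_le_one (by positivity) (min_le_left _ _) hβ.le)

/-- The short-range Hölder maximum of stationary martingale differences in `L^p` is negligible. -/
theorem lintegral_holderMax_small [IsProbabilityMeasure μ] {T : Ω ≃ᵐ Ω}
    (hT : MeasurePreserving T μ μ) (hG : G ≤ mΩ) (hGT : G ≤ G.comap T) {D : Ω → ℝ}
    (hDm : Measurable D) (hD : IsInnovation μ G (G.comap T) D) {p : ℝ} (hp : 2 < p)
    (hDp : MemLp D (ENNReal.ofReal p) μ) {ε : ℝ} (hε : 0 < ε) :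
    ∃ δ : ℝ, 0 < δ ∧ ∀ n l : ℕ, (l : ℝ) ≤ δ * n →
      ∫⁻ ω, holderMax (1 / 2 - 1 / p) T D n l ω ∂μ ≤ ENNReal.ofReal (ε * (n : ℝ) ^ (1 / p)) := by
  have hp0 : 0 < p := by linarith
  obtain ⟨m, hm'⟩ := exists_nat_gt p
  have hm : p < 2 * m := by
    have : (0 : ℝ) ≤ m := by positivity
    linarith
  have hC := martingaleConst_pos hp hm
  have hβ : 0 < 2 * m / p - 1 := by
    rw [sub_pos, lt_div_iff₀ hp0]; linarith
  have hi := integrable_abs_rpow hp0 hDp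
  set C := martingaleConst p m
  -- Chosen so that C x (1 + 1) = ε once the integral is at most 1.
  set x := ε / (2 * C) with hxdef
  have hx : 0 < x := by positivity
  set F : ℝ → Ω → ℝ := fun δ ω => |D ω| ^ p / x ^ p *
    (min 1 (|D ω| ^ p / x ^ p * δ)) ^ (2 * m / p - 1) with hF
  have hFm : ∀ δ, Measurable (F δ) := fun δ => by
    have := hDm.abs
    fun_prop
  have hF0 : ∀ δ, 0 ≤ δ → ∀ ω, 0 ≤ F δ ω := fun δ hδ ω => by simp only [hF]; positivity
  have hFle : ∀ δ, 0 ≤ δ → ∀ ω, F δ ω ≤ |D ω| ^ p / x ^ p := fun δ hδ ω =>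
    mul_le_of_le_one_right (by positivity)
      (Real.rpow_le_one (by positivity) (min_le_left _ _) hβ.le)
  have hFi : ∀ δ, 0 ≤ δ → Integrable (F δ) μ := fun δ hδ =>
    (hi.div_const (x ^ p)).mono' (hFm δ).aestronglyMeasurable
      (Filter.Eventually.of_forall fun ω => by
        rw [Real.norm_eq_abs, abs_of_nonneg (hF0 δ hδ ω)]; exact hFle δ hδ ω)
  -- Dominated convergence with the integrable majorant |D|^p / x^p: the factor with the minimum
  -- tends to 0 with δ because 2m/p - 1 > 0.
  have hlim : Filter.Tendsto (fun δ => ∫ ω, F δ ω ∂μ) (𝓝[>] 0) (𝓝 (∫ _, (0 : ℝ) ∂μ)) := by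
    refine tendsto_integral_filter_of_dominated_convergence (fun ω => |D ω| ^ p / x ^ p)
      (Filter.Eventually.of_forall fun δ => (hFm δ).aestronglyMeasurable) ?_
      (hi.div_const (x ^ p)) (Filter.Eventually.of_forall fun ω => ?_)
    · filter_upwards [self_mem_nhdsWithin] with δ hδ
      refine Filter.Eventually.of_forall fun ω => ?_
      have hδ' : (0 : ℝ) ≤ δ := le_of_lt hδ
      rw [Real.norm_eq_abs, abs_of_nonneg (hF0 δ hδ' ω)]; exact hFle δ hδ' ω
    · have hc : ContinuousAt (fun δ : ℝ => F δ ω) 0 := by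
        simp only [hF]
        refine ContinuousAt.mul continuousAt_const (ContinuousAt.rpow_const ?_ (Or.inr hβ.le))
        fun_prop
      have h0 : F 0 ω = 0 := by
        simp [hF, Real.zero_rpow hβ.ne']
      have := hc.tendsto
      rw [h0] at this
      exact this.mono_left nhdsWithin_le_nhds
  rw [integral_zero] at hlim
  obtain ⟨δ, hδ1, hδ0⟩ := ((hlim.eventually (gt_mem_nhds one_pos)).and self_mem_nhdsWithin).exists
  have hδ0' : (0 : ℝ) < δ := hδ0
  refine ⟨δ, hδ0', fun n l hl => ?_⟩
  rcases Nat.eq_zero_or_pos n with rfl | hn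
  · simp
  rcases Nat.eq_zero_or_pos l with rfl | hl1
  · simp [holderMax_zero_right]
  refine (lintegral_holderMax_le hT hG hGT hDm hD hp hi hm hx hn hl1).trans
    (ENNReal.ofReal_le_ofReal ?_)
  have hn0 : (0 : ℝ) < n := by exact_mod_cast hn
  have hxp : 0 < x ^ p := by positivity
  have hle : ∫ ω, |D ω| ^ p / x ^ p *
        (min 1 (|D ω| ^ p / (x ^ p * n) * l)) ^ (2 * m / p - 1) ∂μ ≤ 1 := by
    refine le_trans ?_ hδ1.le
    refine integral_mono_of_nonneg (Filter.Eventually.of_forall fun ω => ?_)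
      (hFi δ hδ0'.le) (Filter.Eventually.of_forall fun ω => ?_)
    · simp only [Pi.zero_apply]; positivity
    · simp only [hF]
      gcongr ?_ * (min _ ?_) ^ _
      calc |D ω| ^ p / (x ^ p * n) * l ≤ |D ω| ^ p / (x ^ p * n) * (δ * n) := by gcongr
        _ = _ := by field_simp
  calc C * (n : ℝ) ^ (1 / p) * x * (1 + _) ≤ C * (n : ℝ) ^ (1 / p) * x * (1 + 1) := by gcongr
    _ = _ := by rw [hxdef]; field_simp; ring

theorem abs_le_add_indicator {p a y : ℝ} (hp : 1 ≤ p) (ha : 0 < a) :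
    |y| ≤ a + a ^ (1 - p) * (if a < |y| then |y| ^ p else 0) := by
  split_ifs with h
  · have h1 : a ^ (p - 1) ≤ |y| ^ (p - 1) := Real.rpow_le_rpow ha.le h.le (by linarith)
    have hy : 0 < |y| := ha.trans h
    have : |y| ≤ a ^ (1 - p) * |y| ^ p := by
      calc |y| = a ^ (1 - p) * a ^ (p - 1) * |y| := by
            rw [← Real.rpow_add ha]; simp
        _ ≤ a ^ (1 - p) * |y| ^ (p - 1) * |y| := by gcongr
        _ = a ^ (1 - p) * |y| ^ p := by
            rw [mul_assoc, Real.rpow_sub_one hy.ne', div_mul_cancel₀ _ hy.ne']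
    linarith
  · push Not at h; simpa using h

/-- The bound for the largest of `n` stationary variables in `L^p`, with a threshold `x`. -/
theorem lintegral_holderMax_one_le [IsProbabilityMeasure μ] {T : Ω → Ω}
    (hT : MeasurePreserving T μ μ) {f : Ω → ℝ} (hfm : Measurable f) {p : ℝ} (hp : 1 ≤ p)
    (hfp : Integrable (fun ω => |f ω| ^ p) μ) (α : ℝ) {x : ℝ} (hx : 0 < x) {n : ℕ} (hn : 1 ≤ n) :
    ∫⁻ ω, holderMax α T f n 1 ω ∂μ ≤ ENNReal.ofReal ((n : ℝ) ^ (1 / p) * x *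
      (1 + ∫ ω, (if x * (n : ℝ) ^ (1 / p) < |f ω| then |f ω| ^ p else 0) / x ^ p ∂μ)) := by
  have hn0 : (0 : ℝ) < n := by exact_mod_cast hn
  have hp0 : 0 < p := by linarith
  set a := x * (n : ℝ) ^ (1 / p) with hadef
  have ha : 0 < a := by positivity
  set F : Ω → ℝ := fun ω => if a < |f ω| then |f ω| ^ p else 0 with hF
  have hFm : Measurable F :=
    Measurable.ite (measurableSet_lt measurable_const hfm.abs) (hfm.abs.pow_const _)
      measurable_const
  have hF0 : ∀ ω, 0 ≤ F ω := fun ω => by simp only [hF]; split_ifs <;> positivity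
  have hFi : Integrable F μ := by
    refine hfp.mono' hFm.aestronglyMeasurable (Filter.Eventually.of_forall fun ω => ?_)
    rw [Real.norm_eq_abs, abs_of_nonneg (hF0 ω)]
    simp only [hF]
    split_ifs
    · exact le_rfl
    · positivity
  have hcomp : ∀ b, Integrable (fun ω => F (T^[b] ω)) μ :=
    fun b => (hT.iterate b).integrable_comp_of_integrable hFi
  have hcompI : ∀ b, ∫ ω, F (T^[b] ω) ∂μ = ∫ ω, F ω ∂μ := by
    intro b
    have h3 := integral_map (μ := μ) (hT.iterate b).measurable.aemeasurable
      (f := F) (by rw [(hT.iterate b).map_eq]; exact hFi.aestronglyMeasurable)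
    rw [(hT.iterate b).map_eq] at h3
    exact h3.symm
  have hpt : ∀ ω, holderMax α T f n 1 ω ≤
      ENNReal.ofReal (a + a ^ (1 - p) * ∑ b ∈ Finset.range n, F (T^[b] ω)) := by
    intro ω
    refine holderMax_le fun i j hij hj hl => ENNReal.ofReal_le_ofReal ?_
    have : j = i + 1 := by omega
    subst this
    rw [birkhoffSum_succ, add_sub_cancel_left]
    have e : ((i + 1 : ℕ) : ℝ) - i = 1 := by push_cast; ring
    rw [e, Real.one_rpow, div_one]
    refine (abs_le_add_indicator hp ha).trans ?_
    gcongr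
    exact Finset.single_le_sum (f := fun b => F (T^[b] ω)) (fun b _ => hF0 _)
      (Finset.mem_range.2 (by omega))
  have hsumi : Integrable (fun ω => ∑ b ∈ Finset.range n, F (T^[b] ω)) μ :=
    integrable_finsetSum _ fun b _ => hcomp b
  refine (lintegral_mono hpt).trans_eq ?_
  have hsum2 : Integrable (fun ω => a + a ^ (1 - p) * ∑ b ∈ Finset.range n, F (T^[b] ω)) μ :=
    (integrable_const a).add (hsumi.const_mul _)
  rw [← ofReal_integral_eq_lintegral_ofReal hsum2
    (Filter.Eventually.of_forall fun ω => add_nonneg ha.le (mul_nonneg (by positivity)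
      (Finset.sum_nonneg fun b _ => hF0 _))), integral_add (integrable_const a)
    (hsumi.const_mul _), integral_const_mul (a ^ (1 - p)),
    integral_finsetSum _ fun b _ => hcomp b]
  simp only [hcompI, Finset.sum_const, Finset.card_range, nsmul_eq_mul, integral_const,
    probReal_univ, one_smul, integral_div]
  congr 1
  -- The n summands exactly compensate the factor n^{1/p} inside the threshold a.
  have e : a ^ (1 - p) * n = a / x ^ p := by
    rw [Real.rpow_sub ha, Real.rpow_one, hadef, Real.mul_rpow hx.le (by positivity),
      ← Real.rpow_mul hn0.le, one_div_mul_cancel hp0.ne', Real.rpow_one]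
    field_simp
  rw [← mul_assoc, e, hadef]
  ring

theorem lintegral_holderMax_one_le_eLpNorm [IsProbabilityMeasure μ] {T : Ω → Ω}
    (hT : MeasurePreserving T μ μ) {f : Ω → ℝ} (hfm : Measurable f) {p : ℝ} (hp : 1 ≤ p)
    (hfp : MemLp f (ENNReal.ofReal p) μ) (α : ℝ) (n : ℕ) :
    ∫⁻ ω, holderMax α T f n 1 ω ∂μ ≤
      ENNReal.ofReal (2 * (n : ℝ) ^ (1 / p)) * eLpNorm f (ENNReal.ofReal p) μ := by
  have hp0 : 0 < p := by linarith
  rcases Nat.eq_zero_or_pos n with rfl | hn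
  · simp
  have hi := integrable_abs_rpow hp0 hfp
  have := lintegral_holderMax_le_eLpNorm_of_threshold (α := α) (n := n) (l := 1) hT hp0 hfp
    zero_le_one fun x hx => ?_
  · simpa using this
  refine (lintegral_holderMax_one_le hT hfm hp hi α hx hn).trans (ENNReal.ofReal_le_ofReal ?_)
  rw [one_mul]
  gcongr _ * _ * (_ + ?_)
  refine integral_mono_of_nonneg (Filter.Eventually.of_forall fun ω => ?_)
    (hi.div_const _) (Filter.Eventually.of_forall fun ω => ?_)
  · simp only [Pi.zero_apply]; split_ifs <;> positivity
  · simp only []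
    gcongr
    split_ifs
    · exact le_rfl
    · positivity

/-- The largest of n stationary variables in L^p is o(n^{1/p}) in mean, with no assumption on
dependence: the part of |f|^p above x n^{1/p} has vanishing integral. -/
theorem lintegral_holderMax_one_small [IsProbabilityMeasure μ] {T : Ω → Ω}
    (hT : MeasurePreserving T μ μ) {f : Ω → ℝ} (hfm : Measurable f) {p : ℝ} (hp : 1 ≤ p)
    (hfp : MemLp f (ENNReal.ofReal p) μ) (α : ℝ) {ε : ℝ} (hε : 0 < ε) :
    ∃ N : ℕ, ∀ n : ℕ, N ≤ n →
      ∫⁻ ω, holderMax α T f n 1 ω ∂μ ≤ ENNReal.ofReal (ε * (n : ℝ) ^ (1 / p)) := by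
  have hp0 : 0 < p := by linarith
  have hi := integrable_abs_rpow hp0 hfp
  set x := ε / 2 with hxdef
  have hx : 0 < x := by positivity
  set F : ℕ → Ω → ℝ := fun n ω =>
    (if x * (n : ℝ) ^ (1 / p) < |f ω| then |f ω| ^ p else 0) / x ^ p with hF
  have hFm : ∀ n, Measurable (F n) := fun n =>
    (Measurable.ite (measurableSet_lt measurable_const hfm.abs) (hfm.abs.pow_const _)
      measurable_const).div_const _
  have htop : Filter.Tendsto (fun n : ℕ => x * (n : ℝ) ^ (1 / p)) Filter.atTop Filter.atTop :=
    Filter.Tendsto.const_mul_atTop hx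
      ((tendsto_rpow_atTop (by positivity)).comp tendsto_natCast_atTop_atTop)
  have hlim : Filter.Tendsto (fun n => ∫ ω, F n ω ∂μ) Filter.atTop (𝓝 (∫ _, (0 : ℝ) ∂μ)) := by
    refine tendsto_integral_of_dominated_convergence (fun ω => |f ω| ^ p / x ^ p)
      (fun n => (hFm n).aestronglyMeasurable) (hi.div_const _)
      (fun n => Filter.Eventually.of_forall fun ω => ?_)
      (Filter.Eventually.of_forall fun ω => ?_)
    · simp only [hF]
      split_ifs
      · rw [Real.norm_eq_abs, abs_of_nonneg (by positivity)]
      · rw [zero_div, norm_zero]; positivity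
    · refine tendsto_const_nhds.congr' ?_
      filter_upwards [htop.eventually_ge_atTop |f ω|] with n hn
      simp only [hF]
      rw [if_neg (not_lt.2 hn), zero_div]
  rw [integral_zero] at hlim
  obtain ⟨N, hN⟩ := Filter.eventually_atTop.1 (hlim.eventually (gt_mem_nhds one_pos))
  refine ⟨max N 1, fun n hn => ?_⟩
  refine (lintegral_holderMax_one_le hT hfm hp hi α hx ((le_max_right _ _).trans hn)).trans
    (ENNReal.ofReal_le_ofReal ?_)
  have h1 := (hN n ((le_max_left _ _).trans hn)).le
  calc _ ≤ (n : ℝ) ^ (1 / p) * x * (1 + 1) := by gcongr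
    _ = _ := by rw [hxdef]; ring

end

/-! ### Iterated pairing and martingale approximation -/

/-- Functions `g r` whose pair sums under `τ r` are, up to shifts, `g (r + 1)` plus a martingale
difference `D r` for `τ (r + 1) = τ r ∘ τ r`. -/
structure IsCascade {Ω : Type*} (G : MeasurableSpace Ω) {mΩ : MeasurableSpace Ω} (μ : Measure Ω)
    (p : ℝ) (K : ℝ≥0) (τ : ℕ → Ω ≃ᵐ Ω) (g D : ℕ → Ω → ℝ) : Prop where
  preserving : ∀ r, MeasurePreserving (τ r) μ μ
  doubling : ∀ r, (τ (r + 1) : Ω → Ω) = τ r ∘ τ r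
  le : G ≤ mΩ
  le_comap : ∀ r, G ≤ G.comap (τ r)
  measurable : ∀ r, Measurable (g r)
  memLp : ∀ r, MemLp (g r) (ENNReal.ofReal p) μ
  measurable_diff : ∀ r, Measurable (D r)
  memLp_diff : ∀ r, MemLp (D r) (ENNReal.ofReal p) μ
  innovation : ∀ r, IsInnovation μ G (G.comap (τ (r + 1))) (D r)
  eLpNorm_diff_le : ∀ r, eLpNorm (D r) (ENNReal.ofReal p) μ
    ≤ K * eLpNorm (g r) (ENNReal.ofReal p) μ
  decomposition : ∀ r, ∃ A B : Ω → Ω, MeasurePreserving A μ μ ∧ MeasurePreserving B μ μ ∧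
    Function.Commute (τ (r + 1)) A ∧ Function.Commute (τ (r + 1)) B ∧
    g r + g r ∘ τ r =ᵐ[μ] g (r + 1) ∘ A + D r ∘ B

namespace IsCascade

variable {Ω : Type*} {G : MeasurableSpace Ω} {mΩ : MeasurableSpace Ω} {μ : Measure Ω}
  {p : ℝ} {K : ℝ≥0} {τ : ℕ → Ω ≃ᵐ Ω} {g D : ℕ → Ω → ℝ}

theorem lintegral_comp {T A : Ω → Ω} {α : ℝ} {f : Ω → ℝ} {n l : ℕ} (hT : Measurable T)
    (hf : Measurable f) (hA : MeasurePreserving A μ μ) (hTA : Function.Commute T A) :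
    ∫⁻ ω, holderMax α T (f ∘ A) n l ω ∂μ = ∫⁻ ω, holderMax α T f n l ω ∂μ := by
  rw [holderMax_comp hTA]
  exact hA.lintegral_comp (measurable_holderMax hT hf)

/-- The shifts in the decomposition commute with the dynamics and preserve the measure, so they
disappear after integration. -/
theorem lintegral_step (h : IsCascade G μ p K τ g D) {α : ℝ} (hα : 0 < α) (r n l : ℕ) :
    ∫⁻ ω, holderMax α (τ r) (g r) n l ω ∂μ ≤ 2 * ∫⁻ ω, holderMax α (τ r) (g r) n 1 ω ∂μ
      + ENNReal.ofReal (2 ^ (-α)) *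
        (∫⁻ ω, holderMax α (τ (r + 1)) (g (r + 1)) (n / 2) (l / 2) ω ∂μ
          + ∫⁻ ω, holderMax α (τ (r + 1)) (D r) (n / 2) (l / 2) ω ∂μ) := by
  obtain ⟨A, B, hA, hB, hcA, hcB, hdec⟩ := h.decomposition r
  have hm1 := measurable_holderMax (α := α) (n := n) (l := 1) (τ r).measurable (h.measurable r)
  have hm2 := measurable_holderMax (α := α) (n := n / 2) (l := l / 2) (τ (r + 1)).measurable
    ((h.measurable (r + 1)).comp hA.measurable)
  have hm3 := measurable_holderMax (α := α) (n := n / 2) (l := l / 2) (τ (r + 1)).measurable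
    ((h.measurable_diff r).comp hB.measurable)
  have hm23 : Measurable fun ω => holderMax α (τ (r + 1)) (g (r + 1) ∘ A) (n / 2) (l / 2) ω
      + holderMax α (τ (r + 1)) (D r ∘ B) (n / 2) (l / 2) ω := hm2.add hm3
  calc _ ≤ ∫⁻ ω, (2 * holderMax α (τ r) (g r) n 1 ω + ENNReal.ofReal (2 ^ (-α)) *
        (holderMax α (τ (r + 1)) (g (r + 1) ∘ A) (n / 2) (l / 2) ω
          + holderMax α (τ (r + 1)) (D r ∘ B) (n / 2) (l / 2) ω)) ∂μ := by
        refine lintegral_mono_ae ?_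
        filter_upwards [holderMax_congr_ae (h.preserving (r + 1)) hdec α (n / 2) (l / 2)]
          with ω hω
        refine (holderMax_le_pairing hα).trans ?_
        rw [← h.doubling, hω]
        gcongr
        exact holderMax_add_le
    _ = _ := by
        rw [lintegral_add_left (hm1.const_mul _), lintegral_const_mul _ hm1,
          lintegral_const_mul _ hm23, lintegral_add_left hm2,
          lintegral_comp (τ (r + 1)).measurable (h.measurable (r + 1)) hA hcA,
          lintegral_comp (τ (r + 1)).measurable (h.measurable_diff r) hB hcB]

/-- The weight `2 ^ (-1/2)`. -/
noncomputable def weight : ℝ≥0∞ := ENNReal.ofReal (2 ^ (-(1 / 2) : ℝ))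

/-- The tails of the Maxwell–Woodroofe series. -/
noncomputable def tailSum (μ : Measure Ω) (p : ℝ) (g : ℕ → Ω → ℝ) (r : ℕ) : ℝ≥0∞ :=
  ∑' s, weight ^ s * eLpNorm (g (r + s)) (ENNReal.ofReal p) μ

theorem tailSum_eq (r : ℕ) : tailSum μ p g r =
    eLpNorm (g r) (ENNReal.ofReal p) μ + weight * tailSum μ p g (r + 1) := by
  unfold tailSum
  rw [tsum_eq_zero_add' ENNReal.summable, ← ENNReal.tsum_mul_left]
  simp only [pow_zero, one_mul, add_zero]
  congr 2
  funext s
  rw [pow_succ', mul_assoc, show r + (s + 1) = r + 1 + s by ring]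

/-- Multiplied by its weight, `tailSum` at r is the remainder from r on of the series at 0. -/
theorem tendsto_weight_pow_mul_tailSum (h : tailSum μ p g 0 ≠ ∞) :
    Filter.Tendsto (fun r => weight ^ r * tailSum μ p g r) Filter.atTop (𝓝 0) := by
  refine (ENNReal.tendsto_sum_nat_add _ h).congr fun r => ?_
  unfold tailSum
  rw [← ENNReal.tsum_mul_left]
  congr 1
  funext s
  rw [← mul_assoc, ← pow_add, zero_add, add_comm r s]

/-- One pairing gains 2^{-α} from the Hölder scaling and 2^{-1/p} from halving n. Their product is
the ratio 2^{-1/2} of the Maxwell–Woodroofe series. -/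
theorem two_rpow_mul_half_le (hp : 2 < p) (n : ℕ) :
    ENNReal.ofReal (2 ^ (-(1 / 2 - 1 / p))) * ENNReal.ofReal (((n / 2 : ℕ) : ℝ) ^ (1 / p))
      ≤ weight * ENNReal.ofReal ((n : ℝ) ^ (1 / p)) := by
  have hp0 : 0 < p := by linarith
  rw [weight, ← ENNReal.ofReal_mul (by positivity), ← ENNReal.ofReal_mul (by positivity)]
  refine ENNReal.ofReal_le_ofReal ?_
  have h1 : ((n / 2 : ℕ) : ℝ) ≤ n / 2 := Nat.cast_div_le.trans_eq (by push_cast; rfl)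
  calc (2 : ℝ) ^ (-(1 / 2 - 1 / p)) * ((n / 2 : ℕ) : ℝ) ^ (1 / p)
      ≤ (2 : ℝ) ^ (-(1 / 2 - 1 / p)) * ((n : ℝ) / 2) ^ (1 / p) := by gcongr
    _ = _ := by
      rw [Real.div_rpow (by positivity) zero_le_two, neg_sub, Real.rpow_sub two_pos,
        Real.rpow_neg zero_le_two]
      field_simp

/-- The maximal inequality in terms of the Maxwell–Woodroofe series. -/
theorem exists_lintegral_le_tailSum [IsProbabilityMeasure μ] (h : IsCascade G μ p K τ g D)
    (hp : 2 < p) : ∃ C : ℝ≥0∞, C ≠ ∞ ∧ ∀ n r l : ℕ,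
      ∫⁻ ω, holderMax (1 / 2 - 1 / p) (τ r) (g r) n l ω ∂μ
        ≤ C * ENNReal.ofReal ((n : ℝ) ^ (1 / p)) * tailSum μ p g r := by
  have hp0 : 0 < p := by linarith
  have hα : 0 < 1 / 2 - 1 / p := by
    have := one_div_lt_one_div_of_lt two_pos hp
    linarith
  obtain ⟨m, hm'⟩ := exists_nat_gt p
  have hm : p < 2 * m := by
    have : (0 : ℝ) ≤ m := by positivity
    linarith
  have hM := martingaleConst_pos hp hm
  set M := ENNReal.ofReal (2 * martingaleConst p m)
  have hw : weight ≤ 1 := by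
    refine ENNReal.ofReal_le_one.2 ?_
    exact Real.rpow_le_one_of_one_le_of_nonpos one_le_two (by norm_num)
  -- The summand 4 = 2 · 2 pays for the largest summand and M K for the martingale part. The
  -- induction is on n, which each pairing halves, with r and l free.
  refine ⟨4 + M * K, by finiteness, fun n => ?_⟩
  induction n using Nat.strong_induction_on with
  | _ n ih =>
    intro r l
    rcases Nat.eq_zero_or_pos n with rfl | hn
    · simp
    set X := ENNReal.ofReal ((n : ℝ) ^ (1 / p))
    set a := eLpNorm (g r) (ENNReal.ofReal p) μ
    have h1 : ∫⁻ ω, holderMax (1 / 2 - 1 / p) (τ r) (g r) n 1 ω ∂μ ≤ 2 * X * a := by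
      refine (lintegral_holderMax_one_le_eLpNorm (h.preserving r) (h.measurable r) (by linarith)
        (h.memLp r) _ n).trans_eq ?_
      rw [ENNReal.ofReal_mul zero_le_two]; simp [X, a]
    have h2 := ih (n / 2) (by omega) (r + 1) (l / 2)
    have h3 : ∫⁻ ω, holderMax (1 / 2 - 1 / p) (τ (r + 1)) (D r) (n / 2) (l / 2) ω ∂μ
        ≤ M * ENNReal.ofReal (((n / 2 : ℕ) : ℝ) ^ (1 / p)) * (K * a) := by
      refine (lintegral_holderMax_le_eLpNorm (h.preserving (r + 1)) h.le (h.le_comap (r + 1))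
        (h.measurable_diff r) (h.innovation r) hp (h.memLp_diff r) hm (n / 2) (l / 2)).trans ?_
      rw [ENNReal.ofReal_mul (by positivity)]
      gcongr
      exact h.eLpNorm_diff_le r
    set Y := ENNReal.ofReal (((n / 2 : ℕ) : ℝ) ^ (1 / p))
    have hXY : ENNReal.ofReal (2 ^ (-(1 / 2 - 1 / p))) * Y ≤ weight * X :=
      two_rpow_mul_half_le hp n
    calc _ ≤ _ := h.lintegral_step hα r n l
      _ ≤ 2 * (2 * X * a) + ENNReal.ofReal (2 ^ (-(1 / 2 - 1 / p))) *
          ((4 + M * K) * Y * tailSum μ p g (r + 1) + M * Y * (K * a)) := by gcongr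
      _ = 4 * X * a + (ENNReal.ofReal (2 ^ (-(1 / 2 - 1 / p))) * Y) *
          ((4 + M * K) * tailSum μ p g (r + 1) + M * (K * a)) := by ring
      _ ≤ 4 * X * a + (weight * X) * ((4 + M * K) * tailSum μ p g (r + 1) + M * (K * a)) := by
          gcongr
      _ = 4 * X * a + X * ((4 + M * K) * (weight * tailSum μ p g (r + 1)))
          + weight * (X * (M * K * a)) := by ring
      _ ≤ 4 * X * a + X * ((4 + M * K) * (weight * tailSum μ p g (r + 1)))
          + 1 * (X * (M * K * a)) := by gcongr
      _ = (4 + M * K) * X * (a + weight * tailSum μ p g (r + 1)) := by ring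
      _ = _ := by rw [← tailSum_eq]

/-- `c` bounds the normalized short-range Hölder maxima of `g r` asymptotically. -/
def ShortRangeBound (μ : Measure Ω) (p : ℝ) (τ : ℕ → Ω ≃ᵐ Ω) (g : ℕ → Ω → ℝ) (r : ℕ)
    (c : ℝ≥0∞) : Prop :=
  ∀ ε : ℝ, 0 < ε → ∃ δ : ℝ, 0 < δ ∧ ∃ N : ℕ, ∀ n l : ℕ, N ≤ n → (l : ℝ) ≤ δ * n →
    ∫⁻ ω, holderMax (1 / 2 - 1 / p) (τ r) (g r) n l ω ∂μ
      ≤ (c + ENNReal.ofReal ε) * ENNReal.ofReal ((n : ℝ) ^ (1 / p))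

/-- Of the three terms of a pairing step, the largest summand and the martingale part are negligible
at short range. Only the next function is passed on, with one factor `weight`. -/
theorem shortRangeBound_step [IsProbabilityMeasure μ] (h : IsCascade G μ p K τ g D) (hp : 2 < p)
    {r : ℕ} {c : ℝ≥0∞} (hc : ShortRangeBound μ p τ g (r + 1) c) :
    ShortRangeBound μ p τ g r (weight * c) := by
  have hα : 0 < 1 / 2 - 1 / p := by
    have := one_div_lt_one_div_of_lt two_pos hp
    linarith
  have hw : weight ≤ 1 := by
    refine ENNReal.ofReal_le_one.2 ?_
    exact Real.rpow_le_one_of_one_le_of_nonpos one_le_two (by norm_num)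
  intro ε hε
  have hε4 : 0 < ε / 4 := by positivity
  obtain ⟨δ₁, hδ₁, N₁, h₁⟩ := hc (ε / 4) hε4
  obtain ⟨δ₂, hδ₂, h₂⟩ := lintegral_holderMax_small (h.preserving (r + 1)) h.le
    (h.le_comap (r + 1)) (h.measurable_diff r) (h.innovation r) hp (h.memLp_diff r) hε4
  obtain ⟨N₃, h₃⟩ := lintegral_holderMax_one_small (h.preserving r) (h.measurable r)
    (by linarith) (h.memLp r) (1 / 2 - 1 / p) hε4
  set δ := min δ₁ δ₂
  have hδ : 0 < δ := lt_min hδ₁ hδ₂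
  -- For n ≥ 2 one has n ≤ 4 (n / 2) despite integer division, so l ≤ (δ / 2) n gives l / 2 ≤ δ (n /
  -- 2). The bound 2 N₁ ensures n / 2 ≥ N₁.
  refine ⟨δ / 2, by positivity, max 2 (max (2 * N₁) N₃), fun n l hn hl => ?_⟩
  have hn2 : 2 ≤ n := (le_max_left _ _).trans hn
  have hnN : 2 * N₁ ≤ n := (le_max_left _ _).trans ((le_max_right _ _).trans hn)
  have hnN3 : N₃ ≤ n := (le_max_right _ _).trans ((le_max_right _ _).trans hn)
  have hl2 : ((l / 2 : ℕ) : ℝ) ≤ δ * ((n / 2 : ℕ) : ℝ) := by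
    have e1 : ((l / 2 : ℕ) : ℝ) ≤ l / 2 := Nat.cast_div_le.trans_eq (by push_cast; rfl)
    have e2 : (n : ℝ) ≤ 4 * ((n / 2 : ℕ) : ℝ) := by
      exact_mod_cast (by omega : n ≤ 4 * (n / 2))
    have e3 : δ * n ≤ δ * (4 * ((n / 2 : ℕ) : ℝ)) := by gcongr
    linarith
  have b₁ := h₁ (n / 2) (l / 2) (by omega) (hl2.trans (by gcongr; exact min_le_left _ _))
  have b₂ := h₂ (n / 2) (l / 2) (hl2.trans (by gcongr; exact min_le_right _ _))
  have b₃ := h₃ n hnN3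
  rw [ENNReal.ofReal_mul hε4.le] at b₂ b₃
  set X := ENNReal.ofReal ((n : ℝ) ^ (1 / p))
  set e := ENNReal.ofReal (ε / 4)
  have hXY := two_rpow_mul_half_le hp n
  set Y := ENNReal.ofReal (((n / 2 : ℕ) : ℝ) ^ (1 / p))
  have he : ENNReal.ofReal ε = 4 * e := by
    rw [show (4 : ℝ≥0∞) = ENNReal.ofReal 4 by simp, ← ENNReal.ofReal_mul (by norm_num)]
    congr 1; ring
  calc _ ≤ _ := h.lintegral_step hα r n l
    _ ≤ 2 * (e * X) + ENNReal.ofReal (2 ^ (-(1 / 2 - 1 / p))) * ((c + e) * Y + e * Y) := by gcongr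
    _ = 2 * (e * X) + (ENNReal.ofReal (2 ^ (-(1 / 2 - 1 / p))) * Y) * (c + 2 * e) := by ring
    _ ≤ 2 * (e * X) + (weight * X) * (c + 2 * e) := by gcongr
    _ = 2 * (e * X) + weight * c * X + weight * (2 * e * X) := by ring
    _ ≤ 2 * (e * X) + weight * c * X + 1 * (2 * e * X) := by gcongr
    _ = _ := by rw [he]; ring

/-- The short-range Hölder maxima of the partial sums of `g 0` are negligible. -/
theorem lintegral_small [IsProbabilityMeasure μ] (h : IsCascade G μ p K τ g D) (hp : 2 < p)
    (ht : tailSum μ p g 0 ≠ ∞) {ε : ℝ} (hε : 0 < ε) :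
    ∃ δ : ℝ, 0 < δ ∧ ∃ N : ℕ, ∀ n l : ℕ, N ≤ n → (l : ℝ) ≤ δ * n →
      ∫⁻ ω, holderMax (1 / 2 - 1 / p) (τ 0) (g 0) n l ω ∂μ
        ≤ ENNReal.ofReal (ε * (n : ℝ) ^ (1 / p)) := by
  obtain ⟨C, hC, hbound⟩ := h.exists_lintegral_le_tailSum hp
  have hdesc : ∀ R r c, ShortRangeBound μ p τ g (r + R) c →
      ShortRangeBound μ p τ g r (weight ^ R * c) := by
    intro R
    induction R with
    | zero => intro r c hc; simpa using hc
    | succ R ih =>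
      intro r c hc
      have := ih r (weight * c) (h.shortRangeBound_step hp hc)
      rwa [← mul_assoc, ← pow_succ] at this
  have hlim : Filter.Tendsto (fun r => C * (weight ^ r * tailSum μ p g r)) Filter.atTop
      (𝓝 (C * 0)) := ENNReal.Tendsto.const_mul (tendsto_weight_pow_mul_tailSum ht) (Or.inr hC)
  rw [mul_zero] at hlim
  have hε2 : (0 : ℝ≥0∞) < ENNReal.ofReal (ε / 2) := by simpa using hε
  -- The depth R makes C times the remainder of the series less than ε / 2. At that depth the
  -- maximal inequality without any restriction on l suffices, and R steps bring it back to r = 0.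
  obtain ⟨R, hR⟩ := (hlim.eventually (gt_mem_nhds hε2)).exists
  have hRb : ShortRangeBound μ p τ g (0 + R) (C * tailSum μ p g R) := by
    intro ε' _
    refine ⟨1, one_pos, 0, fun n l _ _ => ?_⟩
    rw [zero_add]
    refine (hbound n R l).trans ?_
    calc _ = C * tailSum μ p g R * ENNReal.ofReal ((n : ℝ) ^ (1 / p)) := by ring
      _ ≤ _ := by gcongr; exact le_self_add
  obtain ⟨δ, hδ, N, hN⟩ := hdesc R 0 _ hRb (ε / 2) (by positivity)
  refine ⟨δ, hδ, N, fun n l hn hl => (hN n l hn hl).trans ?_⟩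
  rw [ENNReal.ofReal_mul hε.le]
  gcongr
  calc weight ^ R * (C * tailSum μ p g R) + ENNReal.ofReal (ε / 2)
      = C * (weight ^ R * tailSum μ p g R) + ENNReal.ofReal (ε / 2) := by ring
    _ ≤ ENNReal.ofReal (ε / 2) + ENNReal.ofReal (ε / 2) := by gcongr
    _ = ENNReal.ofReal ε := by
      rw [← ENNReal.ofReal_add (by positivity) (by positivity), add_halves]

end IsCascade

/-! ### The cascade attached to condition (C) -/

section Koopman

variable {Ω : Type*} {mΩ : MeasurableSpace Ω} {μ : Measure Ω} {q : ℝ≥0∞}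

theorem eLpNorm_coe_eq_ofReal_norm (f : Lp ℝ q μ) : eLpNorm f q μ = ENNReal.ofReal ‖f‖ := by
  rw [Lp.norm_def, ENNReal.ofReal_toReal (Lp.eLpNorm_ne_top f)]

theorem coeFn_koopman {T : Ω ≃ᵐ Ω} (hT : MeasurePreserving T μ μ) (f : Lp ℝ q μ) :
    koopman q T hT f =ᵐ[μ] f ∘ T :=
  Lp.coeFn_compMeasurePreserving f hT

theorem coeFn_koopman_pow {T : Ω ≃ᵐ Ω} (hT : MeasurePreserving T μ μ) (f : Lp ℝ q μ) (n : ℕ) :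
    (koopman q T hT ^ n) f =ᵐ[μ] f ∘ T^[n] := by
  induction n with
  | zero => rfl
  | succ n ih =>
    rw [pow_succ', Module.End.mul_apply, Function.iterate_succ, ← Function.comp_assoc]
    exact (coeFn_koopman hT _).trans (hT.quasiMeasurePreserving.ae_eq_comp ih)

theorem norm_koopman {T : Ω ≃ᵐ Ω} (hT : MeasurePreserving T μ μ) (f : Lp ℝ q μ) :
    ‖koopman q T hT f‖ = ‖f‖ := Lp.norm_compMeasurePreserving f hT

theorem norm_koopman_pow {T : Ω ≃ᵐ Ω} (hT : MeasurePreserving T μ μ) (f : Lp ℝ q μ) (n : ℕ) :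
    ‖(koopman q T hT ^ n) f‖ = ‖f‖ := by
  induction n with
  | zero => simp
  | succ n ih => rw [pow_succ', Module.End.mul_apply, norm_koopman, ih]

theorem norm_koopmanInv_pow {T : Ω ≃ᵐ Ω} (hT : MeasurePreserving T μ μ) (f : Lp ℝ q μ) (n : ℕ) :
    ‖(koopmanInv q T hT ^ n) f‖ = ‖f‖ :=
  norm_koopman_pow (hT.symm T) f n

theorem koopman_mul_koopmanInv {T : Ω ≃ᵐ Ω} (hT : MeasurePreserving T μ μ) :
    koopman q T hT * koopmanInv q T hT = 1 := by
  ext1 f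
  refine Lp.ext ?_
  rw [Module.End.mul_apply, Module.End.one_apply]
  refine (coeFn_koopman hT _).trans ?_
  have h1 : koopmanInv q T hT f =ᵐ[μ] f ∘ T.symm := coeFn_koopman (hT.symm T) f
  refine (hT.quasiMeasurePreserving.ae_eq_comp h1).trans ?_
  rw [Function.comp_assoc, T.symm_comp_self, Function.comp_id]

theorem koopmanInv_mul_koopman {T : Ω ≃ᵐ Ω} (hT : MeasurePreserving T μ μ) :
    koopmanInv q T hT * koopman q T hT = 1 := by
  ext1 f
  refine Lp.ext ?_
  rw [Module.End.mul_apply, Module.End.one_apply]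
  have h2 : koopmanInv q T hT (koopman q T hT f) =ᵐ[μ] koopman q T hT f ∘ T.symm :=
    coeFn_koopman (hT.symm T) _
  refine h2.trans (((hT.symm T).quasiMeasurePreserving.ae_eq_comp (coeFn_koopman hT f)).trans ?_)
  rw [Function.comp_assoc, T.self_comp_symm, Function.comp_id]

theorem koopman_pow_mul_koopmanInv_pow {T : Ω ≃ᵐ Ω} (hT : MeasurePreserving T μ μ) (n l : ℕ) :
    koopman q T hT ^ (n + l) * koopmanInv q T hT ^ l = koopman q T hT ^ n := by
  have hc : Commute (koopman q T hT) (koopmanInv q T hT) := by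
    rw [Commute, SemiconjBy, koopman_mul_koopmanInv, koopmanInv_mul_koopman]
  rw [pow_add, mul_assoc, ← hc.mul_pow, koopman_mul_koopmanInv, one_pow, mul_one]

variable {H : Submodule ℝ (Lp ℝ q μ)}

/-- The dyadic iterates `T ^ (2 ^ r)`. -/
def dyadicIterate (T : Ω ≃ᵐ Ω) : ℕ → Ω ≃ᵐ Ω
  | 0 => T
  | r + 1 => (dyadicIterate T r).trans (dyadicIterate T r)

theorem coe_dyadicIterate (T : Ω ≃ᵐ Ω) (r : ℕ) : (dyadicIterate T r : Ω → Ω) = T^[2 ^ r] := by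
  induction r with
  | zero => rfl
  | succ r ih =>
    rw [dyadicIterate, MeasurableEquiv.coe_trans, ih, ← Function.iterate_add, pow_succ, mul_two]

/-- The sum `∑_{i < 2 ^ r} P_T ^ i h`. -/
noncomputable def dyadicSum (Q : Module.End ℝ H) (h : H) (r : ℕ) : H :=
  ∑ i ∈ Finset.range (2 ^ r), (Q ^ i) h

theorem dyadicSum_succ (Q : Module.End ℝ H) (h : H) (r : ℕ) :
    dyadicSum Q h (r + 1) = dyadicSum Q h r + (Q ^ 2 ^ r) (dyadicSum Q h r) := by
  unfold dyadicSum
  rw [pow_succ, mul_two, Finset.sum_range_add, map_sum]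
  simp only [pow_add, Module.End.mul_apply]

/-- A telescoping sum. When Q is a left inverse of V, each term is a power of V applied to g - V Q
g, an element of the kernel of Q. -/
theorem sub_pow_mul_pow_eq_sum {V : Module.End ℝ (Lp ℝ q μ)} {Q : Module.End ℝ H} (f : H) (N : ℕ) :
    (f : Lp ℝ q μ) - (V ^ N) ((Q ^ N) f : H) =
      ∑ l ∈ Finset.range N, (V ^ l) (((Q ^ l) f : H) - V ((Q ((Q ^ l) f) : H) : Lp ℝ q μ)) := by
  have := Finset.sum_range_sub' (fun l => (V ^ l) (((Q ^ l) f : H) : Lp ℝ q μ)) N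
  simp only [pow_zero, Module.End.one_apply] at this
  rw [← this]
  refine Finset.sum_congr rfl fun l _ => ?_
  rw [map_sub, ← Module.End.mul_apply (V ^ l) V, ← pow_succ, ← Module.End.mul_apply Q (Q ^ l),
    ← pow_succ']

end Koopman

/-! ### Innovations under the Koopman operator -/

section Innovation

variable {Ω : Type*} {G G' : MeasurableSpace Ω} {mΩ : MeasurableSpace Ω} {μ : Measure Ω}
  [IsProbabilityMeasure μ] {q : ℝ≥0∞}

theorem condExp_eq_zero_iff (hG : G ≤ mΩ) {f : Ω → ℝ} (hf : Integrable f μ) :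
    μ[f | G] =ᵐ[μ] 0 ↔ ∀ s, MeasurableSet[G] s → ∫ ω in s, f ω ∂μ = 0 := by
  constructor
  · intro h s hs
    rw [← setIntegral_condExp hG hf hs, setIntegral_congr_ae (g := 0) (hG s hs)]
    · simp
    · filter_upwards [h] with ω hω _ using hω
  · intro h
    refine (ae_eq_condExp_of_forall_setIntegral_eq hG hf (g := 0) (fun s _ _ => ?_)
      (fun s hs _ => ?_) ?_).symm
    · exact integrableOn_zero
    · rw [h s hs]; simp
    · exact aestronglyMeasurable_zero

theorem condExp_comp_eq_zero_iff {T : Ω ≃ᵐ Ω} (hT : MeasurePreserving T μ μ) (hG : G ≤ mΩ)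
    {f : Ω → ℝ} (hf : Integrable f μ) :
    μ[f ∘ T | G.comap T] =ᵐ[μ] 0 ↔ μ[f | G] =ᵐ[μ] 0 := by
  have hG' : G.comap T ≤ mΩ := (MeasurableSpace.comap_mono hG).trans T.measurable.comap_le
  rw [condExp_eq_zero_iff hG hf,
    condExp_eq_zero_iff hG' (hT.integrable_comp_of_integrable hf)]
  have key : ∀ A, ∫ ω in T ⁻¹' A, (f ∘ T) ω ∂μ = ∫ ω in A, f ω ∂μ := fun A =>
    hT.setIntegral_preimage_emb T.measurableEmbedding f A
  constructor
  · intro h A hA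
    rw [← key]
    exact h _ ⟨A, hA, rfl⟩
  · rintro h _ ⟨A, hA, rfl⟩
    rw [key]
    exact h A hA

theorem IsInnovation.comp {T : Ω ≃ᵐ Ω} (hT : MeasurePreserving T μ μ) (hG : G ≤ mΩ)
    {f : Ω → ℝ} (hf : Integrable f μ) (h : IsInnovation μ G G' f) :
    IsInnovation μ (G.comap T) (G'.comap T) (f ∘ T) := by
  refine ⟨?_, (condExp_comp_eq_zero_iff hT hG hf).2 h.condExp_eq⟩
  obtain ⟨g, hg, hfg⟩ := h.aesm
  refine ⟨g ∘ T, hg.comp_measurable (comap_measurable T), ?_⟩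
  exact hT.quasiMeasurePreserving.ae_eq_comp hfg

variable [hq : Fact (1 ≤ q)]

theorem integrable_coe_Lp (f : Lp ℝ q μ) : Integrable f μ := (Lp.memLp f).integrable hq.out

/-- The elements of `L^q` that are innovations from `G` to `G'`. -/
def innovationSubmodule (q : ℝ≥0∞) [Fact (1 ≤ q)] (G G' : MeasurableSpace Ω)
    {mΩ : MeasurableSpace Ω} (μ : Measure Ω) [IsProbabilityMeasure μ] :
    Submodule ℝ (Lp ℝ q μ) where
  carrier := {f | IsInnovation μ G G' f}
  add_mem' {f g} hf hg := by
    have h1 : IsInnovation μ G G' (⇑f + ⇑g) := by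
      refine ⟨hf.aesm.add hg.aesm, ?_⟩
      refine (condExp_add (integrable_coe_Lp f) (integrable_coe_Lp g) G).trans ?_
      filter_upwards [hf.condExp_eq, hg.condExp_eq] with ω h1 h2
      rw [Pi.add_apply, h1, h2]; simp
    exact h1.congr (Lp.coeFn_add f g).symm
  zero_mem' := by
    have h1 : IsInnovation μ G G' (0 : Ω → ℝ) := by
      refine ⟨aestronglyMeasurable_zero, ?_⟩
      rw [condExp_zero]
    exact h1.congr (Lp.coeFn_zero ℝ q μ).symm
  smul_mem' c f hf := by
    have h1 : IsInnovation μ G G' (c • ⇑f) := by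
      refine ⟨hf.aesm.const_smul c, ?_⟩
      refine (condExp_smul c (f : Ω → ℝ) G).trans ?_
      filter_upwards [hf.condExp_eq] with ω h1
      rw [Pi.smul_apply, h1]; simp
    exact h1.congr (Lp.coeFn_smul c f).symm

theorem mem_innovationSubmodule {f : Lp ℝ q μ} :
    f ∈ innovationSubmodule q G G' μ ↔ IsInnovation μ G G' f := Iff.rfl

theorem comap_iterate_le {T : Ω ≃ᵐ Ω} (hG : G ≤ mΩ) (n : ℕ) : G.comap T^[n] ≤ mΩ :=
  (MeasurableSpace.comap_mono hG).trans (T.measurable.iterate n).comap_le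

theorem comap_iterate_succ {T : Ω → Ω} (n : ℕ) :
    (G.comap T^[n]).comap T = G.comap T^[n + 1] := by
  rw [MeasurableSpace.comap_comp]; rfl

theorem comap_iterate_succ' {T : Ω → Ω} (n : ℕ) :
    (G.comap T).comap T^[n] = G.comap T^[n + 1] := by
  rw [MeasurableSpace.comap_comp, ← Function.iterate_succ']

theorem comap_iterate_mono {T : Ω → Ω} (hGT : G ≤ G.comap T) {n m : ℕ} (h : n ≤ m) :
    G.comap T^[n] ≤ G.comap T^[m] := by
  induction h with
  | refl => exact le_rfl
  | step _ ih =>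
    refine ih.trans ?_
    rw [← comap_iterate_succ']
    exact MeasurableSpace.comap_mono hGT

theorem le_comap_iterate {T : Ω → Ω} (hGT : G ≤ G.comap T) (n : ℕ) : G ≤ G.comap T^[n] := by
  have := comap_iterate_mono hGT (Nat.zero_le n)
  rwa [Function.iterate_zero, MeasurableSpace.comap_id] at this

/-- The l-th shift is an innovation from T^{-l} G to T^{-l-1} G. Coarsening the first σ-algebra and
refining the second gives one common pair for all l < N, so these shifts can be added within a
single subspace. -/
theorem koopman_pow_mem_innovationSubmodule {T : Ω ≃ᵐ Ω} (hT : MeasurePreserving T μ μ)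
    (hG : G ≤ mΩ) (hGT : G ≤ G.comap T) {e : Lp ℝ q μ}
    (he : e ∈ innovationSubmodule q G (G.comap T) μ) {l N : ℕ} (hl : l < N) :
    (koopman q T hT ^ l) e ∈ innovationSubmodule q G (G.comap T^[N]) μ := by
  have key : ∀ l : ℕ, (koopman q T hT ^ l) e ∈
      innovationSubmodule q (G.comap T^[l]) (G.comap T^[l + 1]) μ := by
    intro l
    induction l with
    | zero => simpa using he
    | succ l ih =>
      rw [pow_succ', Module.End.mul_apply]
      have h1 := (mem_innovationSubmodule.1 ih).comp hT (comap_iterate_le hG l)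
        (integrable_coe_Lp _)
      rw [comap_iterate_succ, comap_iterate_succ] at h1
      exact h1.congr (coeFn_koopman hT _).symm
  refine (mem_innovationSubmodule.1 (key l)).mono ?_ (comap_iterate_mono hGT hl)
    (comap_iterate_le hG l)
  exact le_comap_iterate hGT l

end Innovation

/-! ### Martingale approximation under condition (C) -/

section ConditionC

variable {Ω : Type*} {𝓜 G : MeasurableSpace Ω} {mΩ : MeasurableSpace Ω} {μ : Measure Ω}
  [IsProbabilityMeasure μ] {q : ℝ≥0∞} [hq : Fact (1 ≤ q)] {T : Ω ≃ᵐ Ω}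
  {hT : MeasurePreserving T μ μ} {h𝓜 : 𝓜 ≤ mΩ}
  {hT𝓜 : ∀ A, MeasurableSet[𝓜] A → MeasurableSet[𝓜] (T '' A)}
  {H : Submodule ℝ (Lp ℝ q μ)} {P : ℕ → Module.End ℝ H}

/-- The kernel of `P_T` consists of innovations with respect to a single pair of consecutive
`σ`-algebras. -/
theorem ConditionC.exists_innovation (hC : ConditionC 𝓜 T hT h𝓜 hT𝓜 H P) :
    ∃ G : MeasurableSpace Ω, G ≤ mΩ ∧ G ≤ G.comap T ∧
      ∀ f : H, P 1 f = 0 → (f : Lp ℝ q μ) ∈ innovationSubmodule q G (G.comap T) μ := by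
  have hB : 𝓜 ≤ 𝓜.comap T := fun A hA =>
    ⟨T '' A, hT𝓜 A hA, Set.preimage_image_eq A T.injective⟩
  have hAle : 𝓜.comap T.symm ≤ mΩ :=
    (MeasurableSpace.comap_mono h𝓜).trans T.symm.measurable.comap_le
  have hAeq : (𝓜.comap T.symm).comap T = 𝓜 := by
    rw [MeasurableSpace.comap_comp, T.symm_comp_self, MeasurableSpace.comap_id]
  have hA : 𝓜.comap T.symm ≤ (𝓜.comap T.symm).comap T := by
    rw [hAeq]
    refine (MeasurableSpace.comap_mono hB).trans ?_
    rw [MeasurableSpace.comap_comp, T.self_comp_symm, MeasurableSpace.comap_id]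
  have hor : ∀ f : H, P 1 f = 0 →
      (f : Lp ℝ q μ) ∈ innovationSubmodule q (𝓜.comap T.symm) ((𝓜.comap T.symm).comap T) μ ∨
      (f : Lp ℝ q μ) ∈ innovationSubmodule q 𝓜 (𝓜.comap T) μ := by
    intro f hf
    have hfi := integrable_coe_Lp (f : Lp ℝ q μ)
    rcases hC.martingale f hf with h | h
    -- Index 0 of the filtration T^{-i} 𝓜 says that f is 𝓜-measurable and that f∘T has zero
    -- conditional expectation given 𝓜, that is, f has zero conditional expectation given T 𝓜, which
    -- is `𝓜.comap T.symm`.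
    · left
      refine ⟨?_, ?_⟩
      · rw [hAeq]
        have h1 := h.adapted 0
        change AEStronglyMeasurable[𝓜.comap id] _ μ at h1
        rw [MeasurableSpace.comap_id] at h1
        exact h1
      · have h2 := h.condExp_eq_zero 0
        change μ[(f : Lp ℝ q μ) ∘ T | 𝓜.comap id] =ᵐ[μ] 0 at h2
        rw [MeasurableSpace.comap_id] at h2
        refine (condExp_comp_eq_zero_iff hT hAle hfi).1 ?_
        rwa [hAeq]
    · right
      exact ⟨h.adapted 0, (condExp_comp_eq_zero_iff hT h𝓜 hfi).1 (h.condExp_eq_zero 0)⟩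
  -- The filtration may depend on f, but a vector space covered by two subspaces lies in one of
  -- them; so one choice of `G` serves the whole kernel.
  by_cases hall : ∀ f : H, P 1 f = 0 →
      (f : Lp ℝ q μ) ∈ innovationSubmodule q 𝓜 (𝓜.comap T) μ
  · exact ⟨𝓜, h𝓜, hB, hall⟩
  · refine ⟨𝓜.comap T.symm, hAle, hA, fun g hg => ?_⟩
    by_contra hgA
    push Not at hall
    obtain ⟨f, hf, hfB⟩ := hall
    have hfA := (hor f hf).resolve_right hfB
    have hgB := (hor g hg).resolve_left hgA
    rcases hor (f + g) (by rw [map_add, hf, hg, add_zero]) with h | h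
    · refine hgA ?_
      have := Submodule.sub_mem _ h hfA
      simpa using this
    · refine hfB ?_
      have := Submodule.sub_mem _ h hgB
      simpa using this

/-- Martingale approximation of the pair sums, for both forms of the inverse. -/
theorem ConditionC.exists_decomposition (hC : ConditionC 𝓜 T hT h𝓜 hT𝓜 H P) (hG : G ≤ mΩ)
    (hGT : G ≤ G.comap T)
    (hker : ∀ f : H, P 1 f = 0 → (f : Lp ℝ q μ) ∈ innovationSubmodule q G (G.comap T) μ)
    {N : ℕ} (hN : 1 ≤ N) (f : H) :
    ∃ (a b : ℕ) (D : Lp ℝ q μ), D ∈ innovationSubmodule q G (G.comap T^[N]) μ ∧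
      ‖D‖ ≤ ‖(f : Lp ℝ q μ)‖ + ‖((P 1 ^ N) f : Lp ℝ q μ)‖ ∧
      (f : Lp ℝ q μ) + (koopman q T hT ^ N) f =
        (koopman q T hT ^ a) ((f + (P 1 ^ N) f : H) : Lp ℝ q μ) + (koopman q T hT ^ b) D := by
  rcases hC.inverse with ⟨hH, hinv⟩ | ⟨hH, hinv⟩
  · have hmem : ∀ g : H, (g : Lp ℝ q μ) - koopmanInv q T hT (P 1 g : H) ∈
        innovationSubmodule q G (G.comap T) μ := by
      intro g
      have := hker (g - ⟨koopmanInv q T hT (P 1 g : H), hH _ (P 1 g).2⟩)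
        (by rw [map_sub, hinv, sub_self])
      simpa using this
    -- Here f + U^N f = (f + P^N f) + U^N (f - U^{-N} P^N f). One factor U is left outside D, so
    -- that its pieces are U^{N-1-l} applied to innovations, with exponents below N.
    refine ⟨0, 1, (koopman q T hT ^ (N - 1)) ((f : Lp ℝ q μ) -
      (koopmanInv q T hT ^ N) ((P 1 ^ N) f : H)), ?_, ?_, ?_⟩
    · rw [sub_pow_mul_pow_eq_sum, map_sum]
      refine Submodule.sum_mem _ fun l hl => ?_
      have hl' := Finset.mem_range.1 hl
      rw [← Module.End.mul_apply, show N - 1 = N - 1 - l + l by omega,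
        koopman_pow_mul_koopmanInv_pow]
      exact koopman_pow_mem_innovationSubmodule hT hG hGT (hmem _) (by omega)
    · rw [norm_koopman_pow]
      refine (norm_sub_le _ _).trans_eq ?_
      rw [norm_koopmanInv_pow]
    · rw [← Module.End.mul_apply, ← pow_add, show 1 + (N - 1) = N by omega, map_sub,
        ← Module.End.mul_apply (koopman q T hT ^ N)]
      have := koopman_pow_mul_koopmanInv_pow (q := q) hT 0 N
      rw [zero_add, pow_zero] at this
      rw [this, pow_zero, Module.End.one_apply, Module.End.one_apply, Submodule.coe_add]
      abel
  · have hmem : ∀ g : H, (g : Lp ℝ q μ) - koopman q T hT (P 1 g : H) ∈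
        innovationSubmodule q G (G.comap T) μ := by
      intro g
      have := hker (g - ⟨koopman q T hT (P 1 g : H), hH _ (P 1 g).2⟩)
        (by rw [map_sub, hinv, sub_self])
      simpa using this
    -- Here f + U^N f = U^N (f + P^N f) + (f - U^N P^N f), and the last bracket telescopes without a
    -- further shift.
    refine ⟨N, 0, (f : Lp ℝ q μ) - (koopman q T hT ^ N) ((P 1 ^ N) f : H), ?_, ?_, ?_⟩
    · rw [sub_pow_mul_pow_eq_sum]
      exact Submodule.sum_mem _ fun l hl => koopman_pow_mem_innovationSubmodule hT hG hGT
        (hmem _) (Finset.mem_range.1 hl)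
    · refine (norm_sub_le _ _).trans_eq ?_
      rw [norm_koopman_pow]
    · rw [Submodule.coe_add, map_add, pow_zero, Module.End.one_apply]
      abel

end ConditionC

/-! ### Construction of the cascade -/

section Cascade

variable {Ω : Type*} {𝓜 : MeasurableSpace Ω} {mΩ : MeasurableSpace Ω} {μ : Measure Ω}
  [IsProbabilityMeasure μ] {p : ℝ} {T : Ω ≃ᵐ Ω}
  {hT : MeasurePreserving T μ μ} {h𝓜 : 𝓜 ≤ mΩ}
  {hT𝓜 : ∀ A, MeasurableSet[𝓜] A → MeasurableSet[𝓜] (T '' A)}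
  {H : Submodule ℝ (Lp ℝ (ENNReal.ofReal p) μ)} {P : ℕ → Module.End ℝ H}

/-- The transformations are T^{2^r} and the functions are the sums of P_T^i h over i < 2^r. Applying
P_T^{2^r} to such a sum and adding the sum itself gives the next one, so the decomposition with N =
2^r links consecutive levels. -/
theorem ConditionC.exists_isCascade (hC : ConditionC 𝓜 T hT h𝓜 hT𝓜 H P) (hp : 1 ≤ p) (h : H)
    (hh : mwNorm (P 1) h < ∞) :
    ∃ (τ : ℕ → Ω ≃ᵐ Ω) (g D : ℕ → Ω → ℝ) (K : ℝ≥0) (G : MeasurableSpace Ω),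
      IsCascade G μ p K τ g D ∧ τ 0 = T ∧
      g 0 = (h : Lp ℝ (ENNReal.ofReal p) μ) ∧ IsCascade.tailSum μ p g 0 ≠ ∞ := by
  have : Fact (1 ≤ ENNReal.ofReal p) := ⟨by simpa using hp⟩
  have hcoe := coe_dyadicIterate T
  have hit : ∀ n, MeasurePreserving T^[n] μ μ := hT.iterate
  have hmeas : ∀ f : Lp ℝ (ENNReal.ofReal p) μ, Measurable f := fun f =>
    (Lp.stronglyMeasurable f).measurable
  obtain ⟨G, hG, hGT, hker⟩ := hC.exists_innovation
  obtain ⟨K, hK⟩ := hC.powerBounded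
  have hdec := fun r : ℕ => hC.exists_decomposition hG hGT hker (N := 2 ^ r)
    Nat.one_le_two_pow (dyadicSum (P 1) h r)
  choose a b D hD hDn hDe using hdec
  refine ⟨dyadicIterate T, fun r => (dyadicSum (P 1) h r : Lp ℝ (ENNReal.ofReal p) μ),
    fun r => D r, 1 + K.toNNReal, G, ?_, rfl, ?_, ?_⟩
  · refine
    { preserving := fun r => by rw [hcoe]; exact hit _
      doubling := fun r => rfl
      le := hG
      le_comap := fun r => by
        rw [hcoe]; exact le_comap_iterate hGT _
      measurable := fun r => hmeas _
      memLp := fun r => Lp.memLp _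
      measurable_diff := fun r => hmeas _
      memLp_diff := fun r => Lp.memLp _
      innovation := fun r => ?_
      eLpNorm_diff_le := fun r => ?_
      decomposition := fun r => ?_ }
    -- `D r` is already measurable for T^{-2^r} G, which is contained in the required T^{-2^{r+1}}
    -- G.
    · rw [hcoe]
      refine (mem_innovationSubmodule.1 (hD r)).mono le_rfl
        (comap_iterate_mono hGT (Nat.pow_le_pow_right two_pos (Nat.le_succ r))) hG
    · rw [eLpNorm_coe_eq_ofReal_norm, eLpNorm_coe_eq_ofReal_norm, ← ENNReal.ofReal_coe_nnreal,
        ← ENNReal.ofReal_mul (by positivity)]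
      refine ENNReal.ofReal_le_ofReal ((hDn r).trans ?_)
      have h1 := hK (2 ^ r) Nat.one_le_two_pow (dyadicSum (P 1) h r)
      have h2 : K * ‖(dyadicSum (P 1) h r : Lp ℝ (ENNReal.ofReal p) μ)‖
          ≤ K.toNNReal * ‖(dyadicSum (P 1) h r : Lp ℝ (ENNReal.ofReal p) μ)‖ := by
        gcongr
        exact Real.le_coe_toNNReal K
      push_cast
      linarith
    · refine ⟨T^[a r], T^[b r], hit _, hit _, ?_, ?_, ?_⟩
      · rw [hcoe]; exact (Function.Commute.refl T).iterate_iterate _ _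
      · rw [hcoe]; exact (Function.Commute.refl T).iterate_iterate _ _
      · have e := hDe r
        rw [← dyadicSum_succ] at e
        have e1 := Lp.coeFn_add (dyadicSum (P 1) h r : Lp ℝ (ENNReal.ofReal p) μ)
          ((koopman _ T hT ^ 2 ^ r) (dyadicSum (P 1) h r : Lp ℝ (ENNReal.ofReal p) μ))
        have e2 := Lp.coeFn_add ((koopman _ T hT ^ a r)
          (dyadicSum (P 1) h (r + 1) : Lp ℝ (ENNReal.ofReal p) μ)) ((koopman _ T hT ^ b r) (D r))
        have e3 := coeFn_koopman_pow hT (dyadicSum (P 1) h r : Lp ℝ (ENNReal.ofReal p) μ) (2 ^ r)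
        have e4 := coeFn_koopman_pow hT
          (dyadicSum (P 1) h (r + 1) : Lp ℝ (ENNReal.ofReal p) μ) (a r)
        have e5 := coeFn_koopman_pow hT (D r) (b r)
        rw [e] at e1
        rw [hcoe]
        filter_upwards [e1, e2, e3, e4, e5] with ω e1 e2 e3 e4 e5
        rw [e1] at e2
        simp only [Pi.add_apply] at e2 ⊢
        rw [← e3, ← e4, ← e5, e2]
  · simp [dyadicSum]
  · refine ne_of_lt (lt_of_eq_of_lt ?_ hh)
    unfold IsCascade.tailSum mwNorm
    congr 1
    funext j
    rw [zero_add, eLpNorm_coe_eq_ofReal_norm, IsCascade.weight, ← ENNReal.ofReal_pow (by positivity),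
      ← ENNReal.ofReal_mul (by positivity), ← Real.rpow_natCast, ← Real.rpow_mul zero_le_two]
    congr 3
    ring

end Cascade

/-! ### Compactness and tightness in Hölder spaces -/

theorem holderWith_of_abs_sub_le {α A : ℝ≥0} {x : I → ℝ}
    (h : ∀ s t : I, |x t - x s| ≤ A * |(t : ℝ) - s| ^ (α : ℝ)) : HolderWith A α x := by
  intro s t
  rw [edist_dist, edist_dist, ENNReal.ofReal_rpow_of_nonneg dist_nonneg α.coe_nonneg,
    ← ENNReal.ofReal_coe_nnreal, ← ENNReal.ofReal_mul A.coe_nonneg]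
  exact ENNReal.ofReal_le_ofReal (h t s)

namespace HolderSpace

variable {α : ℝ≥0}

/-- The element of the Hölder space given by a Hölder continuous function. -/
def mk (x : I → ℝ) (hx : MemHolder α x) : HolderSpace α := (⟨x, hx⟩ : holderSubmodule α)

@[simp]
theorem coe_mk (x : I → ℝ) (hx : MemHolder α x) : ⇑(mk x hx) = x := rfl

theorem coe_sub (x y : HolderSpace α) : ((x - y : HolderSpace α) : I → ℝ) = x - y := rfl

theorem norm_le {x : HolderSpace α} (h0 : x 0 = 0) {c : ℝ} (hc : 0 ≤ c)
    (h : ∀ s t : I, |x t - x s| ≤ c * |(t : ℝ) - s| ^ (α : ℝ)) : ‖x‖ ≤ c := by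
  rw [norm_def, h0, abs_zero, add_zero]
  have := (holderWith_of_abs_sub_le (A := ⟨c, hc⟩) h).nnholderNorm_le
  exact_mod_cast this

/-- The set of functions with a prescribed bound on their modulus of Hölder continuity. -/
def modulusSet (α A : ℝ≥0) (δ : ℕ → ℝ) : Set (I → ℝ) :=
  {x | x 0 = 0 ∧ (∀ s t : I, |x t - x s| ≤ A * |(t : ℝ) - s| ^ (α : ℝ)) ∧
    ∀ m : ℕ, ∀ s t : I, |(t : ℝ) - s| ≤ δ m →
      |x t - x s| ≤ (1 / 2) ^ m * |(t : ℝ) - s| ^ (α : ℝ)}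

/-- In the product topology this is a closed subset of a cube, and Tychonoff's theorem applies. -/
theorem isCompact_modulusSet (A : ℝ≥0) (δ : ℕ → ℝ) : IsCompact (modulusSet α A δ) := by
  have hc : IsCompact (Set.univ.pi fun _ : I => Set.Icc (-(A : ℝ)) A) :=
    isCompact_univ_pi fun _ => isCompact_Icc
  refine hc.of_isClosed_subset ?_ ?_
  · have e : modulusSet α A δ = {x | x 0 = 0} ∩ ((⋂ s : I, ⋂ t : I,
        {x | |x t - x s| ≤ A * |(t : ℝ) - s| ^ (α : ℝ)}) ∩
        ⋂ m : ℕ, ⋂ s : I, ⋂ t : I, ⋂ _ : |(t : ℝ) - s| ≤ δ m,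
          {x | |x t - x s| ≤ (1 / 2) ^ m * |(t : ℝ) - s| ^ (α : ℝ)}) := by
      ext x
      simp only [modulusSet, Set.mem_ofPred_eq, Set.mem_inter_iff, Set.mem_iInter]
    rw [e]
    refine (isClosed_eq (continuous_apply _) continuous_const).inter (IsClosed.inter ?_ ?_)
    · exact isClosed_iInter fun s => isClosed_iInter fun t =>
        isClosed_le ((continuous_apply t).sub (continuous_apply s)).abs continuous_const
    · exact isClosed_iInter fun m => isClosed_iInter fun s => isClosed_iInter fun t =>
        isClosed_iInter fun _ =>
        isClosed_le ((continuous_apply t).sub (continuous_apply s)).abs continuous_const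
  · rintro x ⟨h0, hA, -⟩ t -
    have h1 := hA 0 t
    rw [h0, sub_zero] at h1
    have h2 : |(t : ℝ) - (0 : I)| ^ (α : ℝ) ≤ 1 := by
      refine Real.rpow_le_one (abs_nonneg _) ?_ α.coe_nonneg
      rw [Set.Icc.coe_zero, sub_zero, abs_of_nonneg t.2.1]
      exact t.2.2
    have h3 : |x t| ≤ A := h1.trans (mul_le_of_le_one_right A.coe_nonneg h2)
    exact abs_le.1 h3

/-- The inclusion of `modulusSet` into the Hölder space. -/
def ofModulusSet (α A : ℝ≥0) (δ : ℕ → ℝ) (x : modulusSet α A δ) : HolderSpace α :=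
  mk x.1 (holderWith_of_abs_sub_le x.2.2.1).memHolder

/-- On `modulusSet`, pointwise convergence implies convergence in Hölder norm. -/
theorem continuous_ofModulusSet (hα : 0 < α) (A : ℝ≥0) {δ : ℕ → ℝ} (hδ : ∀ m, 0 < δ m) :
    Continuous (ofModulusSet α A δ) := by
  have hα' : (0 : ℝ) < α := hα
  rw [continuous_iff_continuousAt]
  intro x₀
  rw [ContinuousAt, Metric.tendsto_nhds]
  intro ε hε
  obtain ⟨m, hm⟩ := exists_pow_lt_of_lt_one (show 0 < ε / 4 by positivity)
    (show (1 / 2 : ℝ) < 1 by norm_num)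
  set ρ := ε / 4 * δ m ^ (α : ℝ) with hρdef
  have hδα : 0 < δ m ^ (α : ℝ) := Real.rpow_pos_of_pos (hδ m) _
  have hρ : 0 < ρ := by positivity
  -- Points at distance less than r have values within ρ / 4 of each other, so closeness to `x₀` on
  -- a finite r-net gives uniform closeness up to ρ.
  set r := (ρ / (4 * A + 4)) ^ (1 / (α : ℝ)) with hrdef
  have hr : 0 < r := by positivity
  have hrα : r ^ (α : ℝ) = ρ / (4 * A + 4) := by
    rw [hrdef, ← Real.rpow_mul (by positivity), one_div_mul_cancel hα'.ne', Real.rpow_one]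
  obtain ⟨F, -, hF, hcov⟩ := (isCompact_univ (X := I)).finite_cover_balls hr
  have hev : ∀ᶠ x in 𝓝 x₀, ∀ s ∈ F, |x.1 s - x₀.1 s| < ρ / 2 := by
    rw [hF.eventually_all]
    intro s _
    have hcont : Continuous fun x : modulusSet α A δ => |x.1 s - x₀.1 s| :=
      (((continuous_apply s).comp continuous_subtype_val).sub continuous_const).abs
    refine hcont.tendsto x₀ (gt_mem_nhds ?_)
    simpa using hρ
  filter_upwards [hev] with x hx
  have hsup : ∀ t : I, |x.1 t - x₀.1 t| ≤ ρ := by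
    intro t
    obtain ⟨s, hs, hst⟩ : ∃ s ∈ F, t ∈ Metric.ball s r := by
      simpa using hcov (Set.mem_univ t)
    have hd : |(t : ℝ) - s| ^ (α : ℝ) ≤ ρ / (4 * A + 4) := by
      rw [← hrα]
      refine Real.rpow_le_rpow (abs_nonneg _) ?_ hα'.le
      exact (Metric.mem_ball.1 hst).le
    have h1 := x.2.2.1 s t
    have h2 := x₀.2.2.1 s t
    have h3 : (A : ℝ) * |(t : ℝ) - s| ^ (α : ℝ) ≤ ρ / 4 := by
      calc (A : ℝ) * |(t : ℝ) - s| ^ (α : ℝ) ≤ A * (ρ / (4 * A + 4)) := by gcongr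
        _ ≤ (A + 1) * (ρ / (4 * A + 4)) := by gcongr; linarith
        _ = ρ / 4 := by field_simp
    have e : x.1 t - x₀.1 t = (x.1 t - x.1 s) - (x₀.1 t - x₀.1 s) + (x.1 s - x₀.1 s) := by ring
    rw [e]
    refine (abs_add_le _ _).trans ?_
    have h4 := abs_sub (x.1 t - x.1 s) (x₀.1 t - x₀.1 s)
    have h5 := hx s hs
    linarith
  rw [dist_eq_norm]
  refine lt_of_le_of_lt (norm_le (c := ε / 2) ?_ (by positivity) ?_) (by linarith)
  · rw [coe_sub, Pi.sub_apply, ofModulusSet, ofModulusSet, coe_mk, coe_mk, x.2.1, x₀.2.1, sub_zero]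
  · intro s t
    rw [coe_sub, Pi.sub_apply, Pi.sub_apply, ofModulusSet, ofModulusSet, coe_mk, coe_mk]
    -- Short increments of both functions are small by the common modulus. For long ones uniform
    -- closeness suffices, since the denominator is at least (δ m)^α.
    rcases le_or_gt |(t : ℝ) - s| (δ m) with h | h
    · have h1 := x.2.2.2 m s t h
      have h2 := x₀.2.2.2 m s t h
      have e : x.1 t - x₀.1 t - (x.1 s - x₀.1 s) = (x.1 t - x.1 s) - (x₀.1 t - x₀.1 s) := by ring
      rw [e]
      refine (abs_sub _ _).trans ?_
      have h3 : (1 / 2 : ℝ) ^ m * |(t : ℝ) - s| ^ (α : ℝ) ≤ ε / 4 * |(t : ℝ) - s| ^ (α : ℝ) := by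
        gcongr
      linarith
    · refine (abs_sub _ _).trans ?_
      have h1 := hsup t
      have h2 := hsup s
      have h3 : ε / 4 * δ m ^ (α : ℝ) ≤ ε / 4 * |(t : ℝ) - s| ^ (α : ℝ) := by
        gcongr
        exact (hδ m).le
      linarith

theorem isCompact_setOf_mem_modulusSet (hα : 0 < α) (A : ℝ≥0) {δ : ℕ → ℝ} (hδ : ∀ m, 0 < δ m) :
    IsCompact {x : HolderSpace α | ⇑x ∈ modulusSet α A δ} := by
  have : CompactSpace (modulusSet α A δ) :=
    isCompact_iff_compactSpace.1 (isCompact_modulusSet A δ)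
  have e : {x : HolderSpace α | ⇑x ∈ modulusSet α A δ} = Set.range (ofModulusSet α A δ) := by
    ext x
    constructor
    · intro hx
      exact ⟨⟨x, hx⟩, rfl⟩
    · rintro ⟨y, rfl⟩
      exact y.2
  rw [e]
  exact isCompact_range (continuous_ofModulusSet hα A hδ)

/-- A tightness criterion: the Hölder constants are bounded in probability and the moduli of Hölder
continuity tend to zero in probability, both uniformly in the family. -/
theorem isTightMeasureSet_of_modulus (hα : 0 < α) {Ω : Type*} [MeasurableSpace Ω] {μ : Measure Ω}
    {ξ : ℕ → Ω → HolderSpace α} (hξ : ∀ n, Measurable (ξ n)) (h0 : ∀ n ω, ξ n ω 0 = 0)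
    (hA : ∀ ε : ℝ≥0, 0 < ε → ∃ A : ℝ≥0, ∀ n, 1 ≤ n →
      μ {ω | ¬ ∀ s t : I, |ξ n ω t - ξ n ω s| ≤ A * |(t : ℝ) - s| ^ (α : ℝ)} ≤ ε)
    (hδ : ∀ η : ℝ, 0 < η → ∀ ε : ℝ≥0, 0 < ε → ∃ δ : ℝ, 0 < δ ∧ ∀ n, 1 ≤ n →
      μ {ω | ¬ ∀ s t : I, |(t : ℝ) - s| ≤ δ →
        |ξ n ω t - ξ n ω s| ≤ η * |(t : ℝ) - s| ^ (α : ℝ)} ≤ ε) :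
    IsTightMeasureSet {ν | ∃ n : ℕ, 1 ≤ n ∧ ν = μ.map (ξ n)} := by
  rw [isTightMeasureSet_iff_exists_isCompact_measure_compl_le]
  intro ε hε
  have hε2 : ε / 2 ≠ 0 := (ENNReal.half_pos hε.ne').ne'
  obtain ⟨e₀, he₀, he₀ε⟩ := ENNReal.lt_iff_exists_nnreal_btwn.1 (pos_iff_ne_zero.2 hε2)
  obtain ⟨e, he, heε⟩ := ENNReal.exists_pos_sum_of_countable hε2 ℕ
  obtain ⟨A, hA⟩ := hA e₀ (by exact_mod_cast he₀)
  choose δ hδ0 hδ using fun m : ℕ => hδ ((1 / 2) ^ m) (by positivity) (e m) (he m)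
  have hK := isCompact_setOf_mem_modulusSet hα A hδ0
  refine ⟨_, hK, ?_⟩
  rintro _ ⟨n, hn, rfl⟩
  rw [Measure.map_apply (hξ n) hK.isClosed.measurableSet.compl]
  calc μ (ξ n ⁻¹' {x : HolderSpace α | ⇑x ∈ modulusSet α A δ}ᶜ)
      ≤ μ ({ω | ¬ ∀ s t : I, |ξ n ω t - ξ n ω s| ≤ A * |(t : ℝ) - s| ^ (α : ℝ)} ∪
          ⋃ m, {ω | ¬ ∀ s t : I, |(t : ℝ) - s| ≤ δ m →
            |ξ n ω t - ξ n ω s| ≤ (1 / 2) ^ m * |(t : ℝ) - s| ^ (α : ℝ)}) := by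
        refine measure_mono fun ω hω => ?_
        by_contra hcon
        simp only [Set.mem_union, Set.mem_ofPred_eq, Set.mem_iUnion, not_or, not_not,
          not_exists] at hcon
        exact hω ⟨h0 n ω, hcon.1, hcon.2⟩
    _ ≤ e₀ + ∑' m, (e m : ℝ≥0∞) := by
        refine (measure_union_le _ _).trans (add_le_add (hA n hn) ?_)
        exact (measure_iUnion_le _).trans (ENNReal.tsum_le_tsum fun m => hδ m n hn)
    _ ≤ ε / 2 + ε / 2 := add_le_add he₀ε.le heε.le
    _ = ε := ENNReal.add_halves ε

end HolderSpace

/-! ### Polygonal interpolation of partial sums -/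

/-- The piecewise linear function with value `∑_{j < k} X_j` at each natural number `k`. -/
noncomputable def polygon (X : ℕ → ℝ) (u : ℝ) : ℝ :=
  ∑ j ∈ Finset.range ⌊u⌋₊, X j + (u - (⌊u⌋₊ : ℝ)) * X ⌊u⌋₊

theorem polygon_natCast (X : ℕ → ℝ) (i : ℕ) : polygon X i = ∑ j ∈ Finset.range i, X j := by
  simp [polygon]

theorem polygon_of_mem_Icc (X : ℕ → ℝ) {u : ℝ} {i : ℕ} (h : u ∈ Set.Icc (i : ℝ) (i + 1)) :
    polygon X u = ∑ j ∈ Finset.range i, X j + (u - i) * X i := by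
  rcases h.2.lt_or_eq with h1 | h1
  · have : ⌊u⌋₊ = i := (Nat.floor_eq_iff ((Nat.cast_nonneg i).trans h.1)).2 ⟨h.1, h1⟩
    rw [polygon, this]
  · have : u = ((i + 1 : ℕ) : ℝ) := by rw [h1]; push_cast; rfl
    rw [this, polygon_natCast, Finset.sum_range_succ]
    push_cast
    ring

/-- The projection of the real line to `[0,1]`. -/
def ramp (v : ℝ) : ℝ := max 0 (min 1 v)

theorem abs_ramp_sub_ramp_le (a b : ℝ) : |ramp a - ramp b| ≤ |a - b| := by
  unfold ramp
  refine (abs_max_sub_max_le_max 0 _ 0 _).trans ?_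
  rw [sub_self, abs_zero, max_eq_right (abs_nonneg _)]
  refine (abs_min_sub_min_le_max 1 _ 1 _).trans ?_
  rw [sub_self, abs_zero, max_eq_right (abs_nonneg _)]

/-- Writing the polygon as a linear combination of fixed ramps yields both its Lipschitz bound and
the measurability of the path. -/
theorem sum_mul_ramp (X : ℕ → ℝ) {u : ℝ} (hu : 0 ≤ u) (n : ℕ) :
    ∑ j ∈ Finset.range n, X j * ramp (u - j) = polygon X (min u n) := by
  induction n with
  | zero => simp [hu, polygon]
  | succ n ih =>
    rw [Finset.sum_range_succ, ih]
    rcases le_total u n with h | h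
    · have h' : u ≤ ((n + 1 : ℕ) : ℝ) := by push_cast; linarith
      have hr : ramp (u - n) = 0 := by
        rw [ramp, max_eq_left ((min_le_right _ _).trans (by linarith))]
      rw [min_eq_left h, min_eq_left h', hr, mul_zero, add_zero]
    · have hr : ramp (u - n) = min u ((n + 1 : ℕ) : ℝ) - n := by
        rw [ramp, max_eq_right (le_min zero_le_one (by linarith)), min_comm, Nat.cast_succ,
          ← min_sub_sub_right, add_sub_cancel_left]
      have hmem : min u ((n + 1 : ℕ) : ℝ) ∈ Set.Icc (n : ℝ) (n + 1) := by
        rw [Nat.cast_succ]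
        exact ⟨le_min h (by linarith), min_le_right _ _⟩
      rw [min_eq_right h, polygon_natCast, polygon_of_mem_Icc X hmem, hr, mul_comm]

theorem polygon_eq_sum (X : ℕ → ℝ) {u : ℝ} {n : ℕ} (hu : 0 ≤ u) (hun : u ≤ n) :
    polygon X u = ∑ j ∈ Finset.range n, X j * ramp (u - j) := by
  rw [sum_mul_ramp X hu, min_eq_left hun]

theorem abs_polygon_sub_le_mul (X : ℕ → ℝ) {u v : ℝ} {n : ℕ} (hu : u ∈ Set.Icc 0 (n : ℝ))
    (hv : v ∈ Set.Icc 0 (n : ℝ)) :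
    |polygon X v - polygon X u| ≤ (∑ j ∈ Finset.range n, |X j|) * |v - u| := by
  rw [polygon_eq_sum X hu.1 hu.2, polygon_eq_sum X hv.1 hv.2, ← Finset.sum_sub_distrib,
    Finset.sum_mul]
  refine (Finset.abs_sum_le_sum_abs _ _).trans (Finset.sum_le_sum fun j _ => ?_)
  rw [← mul_sub, abs_mul]
  have := abs_ramp_sub_ramp_le (v - j) (u - j)
  rw [sub_sub_sub_cancel_right] at this
  gcongr

/-- Hölder bounds for increments between integers extend to the polygonal interpolation. -/
theorem abs_polygon_sub_le_rpow (X : ℕ → ℝ) {α Q : ℝ} (hα : 0 < α) (hα1 : α ≤ 1) (hQ0 : 0 ≤ Q)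
    {n l : ℕ} (hl : 1 ≤ l)
    (hQ : ∀ i j : ℕ, i < j → j ≤ n → j ≤ i + l →
      |∑ k ∈ Finset.range j, X k - ∑ k ∈ Finset.range i, X k| ≤ Q * ((j : ℝ) - i) ^ α)
    {u v : ℝ} (hu : 0 ≤ u) (huv : u ≤ v) (hv : v ≤ n) (hd : v - u ≤ l) :
    |polygon X v - polygon X u| ≤ 3 * Q * (v - u) ^ α := by
  -- Within one cell the polygon is affine, and a distance at most 1 is dominated by its power α ≤
  -- 1. A general increment consists of two partial cells and one integer increment, hence the
  -- factor 3.
  have cell : ∀ (i : ℕ) (a b : ℝ), i + 1 ≤ n → (i : ℝ) ≤ a → a ≤ b → b ≤ i + 1 →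
      |polygon X b - polygon X a| ≤ Q * (b - a) ^ α := by
    intro i a b hi ha hab hb
    rw [polygon_of_mem_Icc X ⟨ha, hab.trans hb⟩, polygon_of_mem_Icc X ⟨ha.trans hab, hb⟩]
    have e : ∑ j ∈ Finset.range i, X j + (b - i) * X i -
        (∑ j ∈ Finset.range i, X j + (a - i) * X i) = (b - a) * X i := by ring
    have hX : |X i| ≤ Q := by
      have := hQ i (i + 1) (Nat.lt_succ_self i) hi (by omega)
      rw [Finset.sum_range_succ, add_sub_cancel_left] at this
      simpa using this
    have h0 : 0 ≤ b - a := by linarith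
    have h1 : b - a ≤ (b - a) ^ α := Real.self_le_rpow_of_le_one h0 (by linarith) hα1
    rw [e, abs_mul, abs_of_nonneg h0, mul_comm]
    gcongr
  have hnn : 0 ≤ (v - u) ^ α := Real.rpow_nonneg (by linarith) _
  rcases huv.eq_or_lt with rfl | hlt
  · rw [sub_self, abs_zero]
    positivity
  set i := ⌊u⌋₊
  have hi : (i : ℝ) ≤ u := Nat.floor_le hu
  have hi' : u < i + 1 := Nat.lt_floor_add_one u
  have hin : i + 1 ≤ n := by
    have : (i : ℝ) < n := by linarith
    exact_mod_cast this
  rcases le_or_gt v (i + 1) with h1 | h1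
  · refine (cell i u v hin hi huv h1).trans ?_
    nlinarith [mul_nonneg hQ0 hnn]
  set j := ⌊v⌋₊
  have hv0 : 0 ≤ v := hu.trans huv
  have hj : (j : ℝ) ≤ v := Nat.floor_le hv0
  have hj' : v < j + 1 := Nat.lt_floor_add_one v
  have hij : i + 1 ≤ j := Nat.le_floor (by push_cast; exact h1.le)
  have p1 : |polygon X ((i + 1 : ℕ) : ℝ) - polygon X u| ≤ Q * (v - u) ^ α := by
    refine (cell i u _ hin hi (by push_cast; linarith) (by push_cast; rfl)).trans ?_
    gcongr
    · push_cast; linarith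
    · push_cast; exact h1.le
  have p2 : |polygon X (j : ℝ) - polygon X ((i + 1 : ℕ) : ℝ)| ≤ Q * (v - u) ^ α := by
    rcases hij.eq_or_lt with h2 | h2
    · rw [h2, sub_self, abs_zero]
      positivity
    · have hjn : j ≤ n := by exact_mod_cast hj.trans hv
      have hc : ((i + 1 : ℕ) : ℝ) = i + 1 := by push_cast; rfl
      have hjl : j ≤ i + 1 + l := by
        have : (j : ℝ) ≤ i + 1 + l := by linarith
        exact_mod_cast this
      have h3 : ((i + 1 : ℕ) : ℝ) ≤ j := by exact_mod_cast hij
      rw [polygon_natCast, polygon_natCast]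
      refine (hQ _ _ h2 hjn hjl).trans ?_
      gcongr
      linarith
  have p3 : |polygon X v - polygon X (j : ℝ)| ≤ Q * (v - u) ^ α := by
    rcases hj.eq_or_lt with h2 | h2
    · rw [h2, sub_self, abs_zero]
      positivity
    · have hjn : j + 1 ≤ n := by
        have : (j : ℝ) < n := by linarith
        exact_mod_cast this
      refine (cell j _ v hjn le_rfl hj hj'.le).trans ?_
      have h3 : (i : ℝ) + 1 ≤ j := by exact_mod_cast hij
      gcongr
      linarith
  have e : polygon X v - polygon X u = (polygon X ((i + 1 : ℕ) : ℝ) - polygon X u) +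
      (polygon X (j : ℝ) - polygon X ((i + 1 : ℕ) : ℝ)) + (polygon X v - polygon X (j : ℝ)) := by
    ring
  rw [e]
  refine (abs_add_three _ _ _).trans ?_
  linarith

theorem partialSumProcess_eq_polygon {Ω : Type*} (T : Ω → Ω) (f : Ω → ℝ) (n : ℕ) (ω : Ω) (t : I) :
    partialSumProcess T f n ω t = polygon (fun j => f (T^[j] ω)) (n * t) := rfl

namespace HolderSpace

variable {α : ℝ≥0}

theorem coe_sum {ι : Type*} (s : Finset ι) (g : ι → HolderSpace α) :
    ⇑(∑ j ∈ s, g j) = ∑ j ∈ s, ⇑(g j) := by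
  induction s using Finset.cons_induction with
  | empty => rfl
  | cons a s ha ih => rw [Finset.sum_cons, Finset.sum_cons, coe_add, ih]

theorem abs_sub_le_one (s t : I) : |(t : ℝ) - s| ≤ 1 :=
  abs_le.2 ⟨by linarith [s.2.2, t.2.1], by linarith [s.2.1, t.2.2]⟩

theorem memHolder_of_lipschitz (hα : α ≤ 1) {x : I → ℝ} {L : ℝ≥0}
    (h : ∀ s t : I, |x t - x s| ≤ L * |(t : ℝ) - s|) : MemHolder α x := by
  refine (holderWith_of_abs_sub_le (A := L) fun s t => (h s t).trans ?_).memHolder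
  gcongr
  exact Real.self_le_rpow_of_le_one (abs_nonneg _) (abs_sub_le_one s t) hα

/-- The functions `t ↦ n^{-1/2} (0 ∨ (nt - j) ∧ 1)`. -/
noncomputable def rampPath (hα : α ≤ 1) (n j : ℕ) : HolderSpace α :=
  mk (fun t => (n : ℝ) ^ (-(1 / 2) : ℝ) * ramp (n * t - j)) <| by
    refine memHolder_of_lipschitz (L := (n : ℝ≥0) ^ (-(1 / 2) : ℝ) * n) hα fun s t => ?_
    have := abs_ramp_sub_ramp_le (n * t - j) (n * s - j)
    rw [sub_sub_sub_cancel_right, ← mul_sub, abs_mul, Nat.abs_cast] at this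
    push_cast
    rw [← mul_sub, abs_mul, abs_of_nonneg (by positivity), mul_assoc]
    gcongr

/-- The normalized partial sum process as an element of the Hölder space. -/
noncomputable def partialSumPath {Ω : Type*} (hα : α ≤ 1) (T : Ω → Ω) (f : Ω → ℝ) (n : ℕ) (ω : Ω) :
    HolderSpace α :=
  ∑ j : Fin n, f (T^[j] ω) • rampPath hα n j

/-- The Hölder space is not separable, so Borel measurability does not reduce to that of
coordinates. Here the path is a continuous function of the finite vector of values f∘T^j. -/
theorem measurable_partialSumPath {Ω : Type*} [MeasurableSpace Ω] (hα : α ≤ 1) {T : Ω → Ω}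
    {f : Ω → ℝ} (hT : Measurable T) (hf : Measurable f) (n : ℕ) :
    Measurable (partialSumPath hα T f n) := by
  have h1 : Continuous fun x : Fin n → ℝ => ∑ j : Fin n, x j • rampPath hα n j := by fun_prop
  exact h1.measurable.comp (measurable_pi_lambda _ fun j => hf.comp (hT.iterate j))

theorem partialSumPath_apply {Ω : Type*} (hα : α ≤ 1) (T : Ω → Ω) (f : Ω → ℝ) (n : ℕ) (ω : Ω)
    (t : I) : partialSumPath hα T f n ω t =
      (n : ℝ) ^ (-(1 / 2) : ℝ) * partialSumProcess T f n ω t := by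
  have h1 : (n : ℝ) * t ≤ n := mul_le_of_le_one_right (Nat.cast_nonneg n) t.2.2
  have h0 : 0 ≤ (n : ℝ) * t := mul_nonneg (Nat.cast_nonneg n) t.2.1
  rw [partialSumProcess_eq_polygon, polygon_eq_sum _ h0 h1, partialSumPath, coe_sum,
    Finset.sum_apply, Finset.sum_range, Finset.mul_sum]
  refine Finset.sum_congr rfl fun j _ => ?_
  rw [coe_smul, Pi.smul_apply, smul_eq_mul, rampPath, coe_mk]
  ring

theorem partialSumPath_zero {Ω : Type*} (hα : α ≤ 1) (T : Ω → Ω) (f : Ω → ℝ) (n : ℕ) (ω : Ω) :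
    partialSumPath hα T f n ω 0 = 0 := by
  rw [partialSumPath_apply]
  simp [partialSumProcess]

theorem abs_partialSumPath_sub_le_mul {Ω : Type*} (hα : α ≤ 1) (T : Ω → Ω) (f : Ω → ℝ) (n : ℕ)
    (ω : Ω) (s t : I) : |partialSumPath hα T f n ω t - partialSumPath hα T f n ω s| ≤
      (n : ℝ) ^ (-(1 / 2) : ℝ) * n * (∑ j ∈ Finset.range n, |f (T^[j] ω)|) * |(t : ℝ) - s| := by
  have hmem : ∀ r : I, (n : ℝ) * r ∈ Set.Icc 0 (n : ℝ) := fun r =>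
    ⟨mul_nonneg (Nat.cast_nonneg n) r.2.1, mul_le_of_le_one_right (Nat.cast_nonneg n) r.2.2⟩
  have := abs_polygon_sub_le_mul (fun j => f (T^[j] ω)) (hmem s) (hmem t)
  rw [← mul_sub, abs_mul, Nat.abs_cast] at this
  rw [partialSumPath_apply, partialSumPath_apply, ← mul_sub, abs_mul,
    abs_of_nonneg (by positivity), partialSumProcess_eq_polygon, partialSumProcess_eq_polygon]
  calc _ ≤ (n : ℝ) ^ (-(1 / 2) : ℝ) * ((∑ j ∈ Finset.range n, |f (T^[j] ω)|) *
        (n * |(t : ℝ) - s|)) := by gcongr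
    _ = _ := by ring

theorem mul_le_mul_rpow_of_le {L η δ d a : ℝ} (ha : a < 1) (hd0 : 0 ≤ d) (hd : d ≤ δ)
    (hL : 0 ≤ L) (h : L * δ ^ (1 - a) ≤ η) (hη : 0 ≤ η) : L * d ≤ η * d ^ a := by
  rcases hd0.eq_or_lt with rfl | hpos
  · rw [mul_zero]
    exact mul_nonneg hη (Real.rpow_nonneg le_rfl _)
  · have e : d = d ^ (1 - a) * d ^ a := by
      rw [← Real.rpow_add hpos, sub_add_cancel, Real.rpow_one]
    have h1 : d ^ (1 - a) ≤ δ ^ (1 - a) := Real.rpow_le_rpow hd0 hd (by linarith)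
    calc L * d = L * d ^ (1 - a) * d ^ a := by rw [mul_assoc, ← e]
      _ ≤ L * δ ^ (1 - a) * d ^ a := by gcongr
      _ ≤ η * d ^ a := by gcongr

theorem exists_pos_mul_rpow_le {L η a : ℝ} (ha : a < 1) (hL : 0 ≤ L) (hη : 0 < η) :
    ∃ δ : ℝ, 0 < δ ∧ L * δ ^ (1 - a) ≤ η := by
  have h1 : 0 < 1 - a := by linarith
  refine ⟨(η / (L + 1)) ^ (1 / (1 - a)), by positivity, ?_⟩
  rw [← Real.rpow_mul (by positivity), one_div_mul_cancel h1.ne', Real.rpow_one]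
  calc L * (η / (L + 1)) ≤ (L + 1) * (η / (L + 1)) := by gcongr; linarith
    _ = η := by field_simp

/-- Each path is Lipschitz, and a Lipschitz function has vanishing α-Hölder modulus for α < 1. -/
theorem partialSumPath_mem_little {Ω : Type*} (hα : α < 1) (T : Ω → Ω) (f : Ω → ℝ) (n : ℕ)
    (ω : Ω) : partialSumPath hα.le T f n ω ∈ little α := by
  intro ε hε
  have hα' : (α : ℝ) < 1 := hα
  have hL : 0 ≤ (n : ℝ) ^ (-(1 / 2) : ℝ) * n * ∑ j ∈ Finset.range n, |f (T^[j] ω)| :=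
    mul_nonneg (by positivity) (Finset.sum_nonneg fun _ _ => abs_nonneg _)
  obtain ⟨δ, hδ, hle⟩ := exists_pos_mul_rpow_le hα' hL hε
  refine ⟨δ, hδ, fun s t h0 h1 => ?_⟩
  rw [div_le_iff₀ (Real.rpow_pos_of_pos h0 _)]
  exact (abs_partialSumPath_sub_le_mul hα.le T f n ω s t).trans
    (mul_le_mul_rpow_of_le hα' h0.le h1.le hL hle hε.le)

theorem abs_partialSumPath_sub_le_of_holderMax_le {Ω : Type*} (hα0 : 0 < α) (hα : α ≤ 1)
    {T : Ω → Ω} {f : Ω → ℝ} {n l : ℕ} {ω : Ω} {Q : ℝ} (hQ0 : 0 ≤ Q) (hl : 1 ≤ l)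
    (hQ : holderMax α T f n l ω ≤ ENNReal.ofReal Q) {s t : I}
    (hst : (n : ℝ) * |(t : ℝ) - s| ≤ l) :
    |partialSumPath hα T f n ω t - partialSumPath hα T f n ω s| ≤
      3 * Q * ((n : ℝ) ^ (-(1 / 2) : ℝ) * (n : ℝ) ^ (α : ℝ)) * |(t : ℝ) - s| ^ (α : ℝ) := by
  wlog hle : s ≤ t generalizing s t
  · rw [abs_sub_comm, abs_sub_comm (t : ℝ)]
    exact this (by rwa [abs_sub_comm]) (not_le.1 hle).le
  have hle' : (s : ℝ) ≤ t := hle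
  have hinc : ∀ i j : ℕ, i < j → j ≤ n → j ≤ i + l →
      |∑ k ∈ Finset.range j, f (T^[k] ω) - ∑ k ∈ Finset.range i, f (T^[k] ω)| ≤
        Q * ((j : ℝ) - i) ^ (α : ℝ) := by
    intro i j hij hj hjl
    have hpos : (0 : ℝ) < (j : ℝ) - i := sub_pos.2 (by exact_mod_cast hij)
    have h1 := (ENNReal.ofReal_le_ofReal_iff hQ0).1 ((le_holderMax hij hj hjl).trans hQ)
    exact (div_le_iff₀ (Real.rpow_pos_of_pos hpos _)).1 h1
  have h0 : 0 ≤ (t : ℝ) - s := sub_nonneg.2 hle'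
  rw [abs_of_nonneg h0] at hst ⊢
  have key := abs_polygon_sub_le_rpow (fun k => f (T^[k] ω)) (NNReal.coe_pos.2 hα0) hα hQ0 hl hinc
    (u := n * s) (v := n * t) (mul_nonneg (Nat.cast_nonneg n) s.2.1) (by gcongr)
    (mul_le_of_le_one_right (Nat.cast_nonneg n) t.2.2) (by rwa [← mul_sub])
  rw [← mul_sub, Real.mul_rpow (Nat.cast_nonneg n) h0] at key
  rw [partialSumPath_apply, partialSumPath_apply, ← mul_sub, abs_mul,
    abs_of_nonneg (by positivity), partialSumProcess_eq_polygon, partialSumProcess_eq_polygon]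
  calc _ ≤ (n : ℝ) ^ (-(1 / 2) : ℝ) * (3 * Q * ((n : ℝ) ^ (α : ℝ) * ((t : ℝ) - s) ^ (α : ℝ))) := by
        gcongr
    _ = _ := by ring

end HolderSpace

/-! ### Tightness from bounds in mean -/

theorem measure_ofReal_le_le_of_lintegral_le {Ω : Type*} [MeasurableSpace Ω] {μ : Measure Ω}
    {F : Ω → ℝ≥0∞} (hF : Measurable F) {b ε : ℝ} (hb : 0 < b) (hε : 0 ≤ ε)
    (h : ∫⁻ ω, F ω ∂μ ≤ ENNReal.ofReal (ε * b)) :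
    μ {ω | ENNReal.ofReal b ≤ F ω} ≤ ENNReal.ofReal ε := by
  have hb' : ENNReal.ofReal b ≠ 0 := by simpa using hb
  refine (meas_ge_le_lintegral_div hF.aemeasurable hb' ENNReal.ofReal_ne_top).trans ?_
  rw [ENNReal.ofReal_mul hε] at h
  exact ENNReal.div_le_of_le_mul h

theorem exists_measure_lt_le {Ω : Type*} [MeasurableSpace Ω] {μ : Measure Ω} [IsFiniteMeasure μ]
    {L : Ω → ℝ} (hL : Measurable L) {ε : ℝ≥0∞} (hε : 0 < ε) :
    ∃ R : ℝ, 0 ≤ R ∧ μ {ω | R < L ω} ≤ ε := by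
  have ht : IsTightMeasureSet {μ.map L} := isTightMeasureSet_singleton
  rw [isTightMeasureSet_iff_exists_isCompact_measure_compl_le] at ht
  obtain ⟨K, hK, hKε⟩ := ht ε hε
  obtain ⟨R, hR⟩ := hK.isBounded.subset_closedBall 0
  refine ⟨max R 0, le_max_right _ _, le_trans ?_ (hKε _ rfl)⟩
  rw [Measure.map_apply hL hK.isClosed.measurableSet.compl]
  refine measure_mono fun ω hω hmem => ?_
  have h1 := hR hmem
  rw [mem_closedBall_zero_iff, Real.norm_eq_abs] at h1
  exact absurd (le_abs_self (L ω)) (not_le.2 (h1.trans_lt ((le_max_left R 0).trans_lt hω)))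

namespace HolderSpace

/-- The normalized partial sum processes are tight if their discrete Hölder maxima are bounded in
mean, and those over short blocks tend to zero in mean. -/
theorem isTightMeasureSet_partialSumPath {Ω : Type*} [MeasurableSpace Ω] {μ : Measure Ω}
    [IsFiniteMeasure μ] {α : ℝ≥0} (hα0 : 0 < α) (hα : α < 1) {q : ℝ} (hq : (α : ℝ) + q = 1 / 2)
    {T : Ω → Ω} {f : Ω → ℝ} (hT : Measurable T) (hf : Measurable f)
    (hbd : ∃ C : ℝ≥0∞, C ≠ ∞ ∧ ∀ n l : ℕ,
      ∫⁻ ω, holderMax α T f n l ω ∂μ ≤ C * ENNReal.ofReal ((n : ℝ) ^ q))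
    (hsm : ∀ ε : ℝ, 0 < ε → ∃ δ : ℝ, 0 < δ ∧ ∃ N : ℕ, ∀ n l : ℕ, N ≤ n → (l : ℝ) ≤ δ * n →
      ∫⁻ ω, holderMax α T f n l ω ∂μ ≤ ENNReal.ofReal (ε * (n : ℝ) ^ q)) :
    IsTightMeasureSet {ν | ∃ n : ℕ, 1 ≤ n ∧ ν = μ.map (partialSumPath hα.le T f n)} := by
  have hα' : (α : ℝ) < 1 := hα
  have hscale : ∀ n : ℕ, 1 ≤ n → ∀ A : ℝ, 3 * (A / 3 * (n : ℝ) ^ q) *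
      ((n : ℝ) ^ (-(1 / 2) : ℝ) * (n : ℝ) ^ (α : ℝ)) = A := by
    intro n hn A
    have hn0 : (0 : ℝ) < n := by exact_mod_cast hn
    have : (n : ℝ) ^ q * ((n : ℝ) ^ (-(1 / 2) : ℝ) * (n : ℝ) ^ (α : ℝ)) = 1 := by
      rw [← Real.rpow_add hn0, ← Real.rpow_add hn0,
        show q + (-(1 / 2) + (α : ℝ)) = 0 by linarith, Real.rpow_zero]
    linear_combination A * this
  refine isTightMeasureSet_of_modulus hα0 (measurable_partialSumPath hα.le hT hf)
    (partialSumPath_zero hα.le T f) ?_ ?_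
  · obtain ⟨C, hC, hbd⟩ := hbd
    intro ε hε
    have hε' : (0 : ℝ) < ε := hε
    -- Markov's inequality is applied at the level (A / 3) n^q: the 3 is the cost of interpolation,
    -- and C + 1 keeps A positive.
    refine ⟨3 * (C.toNNReal + 1) / ε, fun n hn => ?_⟩
    have hn0 : (0 : ℝ) < n := by exact_mod_cast hn
    set A : ℝ≥0 := 3 * (C.toNNReal + 1) / ε with hA
    have hA0 : (0 : ℝ) < A := by rw [hA]; push_cast; positivity
    have hb : 0 < (A : ℝ) / 3 * (n : ℝ) ^ q := by positivity
    have hint : ∫⁻ ω, holderMax α T f n n ω ∂μ ≤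
        ENNReal.ofReal (ε * ((A : ℝ) / 3 * (n : ℝ) ^ q)) := by
      refine (hbd n n).trans ?_
      rw [← ENNReal.coe_toNNReal hC, ← ENNReal.ofReal_coe_nnreal,
        ← ENNReal.ofReal_mul (NNReal.coe_nonneg _)]
      refine ENNReal.ofReal_le_ofReal ?_
      have e : (ε : ℝ) * ((A : ℝ) / 3 * (n : ℝ) ^ q) = (C.toNNReal + 1) * (n : ℝ) ^ q := by
        rw [hA]; push_cast; field_simp
      rw [e]
      gcongr
      linarith
    have hM := measure_ofReal_le_le_of_lintegral_le (measurable_holderMax hT hf) hb hε'.le hint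
    rw [ENNReal.ofReal_coe_nnreal] at hM
    refine (measure_mono fun ω hω => ?_).trans hM
    by_contra hcon
    refine hω fun s t => ?_
    have := abs_partialSumPath_sub_le_of_holderMax_le hα0 hα.le hb.le hn (not_le.1 hcon).le
      (s := s) (t := t) (mul_le_of_le_one_right (Nat.cast_nonneg n) (abs_sub_le_one s t))
    rwa [hscale n hn] at this
  · intro η hη ε hε
    have hε' : (0 : ℝ) < ε := hε
    -- For a single n the path has a finite random Lipschitz constant, bounded by some R outside a
    -- set of measure ε. This treats the finitely many n not covered by the asymptotic estimate.
    have hone : ∀ n : ℕ, ∃ δ : ℝ, 0 < δ ∧ μ {ω | ¬ ∀ s t : I, |(t : ℝ) - s| ≤ δ →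
        |partialSumPath hα.le T f n ω t - partialSumPath hα.le T f n ω s| ≤
          η * |(t : ℝ) - s| ^ (α : ℝ)} ≤ ε := by
      intro n
      have hm : Measurable fun ω =>
          (n : ℝ) ^ (-(1 / 2) : ℝ) * n * ∑ j ∈ Finset.range n, |f (T^[j] ω)| :=
        (Finset.measurable_fun_sum _ fun j _ =>
          (hf.comp (hT.iterate j)).abs).const_mul _
      obtain ⟨R, hR0, hR⟩ := exists_measure_lt_le (μ := μ) hm (ENNReal.coe_pos.2 hε)
      obtain ⟨δ, hδ, hle⟩ := exists_pos_mul_rpow_le hα' hR0 hη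
      refine ⟨δ, hδ, (measure_mono fun ω hω => ?_).trans hR⟩
      by_contra hcon
      refine hω fun s t hst => (abs_partialSumPath_sub_le_mul hα.le T f n ω s t).trans ?_
      refine le_trans ?_ (mul_le_mul_rpow_of_le hα' (abs_nonneg _) hst hR0 hle hη.le)
      gcongr
      exact not_lt.1 hcon
    have hmono : ∀ n : ℕ, ∀ δ δ' : ℝ, δ ≤ δ' → μ {ω | ¬ ∀ s t : I, |(t : ℝ) - s| ≤ δ →
        |partialSumPath hα.le T f n ω t - partialSumPath hα.le T f n ω s| ≤
          η * |(t : ℝ) - s| ^ (α : ℝ)} ≤ μ {ω | ¬ ∀ s t : I, |(t : ℝ) - s| ≤ δ' →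
        |partialSumPath hα.le T f n ω t - partialSumPath hα.le T f n ω s| ≤
          η * |(t : ℝ) - s| ^ (α : ℝ)} := by
      intro n δ δ' h
      exact measure_mono fun ω hω hcon => hω fun s t hst => hcon s t (hst.trans h)
    have hfin : ∀ N : ℕ, ∃ δ : ℝ, 0 < δ ∧ ∀ n, n < N → μ {ω | ¬ ∀ s t : I, |(t : ℝ) - s| ≤ δ →
        |partialSumPath hα.le T f n ω t - partialSumPath hα.le T f n ω s| ≤
          η * |(t : ℝ) - s| ^ (α : ℝ)} ≤ ε := by
      intro N
      induction N with
      | zero => exact ⟨1, one_pos, fun n hn => absurd hn (Nat.not_lt_zero n)⟩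
      | succ N ih =>
        obtain ⟨δ₁, h1, ih⟩ := ih
        obtain ⟨δ₂, h2, hN⟩ := hone N
        refine ⟨min δ₁ δ₂, lt_min h1 h2, fun n hn => ?_⟩
        rcases (Nat.lt_succ_iff.1 hn).eq_or_lt with rfl | hlt
        · exact (hmono _ _ _ (min_le_right _ _)).trans hN
        · exact (hmono _ _ _ (min_le_left _ _)).trans (ih n hlt)
    obtain ⟨δ₀, hδ₀, N, hN⟩ := hsm (ε * (η / 3)) (by positivity)
    -- For n ≥ 1 / δ₀ the integer part l of δ₀ n is at least 1, as the interpolation bound requires.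
    obtain ⟨δ₁, hδ₁, hlow⟩ := hfin (max N (⌈1 / δ₀⌉₊ + 1))
    refine ⟨min δ₁ (δ₀ / 2), lt_min hδ₁ (by positivity), fun n hn => ?_⟩
    rcases lt_or_ge n (max N (⌈1 / δ₀⌉₊ + 1)) with hlt | hge
    · exact (hmono _ _ _ (min_le_left _ _)).trans (hlow n hlt)
    refine (hmono _ _ _ (min_le_right _ _)).trans ?_
    have hn0 : (0 : ℝ) < n := by exact_mod_cast hn
    have hδn : 1 ≤ δ₀ * n := by
      have h1 : ⌈1 / δ₀⌉₊ ≤ n := (Nat.le_succ _).trans ((le_max_right _ _).trans hge)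
      have h2 : 1 / δ₀ ≤ n := (Nat.le_ceil _).trans (by exact_mod_cast h1)
      rw [div_le_iff₀ hδ₀] at h2
      linarith
    set l := ⌊δ₀ * n⌋₊ with hl
    have hl1 : 1 ≤ l := Nat.le_floor (by simpa using hδn)
    have hint := hN n l ((le_max_left _ _).trans hge) (Nat.floor_le (by positivity))
    have hb : 0 < η / 3 * (n : ℝ) ^ q := by positivity
    rw [mul_assoc] at hint
    have hM := measure_ofReal_le_le_of_lintegral_le (measurable_holderMax hT hf) hb hε'.le hint
    rw [ENNReal.ofReal_coe_nnreal] at hM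
    refine (measure_mono fun ω hω => ?_).trans hM
    by_contra hcon
    refine hω fun s t hst => ?_
    -- From l > δ₀ n - 1 and l ≥ 1 follows l ≥ δ₀ n / 2; this is why δ₀ was halved.
    have hsl : (n : ℝ) * |(t : ℝ) - s| ≤ l := by
      have h1 : δ₀ * n < l + 1 := Nat.lt_floor_add_one _
      have h2 : (1 : ℝ) ≤ l := by exact_mod_cast hl1
      have h3 : (n : ℝ) * |(t : ℝ) - s| ≤ n * (δ₀ / 2) := by gcongr
      linarith
    have := abs_partialSumPath_sub_le_of_holderMax_le hα0 hα.le hb.le hl1 (not_le.1 hcon).le hsl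
    rwa [hscale n hn] at this

end HolderSpace

/-! ### The tightness theorem -/

theorem ConditionC.lintegral_holderMax {Ω : Type*} {𝓜 : MeasurableSpace Ω}
    {mΩ : MeasurableSpace Ω} {μ : Measure Ω} [IsProbabilityMeasure μ] {T : Ω ≃ᵐ Ω}
    {hT : MeasurePreserving T μ μ} {h𝓜 : 𝓜 ≤ mΩ}
    {hT𝓜 : ∀ A, MeasurableSet[𝓜] A → MeasurableSet[𝓜] (T '' A)} {p : ℝ}
    {H : Submodule ℝ (Lp ℝ (ENNReal.ofReal p) μ)} {P : ℕ → Module.End ℝ H}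
    (hC : ConditionC 𝓜 T hT h𝓜 hT𝓜 H P) (hp : 2 < p) (h : H) (hh : mwNorm (P 1) h < ∞) :
    (∃ C : ℝ≥0∞, C ≠ ∞ ∧ ∀ n l : ℕ,
      ∫⁻ ω, holderMax (1 / 2 - 1 / p) T (h : Lp ℝ (ENNReal.ofReal p) μ) n l ω ∂μ ≤
        C * ENNReal.ofReal ((n : ℝ) ^ (1 / p))) ∧
    ∀ ε : ℝ, 0 < ε → ∃ δ : ℝ, 0 < δ ∧ ∃ N : ℕ, ∀ n l : ℕ, N ≤ n → (l : ℝ) ≤ δ * n →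
      ∫⁻ ω, holderMax (1 / 2 - 1 / p) T (h : Lp ℝ (ENNReal.ofReal p) μ) n l ω ∂μ ≤
        ENNReal.ofReal (ε * (n : ℝ) ^ (1 / p)) := by
  obtain ⟨τ, g, D, K, G, hcas, hτ, hg, htail⟩ := hC.exists_isCascade (by linarith) h hh
  rw [← hτ, ← hg]
  refine ⟨?_, fun ε hε => hcas.lintegral_small hp htail hε⟩
  obtain ⟨C, hC', hbd⟩ := hcas.exists_lintegral_le_tailSum hp
  refine ⟨C * IsCascade.tailSum μ p g 0, ENNReal.mul_ne_top hC' htail, fun n l => ?_⟩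
  rw [mul_right_comm]
  exact hbd n 0 l

theorem mainTheorem4 {Ω : Type*} (𝓜 : MeasurableSpace Ω) {mΩ : MeasurableSpace Ω}
    (μ : Measure Ω) [IsProbabilityMeasure μ]
    (T : Ω ≃ᵐ Ω) (hT : MeasurePreserving T μ μ) (h𝓜 : 𝓜 ≤ mΩ)
    (hT𝓜 : ∀ A, MeasurableSet[𝓜] A → MeasurableSet[𝓜] (T '' A))
    (p : ℝ) (hp : 2 < p)
    (H : Submodule ℝ (Lp ℝ (ENNReal.ofReal p) μ)) (P : ℕ → Module.End ℝ H)
    (hC : ConditionC 𝓜 T hT h𝓜 hT𝓜 H P)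
    (h : H) (hh : mwNorm (P 1) h < ∞) :
    ∃ ξ : ℕ → Ω → HolderSpace (Real.toNNReal (1 / 2 - 1 / p)),
      (∀ n ω t, ξ n ω t =
        (n : ℝ) ^ (-(1 / 2) : ℝ) *
          partialSumProcess T (h : Lp ℝ (ENNReal.ofReal p) μ) n ω t) ∧
      (∀ n ω, ξ n ω ∈ HolderSpace.little (Real.toNNReal (1 / 2 - 1 / p))) ∧
      (∀ n, Measurable (ξ n)) ∧
      IsTightMeasureSet {ν | ∃ n : ℕ, 1 ≤ n ∧ ν = μ.map (ξ n)} := by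
  have hp0 : 0 < p := by linarith
  have hpos : 0 < 1 / 2 - 1 / p := by
    have := one_div_lt_one_div_of_lt two_pos hp
    linarith
  have hα0 : 0 < Real.toNNReal (1 / 2 - 1 / p) := Real.toNNReal_pos.2 hpos
  have hcoe : ((Real.toNNReal (1 / 2 - 1 / p) : ℝ≥0) : ℝ) = 1 / 2 - 1 / p :=
    Real.coe_toNNReal _ hpos.le
  have hα1 : Real.toNNReal (1 / 2 - 1 / p) < 1 := by
    rw [← NNReal.coe_lt_coe, hcoe, NNReal.coe_one]
    have := one_div_pos.2 hp0
    linarith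
  have hmeas : Measurable (h : Lp ℝ (ENNReal.ofReal p) μ) := (Lp.stronglyMeasurable _).measurable
  obtain ⟨hbd, hsm⟩ := hC.lintegral_holderMax hp h hh
  rw [← hcoe] at hbd hsm
  exact ⟨HolderSpace.partialSumPath hα1.le T (h : Lp ℝ (ENNReal.ofReal p) μ),
    HolderSpace.partialSumPath_apply hα1.le T _,
    HolderSpace.partialSumPath_mem_little hα1 T _,
    HolderSpace.measurable_partialSumPath hα1.le T.measurable hmeas,
    HolderSpace.isTightMeasureSet_partialSumPath hα0 hα1 (by rw [hcoe]; ring) T.measurable hmeas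
      hbd hsm⟩
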